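/- **Setting.** Let $d,T\ge 1$. In rounds $t=1,\dots,T$ a learner picks an action $X_t$ from a decision set $D_t\subseteq\mathbb R^d$ and observes $Y_t=\langle X_t,\theta_t\rangle+\eta_t$. The sequences $(D_t)$ and $(\theta_t)$ are fixed in advance, with $\|x\|\le L$, $\|\theta_t\|\le S$ and $|\langle x,\theta_t\rangle|\le 1$ for all $x\in D_t$ and all $t$. The noise terms $\eta_t$ are i.i.d. with $\mathbf E[e^{u\eta_t}]\le e^{u^2R^2/2}$ for all $u\in\mathbb R$, and $\eta_t$ is independent of everything up to and including the choice of $X_t$. For $B_T\ge 0$ let $\Theta(B_T)$ be the set of parameter sequences with $\sum_{t=1}^{T-1}\|\theta_{t+1}-\theta_t\|\le B_T$. The dynamic regret is $$\mathcal R_T=\sup_{\theta_{1:T}\in\Theta(B_T)}\mathbf E\Big[\sum_{t=1}^T\Big(\sup_{x\in D_t}\langle x,\theta_t\rangle-\langle X_t,\theta_t\rangle\Big)\Big].$$ **Bandit-over-Bandit (BOB) algorithm.** It knows $d,T,R,L,S$ and a constant $\lambda>0$, but not $B_T$. Put $$H=\lfloor d^{2/3}T^{1/2}\rfloor,\quad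 \Delta=\lceil\ln H\rceil,\quad \gamma=\min\Big\{1,\sqrt{\tfrac{(\Delta+1)\ln(\Delta+1)}{(e-1)\lceil T/H\rceil}}\Big\},\quad s_{j,1}=1\ \ (0\le j\le\Delta),$$ and divide the rounds into $\lceil T/H\rceil$ consecutive blocks of length $H$ (the last one may be shorter). At the start of block $i$, draw $j_i=j$ with conditional probability, given the past, $$p_{j,i}=(1-\gamma)\frac{s_{j,i}}{\sum_{u=0}^{\Delta}s_{u,i}}+\frac{\gamma}{\Delta+1},$$ and set $w_i=\lfloor H^{j_i/\Delta}\rfloor$ (if $H=1$, so that $\Delta=0$, then $w_i=1$). In every round $t$ of block $i$, whose first round is $(i-1)H+1$, let $W_t=\{s:\max((i-1)H+1,\,t-w_i)\le s\le t-1\}$, $V_{t-1}=\lambda I+\sum_{s\in W_t}X_sX_s^\top$ and $\hat\theta_t=V_{t-1}^{-1}\sum_{s\in W_t}X_sY_s$, and let $X_t$ be a maximizer over $x\in D_t$, ties being broken in any non-anticipating way, of $$x^\top\hat\theta_t+\sqrt{x^\top V_{t-1}^{-1}x}\,\Big[R\sqrt{d\ln\big(T(1+w_iL^2/\lambda)\big)}+\sqrt\lambda\,S\Big]$$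 (it is understood that a maximizer exists). After block $i$, put $$s_{j_i,i+1}=s_{j_i,i}\exp\Big(\frac{\gamma}{(\Delta+1)p_{j_i,i}}\Big(\frac12+\frac{\sum_{t\text{ in block }i}Y_t}{2H+4R\sqrt{H\ln(T/\sqrt H)}}\Big)\Big),\qquad s_{u,i+1}=s_{u,i}\ \ (u\ne j_i),$$ where the root is read as $0$ if $T<\sqrt H$. **Theorem.** The BOB algorithm has dynamic regret $\widetilde O\big(d^{2/3}(B_T+1)^{1/4}T^{3/4}\big)$. Precisely: there is an absolute constant $k\in\mathbb N$, and for all $R\ge 0$ and $L,S,\lambda>0$ there is a constant $C$ depending only on $R,L,S,\lambda$, such that for all $d,T\ge 1$, all $B_T\ge 0$, all decision sets and all noise laws as above, $$\mathcal R_T(\mathrm{BOB})\le C\,d^{2/3}(B_T+1)^{1/4}T^{3/4}(1+\ln T)^k .$$ -/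

import Mathlib

open MeasureTheory ProbabilityTheory
open scoped NNReal Matrix

noncomputable section

namespace BOB

/-! Rounds and blocks are numbered from `0`: the rounds are `0, …, T - 1`, and the rounds of block
`i` are `i * H, …, min ((i + 1) * H) T - 1`, where `H` is the block length. -/

/-- The space `ℝ^d` with the Euclidean norm and inner product. -/
abbrev Vec (d : ℕ) : Type := EuclideanSpace ℝ (Fin d)

/-! ### The drifting linear bandit -/

/-- Standing assumptions on decision sets `D` and parameters `θ`: actions have norm at most `L`,
parameters have norm at most `S`, and mean rewards lie in `[-1, 1]`. -/
structure IsNormalized {d : ℕ} (T : ℕ) (L S : ℝ) (D : ℕ → Set (Vec d)) (θ : ℕ → Vec d) : Prop where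
  norm_action_le : ∀ t < T, ∀ x ∈ D t, ‖x‖ ≤ L
  norm_param_le : ∀ t < T, ‖θ t‖ ≤ S
  abs_reward_le : ∀ t < T, ∀ x ∈ D t, |inner ℝ x (θ t)| ≤ 1

/-- The class `Θ(B)` of parameter sequences whose total variation over the `T` rounds is at most
the variation budget `B`. -/
def variationClass (d T : ℕ) (B : ℝ) : Set (ℕ → Vec d) :=
  {θ | ∑ t ∈ Finset.range (T - 1), ‖θ (t + 1) - θ t‖ ≤ B}

/-- The reward observed in round `t`. -/
def reward {d : ℕ} (θ X : ℕ → Vec d) (η : ℕ → ℝ) (t : ℕ) : ℝ :=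
  inner ℝ (X t) (θ t) + η t

/-- The largest mean reward available in round `t`. -/
def optimalReward {d : ℕ} (D : ℕ → Set (Vec d)) (θ : ℕ → Vec d) (t : ℕ) : ℝ :=
  sSup ((fun x => inner ℝ x (θ t)) '' D t)

/-- The expected dynamic regret over `T` rounds of the random actions `X`, in the environment with
decision sets `D` and parameters `θ`. -/
def expectedRegret {d : ℕ} {Ω : Type*} [MeasurableSpace Ω] (P : Measure Ω) (T : ℕ)
    (D : ℕ → Set (Vec d)) (θ : ℕ → Vec d) (X : ℕ → Ω → Vec d) : ℝ :=
  ∫ ω, ∑ t ∈ Finset.range T, (optimalReward D θ t - inner ℝ (X t ω) (θ t)) ∂P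

/-! ### Parameters of the algorithm -/

/-- The block length `H = ⌊d^(2/3) T^(1/2)⌋`. -/
def blockLength (d T : ℕ) : ℕ := ⌊(d : ℝ) ^ (2 / 3 : ℝ) * (T : ℝ) ^ (1 / 2 : ℝ)⌋₊

/-- The grid parameter `Δ = ⌈ln H⌉`. -/
def gridSize (d T : ℕ) : ℕ := ⌈Real.log (blockLength d T)⌉₊

/-- The indices `0, …, Δ` of the candidate window lengths. -/
abbrev Arm (d T : ℕ) : Type := Fin (gridSize d T + 1)

/-- The candidate window length `⌊H^(j/Δ)⌋`. -/
def windowLength (d T : ℕ) (j : Arm d T) : ℕ :=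
  ⌊(blockLength d T : ℝ) ^ ((j : ℝ) / (gridSize d T : ℝ))⌋₊

/-- The number of blocks `⌈T / H⌉`. -/
def numBlocks (d T : ℕ) : ℕ := ⌈(T : ℝ) / (blockLength d T : ℝ)⌉₊

/-- The exploration rate `γ` of EXP3. -/
def exploration (d T : ℕ) : ℝ :=
  min 1 (Real.sqrt (((gridSize d T : ℝ) + 1) * Real.log ((gridSize d T : ℝ) + 1) /
    ((Real.exp 1 - 1) * (numBlocks d T : ℝ))))

/-! ### EXP3 over the window lengths -/

/-- The EXP3 probability of arm `j` when the weights are `s`. -/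
def exp3Prob (d T : ℕ) (s : Arm d T → ℝ) (j : Arm d T) : ℝ :=
  (1 - exploration d T) * (s j / ∑ u, s u) + exploration d T / ((gridSize d T : ℝ) + 1)

/-- The total reward collected in block `i`, from the sequence `Y` of observed rewards. -/
def blockReward (d T : ℕ) (Y : ℕ → ℝ) (i : ℕ) : ℝ :=
  ∑ t ∈ Finset.Ico (i * blockLength d T) (min ((i + 1) * blockLength d T) T), Y t

/-- The block reward, rescaled so as to lie in `[0, 1]` with high probability. -/
def scaledBlockReward (d T : ℕ) (R : ℝ≥0) (Y : ℕ → ℝ) (i : ℕ) : ℝ :=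
  1 / 2 + blockReward d T Y i /
    (2 * (blockLength d T : ℝ) + 4 * (R : ℝ) * Real.sqrt ((blockLength d T : ℝ) *
      Real.log ((T : ℝ) / Real.sqrt (blockLength d T : ℝ))))

/-- The EXP3 weights at the start of block `i`, from the chosen arms `a` and the observed
rewards `Y`. -/
def exp3Weight (d T : ℕ) (R : ℝ≥0) (a : ℕ → Arm d T) (Y : ℕ → ℝ) : ℕ → Arm d T → ℝ
  | 0, _ => 1
  | i + 1, j =>
    if j = a i then
      exp3Weight d T R a Y i j *
        Real.exp (exploration d T /
            (((gridSize d T : ℝ) + 1) * exp3Prob d T (exp3Weight d T R a Y i) j) *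
          scaledBlockReward d T R Y i)
    else exp3Weight d T R a Y i j

/-! ### SW-UCB inside a block -/

/-- The rounds used in round `t` by SW-UCB with window length `w`, started afresh at the beginning
of the block that contains `t`. -/
def windowRounds (d T w t : ℕ) : Finset ℕ :=
  Finset.Ico (max (t / blockLength d T * blockLength d T) (t - w)) t

/-- The regularized Gram matrix. -/
def gram (d T : ℕ) (lam : ℝ) (w : ℕ) (X : ℕ → Vec d) (t : ℕ) : Matrix (Fin d) (Fin d) ℝ :=
  lam • (1 : Matrix (Fin d) (Fin d) ℝ) +
    ∑ s ∈ windowRounds d T w t, Matrix.vecMulVec (X s).ofLp (X s).ofLp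

/-- The sliding window regularized least squares estimate in round `t`. -/
def estimate (d T : ℕ) (lam : ℝ) (w : ℕ) (X : ℕ → Vec d) (Y : ℕ → ℝ) (t : ℕ) : Fin d → ℝ :=
  (gram d T lam w X t)⁻¹ *ᵥ ∑ s ∈ windowRounds d T w t, Y s • (X s).ofLp

/-- The confidence radius `R √(d ln (T (1 + w L² / λ))) + √λ S`. -/
def radius (d T : ℕ) (R : ℝ≥0) (L S lam : ℝ) (w : ℕ) : ℝ :=
  (R : ℝ) * Real.sqrt ((d : ℝ) * Real.log ((T : ℝ) * (1 + (w : ℝ) * L ^ 2 / lam))) +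
    Real.sqrt lam * S

/-- The upper confidence bound of action `x` in round `t`. -/
def ucb (d T : ℕ) (R : ℝ≥0) (L S lam : ℝ) (w : ℕ) (X : ℕ → Vec d) (Y : ℕ → ℝ) (t : ℕ)
    (x : Vec d) : ℝ :=
  x.ofLp ⬝ᵥ estimate d T lam w X Y t +
    Real.sqrt (x.ofLp ⬝ᵥ ((gram d T lam w X t)⁻¹ *ᵥ x.ofLp)) * radius d T R L S lam w

/-! ### Runs of the Bandit-over-Bandit algorithm -/

/-- `arm`, `X` and `η` are the arms (one for each block), actions and noise terms of a run of the
Bandit-over-Bandit algorithm with EXP3 over blocks and SW-UCB inside blocks, in the environment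
with decision sets `D`, parameters `θ` and noise law `ν`.

In the filtration `𝓕`, time `2 * t` is the start of round `t`, before the algorithm makes a
random draw, and time `2 * t + 1` is the moment when the action of round `t` has been chosen and
its noise has not been drawn. Ties in the maximization may be broken in any non-anticipating way. -/
structure IsRun (d T : ℕ) (R : ℝ≥0) (L S lam : ℝ) (D : ℕ → Set (Vec d)) (θ : ℕ → Vec d)
    (ν : Measure ℝ) {Ω : Type*} {mΩ : MeasurableSpace Ω} (P : Measure Ω) (𝓕 : Filtration ℕ mΩ)
    (arm : ℕ → Ω → Arm d T) (X : ℕ → Ω → Vec d) (η : ℕ → Ω → ℝ) : Prop where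
  /-- The noise of round `t` is observed, through the reward, before round `t + 1`. -/
  measurable_noise : ∀ t < T, Measurable[𝓕 (2 * t + 2)] (η t)
  /-- The noise terms all have the law `ν`. -/
  law_noise : ∀ t < T, P.map (η t) = ν
  /-- The noise of a round is independent of all that happened before (in particular, the noise
  terms are i.i.d.). -/
  indep_noise : ∀ t < T, Indep (MeasurableSpace.comap (η t) inferInstance) (𝓕 (2 * t + 1)) P
  /-- The arm of a block is drawn at the start of its first round. -/
  measurable_arm : ∀ i < numBlocks d T, Measurable[𝓕 (2 * (i * blockLength d T) + 1)] (arm i)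
  /-- Given the past, the arm of block `i` is drawn from the EXP3 distribution. -/
  law_arm : ∀ i < numBlocks d T, ∀ j : Arm d T,
    P[(arm i ⁻¹' {j}).indicator (fun _ => (1 : ℝ)) | 𝓕 (2 * (i * blockLength d T))] =ᵐ[P]
      fun ω => exp3Prob d T
        (exp3Weight d T R (fun k => arm k ω)
          (reward θ (fun s => X s ω) (fun s => η s ω)) i) j
  /-- Actions are non-anticipating. -/
  measurable_action : ∀ t < T, Measurable[𝓕 (2 * t + 1)] (X t)
  /-- Actions are feasible. -/
  action_mem : ∀ t < T, ∀ ω, X t ω ∈ D t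
  /-- The action of round `t` maximizes the upper confidence bound computed with the window length
  of the block of `t`. -/
  action_isMaxOn : ∀ t < T, ∀ ω,
    IsMaxOn
      (ucb d T R L S lam (windowLength d T (arm (t / blockLength d T) ω)) (fun s => X s ω)
        (reward θ (fun s => X s ω) (fun s => η s ω)) t)
      (D t) (X t ω)

end BOB

end

noncomputable section

namespace BOB

/-! ### Positive definite quadratic forms -/

section PosDef

variable {n : Type*} [Fintype n] {V : Matrix n n ℝ}

/-! The regret splits into the cost of the best window length on the grid and the cost of EXP3 for
not knowing it.

Fixed window `w`. The error of the ridge estimate at `x` is at most the inverse-Gram norm of `x`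
times the sum of a noise term, a drift term `L √w · (drift in the window)` and `√λ S`
(`abs_estimate_sub_le`). Charging the drift in full would be too expensive in `d`. But the
confidence radius asks for more certainty than the proof needs: noise control with failure
probability `T^(-1/4)` suffices, which leaves a slack of order `√d` in the radius
(`exists_radius_slack`). If the drift term fits in the slack, optimism survives and the drift is
free; otherwise the trivial gap 2 is already at most a constant times `√w · drift / √d`
(`exists_round_gap_le`). Summing with the elliptical potential gives, up to logarithms, `d T / √w +
w^(3/2) B / √d` over all blocks (`exists_block_gap_le`). If `R = 0` there is no slack, but the
radius has no factor `√d` either, and the sum is `√d T / √w + w^(3/2) B`; `radiusScale` treats both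
cases at once. Rounds with excessive noise contribute order `T^(3/4)`.

Noise. A Gaussian mixture supermartingale, advanced one round at a time, controls the
self-normalized noise. It is integrated against an arbitrary nonnegative weight known when the
window opens (`IsRun.lintegral_noiseMixture_le`), so it can be used under the importance weights of
EXP3.

EXP3. No counterfactual run with a fixed window is needed. The importance weight `Z` of arm `j` has
mean one and vanishes unless `j` was drawn; when `j` is drawn, the block really is SW-UCB with that
window, restarted. Hence `Z · blockGap` has expectation at most the deterministic block bound plus
the cost of bad noise. The path inequality `sum_blockGap_le` holds on every path: its term `(1 -
Z)(optimum + noise)` integrates to zero, and the paths whose rescaled rewards may leave `[0, 1]` pay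
a penalty with small expectation (`IsRun.sum_integral_blockGap_le`).

Tuning. The grid is geometric with ratio at most `e`, so some arm is within a constant of the wanted
`w`: `d^(2/3) T^(1/2) (B + 1)^(-1/2)` for `R ≠ 0` and `T^(1/2) (B + 1)^(-1/2)` for `R = 0`. When `T`
is small, or `d` or `B` is large compared with `T`, or the exploration rate is 1, the trivial bound
`2 T` is already good enough. -/

theorem PosDef.mulVec_symm (hV : V.PosDef) (x y : n → ℝ) :
    x ⬝ᵥ (V *ᵥ y) = y ⬝ᵥ (V *ᵥ x) := by
  have h : Vᵀ = V := by
    have := hV.isHermitian.eq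
    rwa [Matrix.conjTranspose_eq_transpose_of_trivial] at this
  rw [Matrix.dotProduct_mulVec, ← Matrix.mulVec_transpose, h, dotProduct_comm]

theorem PosDef.quad_nonneg (hV : V.PosDef) (x : n → ℝ) : 0 ≤ x ⬝ᵥ (V *ᵥ x) := by
  simpa using hV.posSemidef.dotProduct_mulVec_nonneg x

/-- Cauchy–Schwarz, from the sign of the discriminant of the quadratic polynomial `r ↦ (x + r y)ᵀ V
(x + r y)`. -/
theorem PosDef.sq_quad_le (hV : V.PosDef) (x y : n → ℝ) :
    (x ⬝ᵥ (V *ᵥ y)) ^ 2 ≤ (x ⬝ᵥ (V *ᵥ x)) * (y ⬝ᵥ (V *ᵥ y)) := by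
  have h : ∀ r : ℝ, 0 ≤ (y ⬝ᵥ (V *ᵥ y)) * (r * r) + (2 * (x ⬝ᵥ (V *ᵥ y))) * r
      + x ⬝ᵥ (V *ᵥ x) := by
    intro r
    have h1 := PosDef.quad_nonneg hV (x + r • y)
    have h2 := PosDef.mulVec_symm hV x y
    simp only [Matrix.mulVec_add, Matrix.mulVec_smul, dotProduct_add, add_dotProduct,
      dotProduct_smul, smul_dotProduct, smul_eq_mul, ← h2] at h1
    linarith
  have := discrim_le_zero h
  unfold discrim at this
  nlinarith

variable [DecidableEq n]

theorem PosDef.mulVec_inv_mulVec (hV : V.PosDef) (x : n → ℝ) : V *ᵥ (V⁻¹ *ᵥ x) = x := by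
  rw [Matrix.mulVec_mulVec, Matrix.mul_nonsing_inv _ hV.det_pos.ne'.isUnit, Matrix.one_mulVec]

theorem PosDef.inv_mulVec_mulVec (hV : V.PosDef) (x : n → ℝ) : V⁻¹ *ᵥ (V *ᵥ x) = x := by
  rw [Matrix.mulVec_mulVec, Matrix.nonsing_inv_mul _ hV.det_pos.ne'.isUnit, Matrix.one_mulVec]

/-- Duality between the norms of `V` and `V⁻¹`: Cauchy–Schwarz for `V` applied to `V⁻¹ x` and `z`.
-/
theorem PosDef.sq_dot_le (hV : V.PosDef) (x z : n → ℝ) :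
    (x ⬝ᵥ z) ^ 2 ≤ (x ⬝ᵥ (V⁻¹ *ᵥ x)) * (z ⬝ᵥ (V *ᵥ z)) := by
  have h := PosDef.sq_quad_le hV (V⁻¹ *ᵥ x) z
  rw [PosDef.mulVec_symm hV (V⁻¹ *ᵥ x) z, PosDef.mulVec_inv_mulVec hV,
    dotProduct_comm z x, dotProduct_comm (V⁻¹ *ᵥ x) x] at h
  exact h

/-- Comparison of inverse quadratic forms from a comparison of the forms. -/
theorem PosDef.inv_quad_le {W : Matrix n n ℝ} (hV : V.PosDef) (hW : W.PosDef)
    (h : ∀ z, z ⬝ᵥ (V *ᵥ z) ≤ z ⬝ᵥ (W *ᵥ z)) (x : n → ℝ) :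
    x ⬝ᵥ (W⁻¹ *ᵥ x) ≤ x ⬝ᵥ (V⁻¹ *ᵥ x) := by
  -- The test vector `z = W⁻¹ x` gives `(xᵀ W⁻¹ x)² ≤ (xᵀ V⁻¹ x)(zᵀ V z) ≤ (xᵀ V⁻¹ x)(xᵀ W⁻¹ x)`;
  -- one factor then cancels.
  have h1 := PosDef.sq_dot_le hV x (W⁻¹ *ᵥ x)
  have h2 := h (W⁻¹ *ᵥ x)
  rw [PosDef.mulVec_inv_mulVec hW, dotProduct_comm (W⁻¹ *ᵥ x) x] at h2
  have h3 : 0 ≤ x ⬝ᵥ (V⁻¹ *ᵥ x) := PosDef.quad_nonneg hV.inv x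
  have h4 : 0 ≤ x ⬝ᵥ (W⁻¹ *ᵥ x) := PosDef.quad_nonneg hW.inv x
  by_contra hc
  push Not at hc
  nlinarith [mul_le_mul_of_nonneg_left h2 h3]

theorem PosDef.abs_dot_le (hV : V.PosDef) (x y : n → ℝ) :
    |x ⬝ᵥ (V⁻¹ *ᵥ y)| ≤ √(x ⬝ᵥ (V⁻¹ *ᵥ x)) * √(y ⬝ᵥ (V⁻¹ *ᵥ y)) := by
  rw [← Real.sqrt_mul (PosDef.quad_nonneg hV.inv x)]
  exact Real.abs_le_sqrt (PosDef.sq_quad_le hV.inv x y)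

/-- The matrix determinant lemma. It drives both the elliptical potential and the normalization of
the mixture supermartingale. -/
theorem PosDef.det_add_vecMulVec (hV : V.PosDef) (x : n → ℝ) :
    (V + Matrix.vecMulVec x x).det = V.det * (1 + x ⬝ᵥ (V⁻¹ *ᵥ x)) := by
  have h := Matrix.det_add_replicateCol_mul_replicateRow (ι := Unit) hV.det_pos.ne'.isUnit x x
  rw [Matrix.vecMulVec_eq Unit, h]
  congr 1
  rw [Matrix.det_unique]
  simp [Matrix.mul_apply, dotProduct, Matrix.mulVec, Finset.sum_mul, Finset.mul_sum]
  rw [Finset.sum_comm]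
  refine Finset.sum_congr rfl fun i _ => Finset.sum_congr rfl fun j _ => by ring

/-- The rank one update of the inverse quadratic form. -/
theorem PosDef.inv_quad_add_vecMulVec (hV : V.PosDef) (x y : n → ℝ)
    (hW : (V + Matrix.vecMulVec x x).PosDef) :
    y ⬝ᵥ ((V + Matrix.vecMulVec x x)⁻¹ *ᵥ y) =
      y ⬝ᵥ (V⁻¹ *ᵥ y) - (x ⬝ᵥ (V⁻¹ *ᵥ y)) ^ 2 / (1 + x ⬝ᵥ (V⁻¹ *ᵥ x)) := by
  have ha : 0 ≤ x ⬝ᵥ (V⁻¹ *ᵥ x) := PosDef.quad_nonneg hV.inv x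
  -- Sherman–Morrison: `c` is the coefficient for which `V⁻¹ y - c V⁻¹ x` solves the updated linear
  -- system.
  set c := (x ⬝ᵥ (V⁻¹ *ᵥ y)) / (1 + x ⬝ᵥ (V⁻¹ *ᵥ x)) with hc
  have hz : (V + Matrix.vecMulVec x x) *ᵥ (V⁻¹ *ᵥ y - c • (V⁻¹ *ᵥ x)) = y := by
    rw [Matrix.add_mulVec, Matrix.mulVec_sub, Matrix.mulVec_smul, PosDef.mulVec_inv_mulVec hV,
      PosDef.mulVec_inv_mulVec hV, Matrix.vecMulVec_mulVec]
    simp only [dotProduct_sub, dotProduct_smul, smul_eq_mul, op_smul_eq_smul]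
    have : x ⬝ᵥ (V⁻¹ *ᵥ y) - c * (x ⬝ᵥ (V⁻¹ *ᵥ x)) = c := by
      rw [hc]; field_simp; ring
    rw [this]; simp
  have hz' : (V + Matrix.vecMulVec x x)⁻¹ *ᵥ y = V⁻¹ *ᵥ y - c • (V⁻¹ *ᵥ x) := by
    conv_lhs => rw [← hz]
    rw [PosDef.inv_mulVec_mulVec hW]
  rw [hz', dotProduct_sub, dotProduct_smul, PosDef.mulVec_symm hV.inv y x, smul_eq_mul, hc]
  ring

end PosDef

/-! ### Ridge regression matrices -/

section Ridge

variable {d : ℕ}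

/-- The regularized Gram matrix of the vectors `X s`, `s ∈ I`. -/
def ridge (lam : ℝ) (X : ℕ → Fin d → ℝ) (I : Finset ℕ) : Matrix (Fin d) (Fin d) ℝ :=
  lam • (1 : Matrix (Fin d) (Fin d) ℝ) + ∑ s ∈ I, Matrix.vecMulVec (X s) (X s)

theorem ridge_mulVec (lam : ℝ) (X : ℕ → Fin d → ℝ) (I : Finset ℕ) (z : Fin d → ℝ) :
    ridge lam X I *ᵥ z = lam • z + ∑ s ∈ I, (X s ⬝ᵥ z) • X s := by
  rw [ridge, Matrix.add_mulVec, Matrix.sum_mulVec]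
  simp [Matrix.vecMulVec_mulVec, Matrix.smul_mulVec]

theorem ridge_quad (lam : ℝ) (X : ℕ → Fin d → ℝ) (I : Finset ℕ) (y z : Fin d → ℝ) :
    y ⬝ᵥ (ridge lam X I *ᵥ z) = lam * (y ⬝ᵥ z) + ∑ s ∈ I, (X s ⬝ᵥ y) * (X s ⬝ᵥ z) := by
  rw [ridge_mulVec, dotProduct_add, dotProduct_smul, dotProduct_sum, smul_eq_mul]
  congr 1
  refine Finset.sum_congr rfl fun s _ => ?_
  rw [dotProduct_smul, smul_eq_mul, dotProduct_comm y, mul_comm]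

theorem ridge_isHermitian (lam : ℝ) (X : ℕ → Fin d → ℝ) (I : Finset ℕ) :
    (ridge lam X I).IsHermitian := by
  ext i j
  simp [ridge, Matrix.sum_apply, Matrix.vecMulVec_apply, Matrix.one_apply, mul_comm, eq_comm]

theorem ridge_posDef {lam : ℝ} (hlam : 0 < lam) (X : ℕ → Fin d → ℝ) (I : Finset ℕ) :
    (ridge lam X I).PosDef := by
  refine Matrix.PosDef.of_dotProduct_mulVec_pos (ridge_isHermitian lam X I) fun x hx => ?_
  rw [star_trivial, ridge_quad]
  have h1 : 0 < x ⬝ᵥ x := by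
    have := Matrix.dotProduct_star_self_pos_iff (v := x)
    rw [star_trivial] at this
    exact this.2 hx
  have h2 : 0 ≤ ∑ s ∈ I, (X s ⬝ᵥ x) * (X s ⬝ᵥ x) :=
    Finset.sum_nonneg fun s _ => mul_self_nonneg _
  positivity

theorem ridge_inv_quad_nonneg {lam : ℝ} (hlam : 0 < lam) (X : ℕ → Fin d → ℝ) (I : Finset ℕ)
    (x : Fin d → ℝ) : 0 ≤ x ⬝ᵥ ((ridge lam X I)⁻¹ *ᵥ x) :=
  PosDef.quad_nonneg (ridge_posDef hlam X I).inv x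

theorem ridge_inv_quad_anti {lam : ℝ} (hlam : 0 < lam) (X : ℕ → Fin d → ℝ) {I J : Finset ℕ}
    (h : I ⊆ J) (x : Fin d → ℝ) :
    x ⬝ᵥ ((ridge lam X J)⁻¹ *ᵥ x) ≤ x ⬝ᵥ ((ridge lam X I)⁻¹ *ᵥ x) := by
  refine PosDef.inv_quad_le (ridge_posDef hlam X I) (ridge_posDef hlam X J) (fun z => ?_) x
  rw [ridge_quad, ridge_quad]
  have := Finset.sum_le_sum_of_subset_of_nonneg h
    (f := fun s => (X s ⬝ᵥ z) * (X s ⬝ᵥ z)) (fun s _ _ => mul_self_nonneg _)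
  linarith

theorem ridge_empty_inv (lam : ℝ) (X : ℕ → Fin d → ℝ) :
    (ridge lam X ∅)⁻¹ = lam⁻¹ • (1 : Matrix (Fin d) (Fin d) ℝ) := by
  rcases eq_or_ne lam 0 with rfl | h
  · rcases Nat.eq_zero_or_pos d with rfl | hd
    · exact Subsingleton.elim _ _
    · have : Nonempty (Fin d) := ⟨⟨0, hd⟩⟩
      simp [ridge]
  · refine Matrix.inv_eq_left_inv ?_
    simp [ridge, smul_smul, h]

theorem ridge_inv_quad_le {lam : ℝ} (hlam : 0 < lam) (X : ℕ → Fin d → ℝ) (I : Finset ℕ)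
    (x : Fin d → ℝ) : x ⬝ᵥ ((ridge lam X I)⁻¹ *ᵥ x) ≤ (x ⬝ᵥ x) / lam := by
  refine (ridge_inv_quad_anti hlam X (Finset.empty_subset I) x).trans ?_
  rw [ridge_empty_inv, Matrix.smul_mulVec, Matrix.one_mulVec, dotProduct_smul, smul_eq_mul,
    div_eq_inv_mul]

/-- Weighted sums of the regressors are controlled by their weights in the inverse norm. -/
theorem ridge_inv_quad_sum_le {lam : ℝ} (hlam : 0 < lam) (X : ℕ → Fin d → ℝ) (I : Finset ℕ)
    (c : ℕ → ℝ) :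
    (∑ s ∈ I, c s • X s) ⬝ᵥ ((ridge lam X I)⁻¹ *ᵥ (∑ s ∈ I, c s • X s)) ≤ ∑ s ∈ I, c s ^ 2 := by
  set y := ∑ s ∈ I, c s • X s with hy
  set z := (ridge lam X I)⁻¹ *ᵥ y with hz
  have hV := ridge_posDef hlam X I
  have h1 : y ⬝ᵥ z = ∑ s ∈ I, c s * (X s ⬝ᵥ z) := by
    rw [hy, sum_dotProduct]; simp [smul_dotProduct]
  have h2 : (y ⬝ᵥ z) ^ 2 ≤ (∑ s ∈ I, c s ^ 2) * ∑ s ∈ I, (X s ⬝ᵥ z) ^ 2 := by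
    rw [h1]; exact Finset.sum_mul_sq_le_sq_mul_sq I _ _
  -- Since `V z = y`, the form `zᵀ V z` equals `y ⬝ᵥ z`; dropping its part `lam |z|²` gives the
  -- claim. With `h2` this yields `(y ⬝ᵥ z)² ≤ (∑ c²)(y ⬝ᵥ z)`.
  have h3 : ∑ s ∈ I, (X s ⬝ᵥ z) ^ 2 ≤ y ⬝ᵥ z := by
    have h4 := ridge_quad lam X I z z
    rw [hz, PosDef.mulVec_inv_mulVec hV, ← hz, dotProduct_comm z y] at h4
    have h5 : 0 ≤ z ⬝ᵥ z := by simpa using dotProduct_star_self_nonneg z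
    have : 0 ≤ lam * (z ⬝ᵥ z) := by positivity
    simp only [pow_two]
    linarith
  have h0 : 0 ≤ y ⬝ᵥ z := ridge_inv_quad_nonneg hlam X I y
  have h6 : 0 ≤ ∑ s ∈ I, c s ^ 2 := Finset.sum_nonneg fun s _ => sq_nonneg _
  by_contra hc
  push Not at hc
  nlinarith [mul_le_mul_of_nonneg_left h3 h6]

theorem ridge_insert (lam : ℝ) (X : ℕ → Fin d → ℝ) {I : Finset ℕ} {s : ℕ} (hs : s ∉ I) :
    ridge lam X (insert s I) = ridge lam X I + Matrix.vecMulVec (X s) (X s) := by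
  rw [ridge, ridge, Finset.sum_insert hs]; abel

theorem ridge_Ico_succ (lam : ℝ) (X : ℕ → Fin d → ℝ) {a b : ℕ} (hab : a ≤ b) :
    ridge lam X (Finset.Ico a (b + 1)) =
      ridge lam X (Finset.Ico a b) + Matrix.vecMulVec (X b) (X b) := by
  rw [← Finset.insert_Ico_right_eq_Ico_add_one hab, ridge_insert]
  simp

theorem det_ridge_empty (lam : ℝ) (X : ℕ → Fin d → ℝ) : (ridge lam X ∅).det = lam ^ d := by
  simp [ridge]

theorem det_ridge_Ico_succ {lam : ℝ} (hlam : 0 < lam) (X : ℕ → Fin d → ℝ) {a b : ℕ}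
    (hab : a ≤ b) :
    (ridge lam X (Finset.Ico a (b + 1))).det = (ridge lam X (Finset.Ico a b)).det *
      (1 + X b ⬝ᵥ ((ridge lam X (Finset.Ico a b))⁻¹ *ᵥ X b)) := by
  rw [ridge_Ico_succ lam X hab, PosDef.det_add_vecMulVec (ridge_posDef hlam X _)]

/-- Every eigenvalue is the quadratic form at a unit eigenvector, hence at most `lam + |I| L²` by
Cauchy–Schwarz. -/
theorem det_ridge_le {lam L : ℝ} (hlam : 0 < lam) (X : ℕ → Fin d → ℝ) (I : Finset ℕ)
    (hX : ∀ s ∈ I, X s ⬝ᵥ X s ≤ L ^ 2) :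
    (ridge lam X I).det ≤ (lam + I.card * L ^ 2) ^ d := by
  have hV := ridge_posDef hlam X I
  have hH := ridge_isHermitian lam X I
  rw [hH.det_eq_prod_eigenvalues]
  have : (lam + I.card * L ^ 2) ^ d = ∏ _i : Fin d, (lam + I.card * L ^ 2) := by simp
  rw [this]
  refine Finset.prod_le_prod (fun i _ => (hV.eigenvalues_pos i).le) fun i _ => ?_
  have h1 := hH.eigenvalues_eq i
  set v : Fin d → ℝ := (hH.eigenvectorBasis i).ofLp with hv
  have hvv : v ⬝ᵥ v = 1 := by
    have := hH.eigenvectorBasis.orthonormal.1 i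
    have h2 := EuclideanSpace.real_norm_sq_eq (hH.eigenvectorBasis i)
    rw [this] at h2
    simp only [dotProduct, hv]
    rw [show (1 : ℝ) = 1 ^ 2 by norm_num, h2]
    exact Finset.sum_congr rfl fun j _ => by ring
  have h2 : hH.eigenvalues i = v ⬝ᵥ (ridge lam X I *ᵥ v) := by
    rw [h1]; simp [hv]
  change hH.eigenvalues i ≤ _
  rw [h2, ridge_quad, hvv, mul_one]
  have h3 : ∑ s ∈ I, (X s ⬝ᵥ v) * (X s ⬝ᵥ v) ≤ ∑ _s ∈ I, L ^ 2 := by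
    refine Finset.sum_le_sum fun s hs => ?_
    have h4 : (X s ⬝ᵥ v) ^ 2 ≤ (X s ⬝ᵥ X s) * (v ⬝ᵥ v) := by
      have := Finset.sum_mul_sq_le_sq_mul_sq Finset.univ (X s) v
      simpa [dotProduct, pow_two] using this
    rw [hvv, mul_one] at h4
    nlinarith [hX s hs]
  simp only [Finset.sum_const, nsmul_eq_mul] at h3
  linarith

theorem log_det_ridge_le {lam L : ℝ} (hlam : 0 < lam) (X : ℕ → Fin d → ℝ) (I : Finset ℕ)
    (hX : ∀ s ∈ I, X s ⬝ᵥ X s ≤ L ^ 2) {w : ℕ} (hw : I.card ≤ w) :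
    Real.log ((ridge lam X I).det / lam ^ d) ≤ d * Real.log (1 + w * L ^ 2 / lam) := by
  have hdet := (ridge_posDef hlam X I).det_pos
  rw [← Real.log_pow]
  refine Real.log_le_log (by positivity) ?_
  rw [div_le_iff₀ (by positivity), ← mul_pow]
  refine (det_ridge_le hlam X I hX).trans ?_
  have hwc : (I.card : ℝ) ≤ w := by exact_mod_cast hw
  have : (1 + w * L ^ 2 / lam) * lam = lam + w * L ^ 2 := by field_simp
  rw [this]
  gcongr

/-- The elliptical potential lemma. -/
theorem sum_ridge_inv_quad_le {lam L : ℝ} (hlam : 0 < lam) (X : ℕ → Fin d → ℝ) {a b w : ℕ}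
    (hab : a ≤ b) (hw : b ≤ a + w) (hX : ∀ s ∈ Finset.Ico a b, X s ⬝ᵥ X s ≤ L ^ 2) :
    ∑ t ∈ Finset.Ico a b, X t ⬝ᵥ ((ridge lam X (Finset.Ico a t))⁻¹ *ᵥ X t) ≤
      (1 + L ^ 2 / lam) * (d * Real.log (1 + w * L ^ 2 / lam)) := by
  have key : ∀ b, a ≤ b → (∀ s ∈ Finset.Ico a b, X s ⬝ᵥ X s ≤ L ^ 2) →
      ∑ t ∈ Finset.Ico a b, X t ⬝ᵥ ((ridge lam X (Finset.Ico a t))⁻¹ *ᵥ X t) ≤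
      (1 + L ^ 2 / lam) * Real.log ((ridge lam X (Finset.Ico a b)).det / lam ^ d) := by
    intro b hab
    induction b, hab using Nat.le_induction with
    | base => intro _; simp [det_ridge_empty, hlam.ne']
    | succ b hab ih =>
      intro hX
      rw [Finset.sum_Ico_succ_top hab, det_ridge_Ico_succ hlam X hab]
      set q := X b ⬝ᵥ ((ridge lam X (Finset.Ico a b))⁻¹ *ᵥ X b) with hq
      have hq0 : 0 ≤ q := ridge_inv_quad_nonneg hlam X _ _
      have hqL : q ≤ L ^ 2 / lam := by
        refine (ridge_inv_quad_le hlam X _ _).trans ?_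
        have := hX b (by simp [hab])
        gcongr
      have hdet := (ridge_posDef hlam X (Finset.Ico a b)).det_pos
      have h1 : Real.log ((ridge lam X (Finset.Ico a b)).det * (1 + q) / lam ^ d) =
          Real.log ((ridge lam X (Finset.Ico a b)).det / lam ^ d) + Real.log (1 + q) := by
        rw [← Real.log_mul (by positivity) (by positivity)]
        congr 1; ring
      rw [h1, mul_add]
      refine add_le_add (ih fun s hs => hX s ?_) ?_
      · simp only [Finset.mem_Ico] at hs ⊢; omega
      -- From `q / (1 + q) ≤ log (1 + q)` one gets `q ≤ (1 + q) log (1 + q)`, and `q ≤ L² / lam`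
      -- turns the first factor into the prefactor `1 + L² / lam`. No truncation of `q` at 1 is
      -- needed.
      · have h2 := Real.one_sub_inv_le_log_of_pos (show 0 < 1 + q by positivity)
        have h3 : 1 - (1 + q)⁻¹ = q / (1 + q) := by field_simp; ring
        rw [h3, div_le_iff₀ (by positivity)] at h2
        have h4 : 0 ≤ Real.log (1 + q) := Real.log_nonneg (by linarith)
        nlinarith
  refine (key b hab hX).trans ?_
  have : 0 ≤ 1 + L ^ 2 / lam := by positivity
  refine mul_le_mul_of_nonneg_left (log_det_ridge_le hlam X _ hX ?_) this
  simp; omega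

end Ridge

/-! ### Regret of SW-UCB along a path -/

section Rounds

variable {d : ℕ}

theorem inner_eq_dotProduct (x y : Vec d) : inner ℝ x y = x.ofLp ⬝ᵥ y.ofLp := by
  rw [EuclideanSpace.inner_eq_star_dotProduct, star_trivial, dotProduct_comm]

theorem dotProduct_self_eq (x : Vec d) : x.ofLp ⬝ᵥ x.ofLp = ‖x‖ ^ 2 := by
  rw [← inner_eq_dotProduct, real_inner_self_eq_norm_sq]

/-- The regularized Gram matrix of actions. -/
abbrev actionGram (lam : ℝ) (X : ℕ → Vec d) (I : Finset ℕ) : Matrix (Fin d) (Fin d) ℝ :=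
  ridge lam (fun s => (X s).ofLp) I

/-- The norm of `x` for the inverse of the regularized Gram matrix. -/
def invNorm (lam : ℝ) (X : ℕ → Vec d) (I : Finset ℕ) (x : Fin d → ℝ) : ℝ :=
  √(x ⬝ᵥ ((actionGram lam X I)⁻¹ *ᵥ x))

/-- The noise part of the regression. -/
def noiseSum (X : ℕ → Vec d) (η : ℕ → ℝ) (I : Finset ℕ) : Fin d → ℝ :=
  ∑ s ∈ I, η s • (X s).ofLp

/-- The variation of the parameters over `I`. -/
def driftOn (θ : ℕ → Vec d) (I : Finset ℕ) : ℝ := ∑ p ∈ I, ‖θ (p + 1) - θ p‖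

theorem driftOn_nonneg (θ : ℕ → Vec d) (I : Finset ℕ) : 0 ≤ driftOn θ I :=
  Finset.sum_nonneg fun _ _ => norm_nonneg _

theorem invNorm_nonneg (lam : ℝ) (X : ℕ → Vec d) (I : Finset ℕ) (x : Fin d → ℝ) :
    0 ≤ invNorm lam X I x := Real.sqrt_nonneg _

theorem invNorm_le {lam L : ℝ} (hlam : 0 < lam) (hL : 0 ≤ L) (X : ℕ → Vec d) (I : Finset ℕ)
    (x : Vec d) (hx : ‖x‖ ≤ L) : invNorm lam X I x.ofLp ≤ L / √lam := by
  rw [invNorm, ← Real.sqrt_sq hL, ← Real.sqrt_div' _ hlam.le]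
  refine Real.sqrt_le_sqrt ((ridge_inv_quad_le hlam _ I _).trans ?_)
  rw [dotProduct_self_eq]
  gcongr

theorem norm_param_sub_le (θ : ℕ → Vec d) {a s t : ℕ} (has : a ≤ s) (hst : s ≤ t) :
    ‖θ s - θ t‖ ≤ driftOn θ (Finset.Ico a t) := by
  have h := dist_le_Ico_sum_dist θ hst
  rw [dist_eq_norm] at h
  refine h.trans ?_
  refine (Finset.sum_le_sum_of_subset_of_nonneg (Finset.Ico_subset_Ico_left has)
    fun _ _ _ => dist_nonneg).trans (le_of_eq ?_)
  exact Finset.sum_congr rfl fun p _ => by rw [dist_comm, dist_eq_norm]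

/-- The estimation error of sliding window ridge regression. -/
theorem abs_estimate_sub_le {lam L S : ℝ} (hlam : 0 < lam) (hL : 0 ≤ L) (θ X : ℕ → Vec d)
    (η : ℕ → ℝ) {a t w : ℕ} (hw : t ≤ a + w) (hX : ∀ s ∈ Finset.Ico a t, ‖X s‖ ≤ L)
    (hθ : ‖θ t‖ ≤ S) (x : Fin d → ℝ) :
    |x ⬝ᵥ ((actionGram lam X (Finset.Ico a t))⁻¹ *ᵥ
        ∑ s ∈ Finset.Ico a t, reward θ X η s • (X s).ofLp) - x ⬝ᵥ (θ t).ofLp| ≤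
      invNorm lam X (Finset.Ico a t) x *
        (invNorm lam X (Finset.Ico a t) (noiseSum X η (Finset.Ico a t)) +
          L * √w * driftOn θ (Finset.Ico a t) + √lam * S) := by
  set I := Finset.Ico a t with hI
  set V := actionGram lam X I with hVdef
  have hV : V.PosDef := ridge_posDef hlam _ _
  set c : ℕ → ℝ := fun s => inner ℝ (X s) (θ s - θ t) with hc
  -- Measured against `θ t`, the regression vector splits into noise, drift (with coefficients `c`),
  -- the exact term `V θ_t`, and the regularization bias `lam θ_t`.
  have h1 : ∑ s ∈ I, reward θ X η s • (X s).ofLp =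
      noiseSum X η I + ∑ s ∈ I, c s • (X s).ofLp + V *ᵥ (θ t).ofLp - lam • (θ t).ofLp := by
    rw [hVdef, actionGram, ridge_mulVec, noiseSum, add_sub_assoc, add_sub_cancel_left,
      ← Finset.sum_add_distrib, ← Finset.sum_add_distrib]
    refine Finset.sum_congr rfl fun s _ => ?_
    rw [← add_smul, ← add_smul]
    congr 1
    simp only [reward, hc, inner_sub_right, inner_eq_dotProduct]
    ring
  have h2 : x ⬝ᵥ (V⁻¹ *ᵥ ∑ s ∈ I, reward θ X η s • (X s).ofLp) - x ⬝ᵥ (θ t).ofLp =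
      x ⬝ᵥ (V⁻¹ *ᵥ noiseSum X η I) + x ⬝ᵥ (V⁻¹ *ᵥ ∑ s ∈ I, c s • (X s).ofLp) -
        lam * (x ⬝ᵥ (V⁻¹ *ᵥ (θ t).ofLp)) := by
    rw [h1, Matrix.mulVec_sub, Matrix.mulVec_add, Matrix.mulVec_add, Matrix.mulVec_smul,
      PosDef.inv_mulVec_mulVec hV]
    simp only [dotProduct_add, dotProduct_sub, dotProduct_smul, smul_eq_mul]
    ring
  have h3 := PosDef.abs_dot_le hV x (noiseSum X η I)
  have h4 := PosDef.abs_dot_le hV x (∑ s ∈ I, c s • (X s).ofLp)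
  have h5 := PosDef.abs_dot_le hV x (θ t).ofLp
  have hB := driftOn_nonneg θ I
  -- The drift vector is measured in the inverse-Gram norm, where its size is at most the Euclidean
  -- norm of its coefficients. At most `w` coefficients, each at most `L · drift`, produce the
  -- factor `√w`.
  have h6 : √((∑ s ∈ I, c s • (X s).ofLp) ⬝ᵥ (V⁻¹ *ᵥ ∑ s ∈ I, c s • (X s).ofLp)) ≤
      L * √w * driftOn θ I := by
    refine Real.sqrt_le_iff.2 ⟨by positivity, ?_⟩
    refine (ridge_inv_quad_sum_le hlam _ I c).trans ?_
    have h7 : ∀ s ∈ I, c s ^ 2 ≤ (L * driftOn θ I) ^ 2 := by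
      intro s hs
      rw [← sq_abs]
      have hs' := Finset.mem_Ico.1 hs
      refine pow_le_pow_left₀ (abs_nonneg _) ?_ 2
      refine (abs_real_inner_le_norm _ _).trans ?_
      exact mul_le_mul (hX s hs) (norm_param_sub_le θ hs'.1 hs'.2.le) (norm_nonneg _) hL
    refine (Finset.sum_le_sum h7).trans ?_
    rw [Finset.sum_const, nsmul_eq_mul]
    have hcard : (I.card : ℝ) ≤ w := by
      have : I.card ≤ w := by simp [hI]; omega
      exact_mod_cast this
    have : (L * √w * driftOn θ I) ^ 2 = w * (L * driftOn θ I) ^ 2 := by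
      rw [mul_pow, mul_pow, Real.sq_sqrt (Nat.cast_nonneg w)]; ring
    rw [this]
    gcongr
  have h8 : lam * √((θ t).ofLp ⬝ᵥ (V⁻¹ *ᵥ (θ t).ofLp)) ≤ √lam * S := by
    have hS : 0 ≤ S := (norm_nonneg _).trans hθ
    have h9 : √((θ t).ofLp ⬝ᵥ (V⁻¹ *ᵥ (θ t).ofLp)) ≤ S / √lam :=
      invNorm_le hlam hS X I (θ t) hθ
    calc _ ≤ lam * (S / √lam) := by gcongr
      _ = √lam * S := by
        have := Real.mul_self_sqrt hlam.le
        have h0 : 0 < √lam := Real.sqrt_pos.2 hlam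
        field_simp
        nlinarith
  rw [h2]
  simp only [invNorm]
  set q := √(x ⬝ᵥ (V⁻¹ *ᵥ x)) with hq
  have hq0 : 0 ≤ q := Real.sqrt_nonneg _
  have h10 : |lam * (x ⬝ᵥ (V⁻¹ *ᵥ (θ t).ofLp))| ≤ q * (√lam * S) := by
    rw [abs_mul, abs_of_pos hlam]
    calc _ ≤ lam * (q * √((θ t).ofLp ⬝ᵥ (V⁻¹ *ᵥ (θ t).ofLp))) := by gcongr
      _ = q * (lam * √((θ t).ofLp ⬝ᵥ (V⁻¹ *ᵥ (θ t).ofLp))) := by ring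
      _ ≤ _ := by gcongr
  have h11 := mul_le_mul_of_nonneg_left h6 hq0
  refine (abs_sub _ _).trans ?_
  refine (add_le_add (abs_add_le _ _) le_rfl).trans ?_
  rw [mul_add, mul_add]
  exact add_le_add (add_le_add h3 (h4.trans h11)) h10

/-- The regret of one round of an optimistic choice. -/
theorem optimistic_gap_le {lam L S β ρ : ℝ} (hlam : 0 < lam) (hL : 0 ≤ L) (θ X : ℕ → Vec d)
    (η : ℕ → ℝ) {a t w : ℕ} (hw : t ≤ a + w) (hX : ∀ s ∈ Finset.Ico a t, ‖X s‖ ≤ L)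
    (hθ : ‖θ t‖ ≤ S)
    (hρ : invNorm lam X (Finset.Ico a t) (noiseSum X η (Finset.Ico a t)) ≤ ρ) (x : Vec d)
    (hmax : x.ofLp ⬝ᵥ ((actionGram lam X (Finset.Ico a t))⁻¹ *ᵥ
          ∑ s ∈ Finset.Ico a t, reward θ X η s • (X s).ofLp) +
        invNorm lam X (Finset.Ico a t) x.ofLp * β ≤
      (X t).ofLp ⬝ᵥ ((actionGram lam X (Finset.Ico a t))⁻¹ *ᵥ
          ∑ s ∈ Finset.Ico a t, reward θ X η s • (X s).ofLp) +
        invNorm lam X (Finset.Ico a t) (X t).ofLp * β) :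
    inner ℝ x (θ t) - inner ℝ (X t) (θ t) ≤
      invNorm lam X (Finset.Ico a t) (X t).ofLp *
          (β + (ρ + L * √w * driftOn θ (Finset.Ico a t) + √lam * S)) +
        invNorm lam X (Finset.Ico a t) x.ofLp *
          (ρ + L * √w * driftOn θ (Finset.Ico a t) + √lam * S - β) := by
  -- The estimate is used at the competitor `x` and at the chosen action. The term with factor
  -- `error - β` at `x` is kept: its sign depends on whether the drift fits into the slack of `β`.
  have h1 := abs_le.1 (abs_estimate_sub_le hlam hL θ X η hw hX hθ x.ofLp)
  have h2 := abs_le.1 (abs_estimate_sub_le hlam hL θ X η hw hX hθ (X t).ofLp)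
  rw [inner_eq_dotProduct, inner_eq_dotProduct]
  have h3 := mul_le_mul_of_nonneg_left hρ (invNorm_nonneg lam X (Finset.Ico a t) x.ofLp)
  have h4 := mul_le_mul_of_nonneg_left hρ (invNorm_nonneg lam X (Finset.Ico a t) (X t).ofLp)
  nlinarith [h1.1, h1.2, h2.1, h2.2]

/-- The elliptical potential lemma for windows of length `w` in a block that starts at `A`. -/
theorem sum_invNorm_sq_le {lam L : ℝ} (hlam : 0 < lam) (X : ℕ → Vec d) (A w : ℕ) :
    ∀ k n : ℕ, n ≤ k * w → (∀ s ∈ Finset.Ico A (A + n), ‖X s‖ ≤ L) →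
      ∑ t ∈ Finset.Ico A (A + n),
          (X t).ofLp ⬝ᵥ ((actionGram lam X (Finset.Ico (max A (t - w)) t))⁻¹ *ᵥ (X t).ofLp) ≤
        k * ((1 + L ^ 2 / lam) * (d * Real.log (1 + w * L ^ 2 / lam))) := by
  intro k
  induction k with
  | zero =>
    intro n hn _
    have : n = 0 := by omega
    subst this; simp
  | succ k ih =>
    intro n hn hX
    have hn' : n ≤ k * w + w := by rw [add_mul, one_mul] at hn; exact hn
    -- The last `w` rounds are split off. Truncated subtraction is intended: if `n < w`, the first
    -- piece is empty.
    rw [← Finset.sum_Ico_consecutive _ (show A ≤ A + (n - w) by omega)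
      (show A + (n - w) ≤ A + n by omega)]
    have h1 := ih (n - w) (by omega) fun s hs => hX s (by
      simp only [Finset.mem_Ico] at hs ⊢; omega)
    have h2 := sum_ridge_inv_quad_le (L := L) hlam (fun s => (X s).ofLp)
      (show A + (n - w) ≤ A + n by omega) (show A + n ≤ A + (n - w) + w by omega) fun s hs => by
        rw [dotProduct_self_eq]
        have := hX s (by simp only [Finset.mem_Ico] at hs ⊢; omega)
        gcongr
    -- In these last `w` rounds the sliding window contains all earlier rounds of the piece, so
    -- enlarging the Gram matrix only decreases the inverse form.
    have h3 : ∑ t ∈ Finset.Ico (A + (n - w)) (A + n),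
          (X t).ofLp ⬝ᵥ ((actionGram lam X (Finset.Ico (max A (t - w)) t))⁻¹ *ᵥ (X t).ofLp) ≤
        ∑ t ∈ Finset.Ico (A + (n - w)) (A + n),
          (X t).ofLp ⬝ᵥ ((actionGram lam X (Finset.Ico (A + (n - w)) t))⁻¹ *ᵥ (X t).ofLp) := by
      refine Finset.sum_le_sum fun t ht => ridge_inv_quad_anti hlam _ ?_ _
      refine Finset.Ico_subset_Ico_left ?_
      simp only [Finset.mem_Ico] at ht
      omega
    push_cast
    linarith

/-- The sum of the norms of the actions in a block. -/
theorem sum_invNorm_le {lam L : ℝ} (hlam : 0 < lam) (X : ℕ → Vec d) {A w n H : ℕ}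
    (hw : 1 ≤ w) (hwH : w ≤ H) (hn : n ≤ H) (hX : ∀ s ∈ Finset.Ico A (A + n), ‖X s‖ ≤ L) :
    ∑ t ∈ Finset.Ico A (A + n), invNorm lam X (Finset.Ico (max A (t - w)) t) (X t).ofLp ≤
      H * √(2 * ((1 + L ^ 2 / lam) * (d * Real.log (1 + w * L ^ 2 / lam))) / w) := by
  set E := (1 + L ^ 2 / lam) * (d * Real.log (1 + w * L ^ 2 / lam)) with hE
  have hlog : 0 ≤ Real.log (1 + w * L ^ 2 / lam) := Real.log_nonneg (by
    have : 0 ≤ w * L ^ 2 / lam := by positivity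
    linarith)
  have hE0 : 0 ≤ E := by positivity
  have hw0 : (0 : ℝ) < w := by exact_mod_cast hw
  have hk : n ≤ (H / w + 1) * w := hn.trans (by
    have := Nat.lt_div_mul_add (a := H) (b := w) (by omega)
    rw [add_mul, one_mul]; omega)
  have h1 := sum_invNorm_sq_le hlam X A w (H / w + 1) n hk hX
  -- The number of pieces of length `w`; the assumption `w ≤ H` absorbs the rounding and produces
  -- the 2 under the root.
  have h2 : ((H / w + 1 : ℕ) : ℝ) ≤ 2 * H / w := by
    have h3 : ((H / w : ℕ) : ℝ) ≤ H / w := Nat.cast_div_le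
    have h4 : (1 : ℝ) ≤ H / w := by
      rw [le_div_iff₀ hw0, one_mul]; exact_mod_cast hwH
    push_cast
    rw [mul_div_assoc]; linarith
  have h5 : (∑ t ∈ Finset.Ico A (A + n),
      invNorm lam X (Finset.Ico (max A (t - w)) t) (X t).ofLp) ^ 2 ≤
      (H * √(2 * E / w)) ^ 2 := by
    refine (sq_sum_le_card_mul_sum_sq).trans ?_
    have h6 : ∀ t, invNorm lam X (Finset.Ico (max A (t - w)) t) (X t).ofLp ^ 2 =
        (X t).ofLp ⬝ᵥ ((actionGram lam X (Finset.Ico (max A (t - w)) t))⁻¹ *ᵥ (X t).ofLp) :=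
      fun t => Real.sq_sqrt (ridge_inv_quad_nonneg hlam _ _ _)
    simp only [h6, Nat.card_Ico, add_tsub_cancel_left]
    rw [mul_pow, Real.sq_sqrt (by positivity)]
    calc (n : ℝ) * _ ≤ H * (2 * H / w * E) := by
          refine mul_le_mul (by exact_mod_cast hn) (h1.trans ?_) ?_ (by positivity)
          · gcongr
          · exact Finset.sum_nonneg fun t _ => ridge_inv_quad_nonneg hlam _ _ _
      _ = _ := by ring
  exact (le_abs_self _).trans (abs_le_of_sq_le_sq h5 (by positivity))

/-- Each drift increment is counted at most `w` times. -/
theorem sum_driftOn_le (θ : ℕ → Vec d) {A E : ℕ} (w : ℕ) :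
    ∑ t ∈ Finset.Ico A E, driftOn θ (Finset.Ico (max A (t - w)) t) ≤
      w * driftOn θ (Finset.Ico A (E - 1)) := by
  unfold driftOn
  -- Increment `p` lies in the window of round `t` only if `p < t ≤ p + w`. As `t < E`, the
  -- increment that leaves the block never occurs, hence `E - 1`.
  rw [Finset.sum_comm' (t' := Finset.Ico A (E - 1))
    (s' := fun p => (Finset.Ico A E).filter fun t => p < t ∧ t ≤ p + w), Finset.mul_sum]
  · refine Finset.sum_le_sum fun p _ => ?_
    rw [Finset.sum_const, nsmul_eq_mul]
    refine mul_le_mul_of_nonneg_right ?_ (norm_nonneg _)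
    have : ((Finset.Ico A E).filter fun t => p < t ∧ t ≤ p + w).card ≤ w := by
      calc _ ≤ (Finset.Ioc p (p + w)).card := Finset.card_le_card fun t ht => by
            simp only [Finset.mem_filter, Finset.mem_Ioc] at ht ⊢; exact ht.2
        _ = w := by simp
    exact_mod_cast this
  · intro t p
    simp only [Finset.mem_Ico, Finset.mem_filter]
    omega

end Rounds

/-! ### The confidence radius -/

/-- The radius within which the noise part of the regression lies with probability at least
`1 - T^(-1/4)`. -/
def noiseRadius (d T : ℕ) (R : ℝ≥0) (L lam : ℝ) (w : ℕ) : ℝ :=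
  (R : ℝ) * √((d : ℝ) * Real.log (1 + (w : ℝ) * L ^ 2 / lam) + Real.log T / 2)

/-- The scale of the confidence radius. -/
def radiusScale (d : ℕ) (R : ℝ≥0) : ℝ := if R = 0 then 1 else √d

theorem one_le_radiusScale {d : ℕ} (hd : 1 ≤ d) (R : ℝ≥0) : 1 ≤ radiusScale d R := by
  unfold radiusScale
  split_ifs
  · exact le_rfl
  · rw [Real.one_le_sqrt]; exact_mod_cast hd

/-- For `T ≥ 2`, constants can be absorbed into a multiple of `log T`. -/
theorem log_window_le {L lam : ℝ} (hlam : 0 < lam) {T w : ℕ} (hT : 2 ≤ T) (hwT : w ≤ T) :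
    Real.log (1 + w * L ^ 2 / lam) ≤ (1 + Real.log (1 + L ^ 2 / lam) / Real.log 2) *
      Real.log T := by
  have hT' : (2 : ℝ) ≤ T := by exact_mod_cast hT
  have hw : (w : ℝ) ≤ T := by exact_mod_cast hwT
  have h0 : 0 ≤ L ^ 2 / lam := by positivity
  have h1 : Real.log (1 + w * L ^ 2 / lam) ≤ Real.log T + Real.log (1 + L ^ 2 / lam) := by
    rw [← Real.log_mul (by positivity) (by positivity)]
    refine Real.log_le_log (by positivity) ?_
    rw [mul_div_assoc]
    nlinarith
  have h2 : Real.log 2 ≤ Real.log T := Real.log_le_log (by norm_num) hT'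
  have h3 : 0 < Real.log 2 := Real.log_pos (by norm_num)
  have h4 : 0 ≤ Real.log (1 + L ^ 2 / lam) := Real.log_nonneg (by linarith)
  have h5 : Real.log (1 + L ^ 2 / lam) ≤ Real.log (1 + L ^ 2 / lam) / Real.log 2 * Real.log T := by
    rw [div_mul_eq_mul_div, le_div_iff₀ h3]
    gcongr
  linarith

theorem log_radius_eq {L lam : ℝ} (hlam : 0 < lam) {T : ℕ} (w : ℕ) (hT : 2 ≤ T) :
    Real.log (T * (1 + w * L ^ 2 / lam)) = Real.log T + Real.log (1 + w * L ^ 2 / lam) := by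
  have : (0 : ℝ) < T := by exact_mod_cast (by omega : 0 < T)
  rw [Real.log_mul this.ne' (by positivity)]

/-- The confidence radius exceeds what the noise requires by a multiple of `√d`. -/
theorem exists_radius_slack (R : ℝ≥0) (L S : ℝ) {lam : ℝ} (hlam : 0 < lam) (hR : R ≠ 0) :
    ∃ c : ℝ, 0 < c ∧ ∀ d T w : ℕ, 1 ≤ d → 2 ≤ T → w ≤ T →
      noiseRadius d T R L lam w + √lam * S + c * √d ≤ radius d T R L S lam w := by
  set κ := 1 + Real.log (1 + L ^ 2 / lam) / Real.log 2 with hκ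
  have hl2 : 0 < Real.log 2 := Real.log_pos (by norm_num)
  have h0 : 0 ≤ L ^ 2 / lam := by positivity
  have hκ1 : 1 ≤ κ := by
    have : 0 ≤ Real.log (1 + L ^ 2 / lam) := Real.log_nonneg (by linarith)
    rw [hκ]
    have : 0 ≤ Real.log (1 + L ^ 2 / lam) / Real.log 2 := by positivity
    linarith
  have hR' : (0 : ℝ) < R := by exact_mod_cast pos_iff_ne_zero.2 hR
  -- With `y` and `z` the roots in the two radii and `u = √(d log T)`: `y² - z² ≥ u² / 2`, `y + z ≤
  -- 2 y ≤ 2 √(κ + 1) u`, so `y - z ≥ u / (4 √(κ + 1))`; finally `u ≥ √(log 2) √d`.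
  refine ⟨R * (√(Real.log 2) / (4 * √(κ + 1))), by positivity, ?_⟩
  intro d T w hd hT hw
  have hd' : (1 : ℝ) ≤ d := by exact_mod_cast hd
  have hlw := log_window_le (L := L) hlam hT hw
  rw [← hκ] at hlw
  have hT' : (2 : ℝ) ≤ T := by exact_mod_cast hT
  have hlT : Real.log 2 ≤ Real.log T := Real.log_le_log (by norm_num) hT'
  have hl0 : 0 ≤ Real.log (1 + w * L ^ 2 / lam) := Real.log_nonneg (by
    have : 0 ≤ w * L ^ 2 / lam := by positivity
    linarith)
  unfold noiseRadius radius
  rw [log_radius_eq hlam w hT]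
  set ℓ := Real.log T
  set m := Real.log (1 + w * L ^ 2 / lam)
  have hℓ : 0 < ℓ := hl2.trans_le hlT
  set y := √(d * (ℓ + m)) with hy
  set z := √(d * m + ℓ / 2) with hz
  have hy2 : y ^ 2 = d * (ℓ + m) := Real.sq_sqrt (by positivity)
  have hz2 : z ^ 2 = d * m + ℓ / 2 := Real.sq_sqrt (by positivity)
  have hy0 : 0 < y := Real.sqrt_pos.2 (by positivity)
  have hzy : z ≤ y := Real.sqrt_le_sqrt (by nlinarith)
  set u := √(d * ℓ) with hu
  have hu2 : u ^ 2 = d * ℓ := Real.sq_sqrt (by positivity)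
  have hu0 : 0 < u := Real.sqrt_pos.2 (by positivity)
  have hyu : y ≤ √(κ + 1) * u := by
    rw [hu, ← Real.sqrt_mul (by positivity)]
    refine Real.sqrt_le_sqrt ?_
    nlinarith
  -- The gap between the squares is `d ℓ - ℓ / 2`: the radius carries `log T` inside the factor `d`,
  -- the noise only needs `log T / 2` outside it.
  have h1 : u ^ 2 / 2 ≤ (y - z) * (2 * y) := by
    have : (y - z) * (y + z) ≤ (y - z) * (2 * y) :=
      mul_le_mul_of_nonneg_left (by linarith) (by linarith)
    nlinarith
  have hs0 : 0 < √(κ + 1) := Real.sqrt_pos.2 (by positivity)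
  have h2 : u / (4 * √(κ + 1)) ≤ y - z := by
    rw [div_le_iff₀ (by positivity)]
    have h3 : (y - z) * (2 * y) ≤ (y - z) * (2 * (√(κ + 1) * u)) :=
      mul_le_mul_of_nonneg_left (by linarith) (by linarith)
    have h4 : u * (u / 2) ≤ u * ((y - z) * (2 * √(κ + 1))) := by nlinarith
    have := le_of_mul_le_mul_left h4 hu0
    linarith
  have h5 : √(Real.log 2) * √d ≤ u := by
    rw [hu, ← Real.sqrt_mul hl2.le]
    refine Real.sqrt_le_sqrt ?_
    nlinarith
  have h6 : √(Real.log 2) / (4 * √(κ + 1)) * √d ≤ y - z := by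
    refine le_trans ?_ h2
    rw [div_mul_eq_mul_div]
    gcongr
  nlinarith [mul_le_mul_of_nonneg_left h6 hR'.le]

/-- The factor `√d` multiplies only the noise part of the radius, so it disappears when `R = 0`;
this is what `radiusScale` records. -/
theorem exists_radius_le (R : ℝ≥0) (L S : ℝ) {lam : ℝ} (hlam : 0 < lam) (hS : 0 < S) :
    ∃ C : ℝ, 0 < C ∧ ∀ d T w : ℕ, 1 ≤ d → 2 ≤ T → w ≤ T →
      radius d T R L S lam w ≤ C * radiusScale d R * (1 + Real.log T) := by
  set κ := 1 + Real.log (1 + L ^ 2 / lam) / Real.log 2 with hκ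
  have h0 : 0 ≤ L ^ 2 / lam := by positivity
  have hκ1 : 1 ≤ κ := by
    have : 0 ≤ Real.log (1 + L ^ 2 / lam) := Real.log_nonneg (by linarith)
    have hl2 : 0 < Real.log 2 := Real.log_pos (by norm_num)
    rw [hκ]
    have : 0 ≤ Real.log (1 + L ^ 2 / lam) / Real.log 2 := by positivity
    linarith
  refine ⟨R * √(κ + 1) + √lam * S, by positivity, ?_⟩
  intro d T w hd hT hw
  have hlw := log_window_le (L := L) hlam hT hw
  rw [← hκ] at hlw
  have hT' : (2 : ℝ) ≤ T := by exact_mod_cast hT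
  have hlT : 0 ≤ Real.log T := Real.log_nonneg (by linarith)
  unfold radius
  rw [log_radius_eq hlam w hT]
  have hg := one_le_radiusScale hd R
  have h1 : (R : ℝ) * √(d * (Real.log T + Real.log (1 + w * L ^ 2 / lam))) ≤
      R * √(κ + 1) * radiusScale d R * (1 + Real.log T) := by
    rcases eq_or_ne R 0 with h | h
    · simp [h]
    · have h2 : radiusScale d R = √d := by simp [radiusScale, h]
      rw [h2, mul_assoc, mul_assoc]
      refine mul_le_mul_of_nonneg_left ?_ R.2
      refine Real.sqrt_le_iff.2 ⟨by positivity, ?_⟩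
      rw [mul_pow, mul_pow, Real.sq_sqrt (by positivity), Real.sq_sqrt (by positivity)]
      have h3 : Real.log T ≤ (1 + Real.log T) ^ 2 := by nlinarith
      have h4 : Real.log T + Real.log (1 + w * L ^ 2 / lam) ≤ (κ + 1) * Real.log T := by linarith
      calc _ ≤ (d : ℝ) * ((κ + 1) * (1 + Real.log T) ^ 2) := by
            gcongr
            exact h4.trans (by gcongr)
        _ = _ := by ring
  have h2 : √lam * S ≤ √lam * S * radiusScale d R * (1 + Real.log T) := by
    have h3 : 1 ≤ radiusScale d R * (1 + Real.log T) := by nlinarith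
    have h4 : 0 ≤ √lam * S := by positivity
    rw [mul_assoc]
    nlinarith
  linarith

/-- A round whose noise lies within the noise radius: the bias costs only its excess over the
slack of the confidence radius. -/
theorem exists_round_gap_le (R : ℝ≥0) {L S lam : ℝ} (hlam : 0 < lam) (hL : 0 < L) :
    ∃ K : ℝ, 0 < K ∧ ∀ (d T w : ℕ) (θ X : ℕ → Vec d) (η : ℕ → ℝ) (a t : ℕ) (x : Vec d),
      1 ≤ d → 2 ≤ T → w ≤ T → t ≤ a + w →
      (∀ s ∈ Finset.Ico a t, ‖X s‖ ≤ L) → ‖X t‖ ≤ L → ‖x‖ ≤ L → ‖θ t‖ ≤ S →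
      inner ℝ x (θ t) - inner ℝ (X t) (θ t) ≤ 2 →
      invNorm lam X (Finset.Ico a t) (noiseSum X η (Finset.Ico a t)) ≤ noiseRadius d T R L lam w →
      x.ofLp ⬝ᵥ ((actionGram lam X (Finset.Ico a t))⁻¹ *ᵥ
          ∑ s ∈ Finset.Ico a t, reward θ X η s • (X s).ofLp) +
        invNorm lam X (Finset.Ico a t) x.ofLp * radius d T R L S lam w ≤
      (X t).ofLp ⬝ᵥ ((actionGram lam X (Finset.Ico a t))⁻¹ *ᵥ
          ∑ s ∈ Finset.Ico a t, reward θ X η s • (X s).ofLp) +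
        invNorm lam X (Finset.Ico a t) (X t).ofLp * radius d T R L S lam w →
      inner ℝ x (θ t) - inner ℝ (X t) (θ t) ≤
        2 * radius d T R L S lam w * invNorm lam X (Finset.Ico a t) (X t).ofLp +
          K * (√w * driftOn θ (Finset.Ico a t) / radiusScale d R) := by
  rcases eq_or_ne R 0 with rfl | hR
  -- Without noise there is no slack. The drift term is paid at both actions, whose inverse-Gram
  -- norms are at most `L / √lam`.
  · refine ⟨2 * L * (L / √lam), by positivity, ?_⟩
    intro d T w θ X η a t x hd hT hwT hw hX hXt hx hθ _ hρ hmax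
    have h := optimistic_gap_le hlam hL.le θ X η hw hX hθ hρ x hmax
    have h1 := invNorm_le hlam hL.le X (Finset.Ico a t) x hx
    have h2 := invNorm_le hlam hL.le X (Finset.Ico a t) (X t) hXt
    have hn1 := invNorm_nonneg lam X (Finset.Ico a t) x.ofLp
    have hn2 := invNorm_nonneg lam X (Finset.Ico a t) (X t).ofLp
    have hB := driftOn_nonneg θ (Finset.Ico a t)
    have hr : radius d T 0 L S lam w = √lam * S := by simp [radius]
    have hn : noiseRadius d T 0 L lam w = 0 := by simp [noiseRadius]
    have hg : radiusScale d 0 = 1 := by simp [radiusScale]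
    rw [hr, hn] at h
    rw [hr, hg]
    set b := √w * driftOn θ (Finset.Ico a t) with hb
    have hb0 : 0 ≤ b := by positivity
    have h3 := mul_le_mul_of_nonneg_right h1 hb0
    have h4 := mul_le_mul_of_nonneg_right h2 hb0
    have e1 : L * √w * driftOn θ (Finset.Ico a t) = L * b := by rw [hb]; ring
    rw [e1] at h
    have h5 := mul_le_mul_of_nonneg_left h3 hL.le
    have h6 := mul_le_mul_of_nonneg_left h4 hL.le
    rw [div_one]
    nlinarith
  · obtain ⟨c, hc, hslack⟩ := exists_radius_slack R L S hlam hR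
    refine ⟨2 * L / c, by positivity, ?_⟩
    intro d T w θ X η a t x hd hT hwT hw hX hXt hx hθ h2 hρ hmax
    have h := optimistic_gap_le hlam hL.le θ X η hw hX hθ hρ x hmax
    have hn1 := invNorm_nonneg lam X (Finset.Ico a t) x.ofLp
    have hn2 := invNorm_nonneg lam X (Finset.Ico a t) (X t).ofLp
    have hB := driftOn_nonneg θ (Finset.Ico a t)
    have hg : radiusScale d R = √d := by simp [radiusScale, hR]
    have hs := hslack d T w hd hT hwT
    rw [hg]
    have hd0 : 0 < √(d : ℝ) := Real.sqrt_pos.2 (by exact_mod_cast hd)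
    set b := √w * driftOn θ (Finset.Ico a t) with hb
    have hb0 : 0 ≤ b := by positivity
    have e1 : L * √w * driftOn θ (Finset.Ico a t) = L * b := by rw [hb]; ring
    rw [e1] at h
    -- If the drift fits into the slack `c √d`, the radius dominates the whole error and the
    -- competitor's term is nonpositive. If not, `2 L b / (c √d)` exceeds 2, the trivial bound on
    -- the gap.
    rcases le_or_gt (L * b) (c * √d) with hcase | hcase
    · have h7 : 0 ≤ 2 * L / c * (b / √d) := by positivity
      have h8 : noiseRadius d T R L lam w + L * b + √lam * S ≤ radius d T R L S lam w := by
        linarith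
      have h9 := mul_le_mul_of_nonneg_left h8 hn2
      have h10 : invNorm lam X (Finset.Ico a t) x.ofLp *
          (noiseRadius d T R L lam w + L * b + √lam * S - radius d T R L S lam w) ≤ 0 :=
        mul_nonpos_of_nonneg_of_nonpos hn1 (by linarith)
      linarith
    · have h7 : 2 ≤ 2 * L / c * (b / √d) := by
        rw [div_mul_div_comm, le_div_iff₀ (by positivity)]
        linarith
      have h8 : 0 ≤ radius d T R L S lam w := by
        have : 0 ≤ radius d T R L S lam w - √lam * S := by
          unfold radius
          have : (0 : ℝ) ≤ R * √(d * Real.log (T * (1 + w * L ^ 2 / lam))) := by positivity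
          linarith
        have hS : 0 ≤ S := (norm_nonneg _).trans hθ
        have : 0 ≤ √lam * S := by positivity
        linarith
      have h9 : 0 ≤ 2 * radius d T R L S lam w * invNorm lam X (Finset.Ico a t) (X t).ofLp := by
        positivity
      linarith

/-! ### Regret of a block -/

/-- The regret of round `t`. -/
def gap {d : ℕ} (D : ℕ → Set (Vec d)) (θ X : ℕ → Vec d) (t : ℕ) : ℝ :=
  optimalReward D θ t - inner ℝ (X t) (θ t)

section Gap

variable {d T : ℕ} {L S : ℝ} {D : ℕ → Set (Vec d)} {θ : ℕ → Vec d}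

theorem IsNormalized.inner_le_optimalReward (h : IsNormalized T L S D θ) {t : ℕ} (ht : t < T)
    {x : Vec d} (hx : x ∈ D t) : inner ℝ x (θ t) ≤ optimalReward D θ t := by
  refine le_csSup ⟨1, ?_⟩ ⟨x, hx, rfl⟩
  rintro _ ⟨y, hy, rfl⟩
  exact (abs_le.1 (h.abs_reward_le t ht y hy)).2

theorem optimalReward_le_of_forall {t : ℕ} {x : Vec d}
    (hx : x ∈ D t) {c : ℝ} (hc : ∀ y ∈ D t, inner ℝ y (θ t) ≤ c) : optimalReward D θ t ≤ c := by
  refine csSup_le ⟨_, x, hx, rfl⟩ ?_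
  rintro _ ⟨y, hy, rfl⟩
  exact hc y hy

theorem IsNormalized.abs_optimalReward_le (h : IsNormalized T L S D θ) {t : ℕ} (ht : t < T)
    {x : Vec d} (hx : x ∈ D t) : |optimalReward D θ t| ≤ 1 := by
  have h1 := abs_le.1 (h.abs_reward_le t ht x hx)
  refine abs_le.2 ⟨h1.1.trans (h.inner_le_optimalReward ht hx), ?_⟩
  exact optimalReward_le_of_forall hx fun y hy =>
    (abs_le.1 (h.abs_reward_le t ht y hy)).2

theorem IsNormalized.gap_nonneg (h : IsNormalized T L S D θ) {X : ℕ → Vec d} {t : ℕ}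
    (ht : t < T) (hx : X t ∈ D t) : 0 ≤ gap D θ X t :=
  sub_nonneg.2 (h.inner_le_optimalReward ht hx)

theorem IsNormalized.gap_le_two (h : IsNormalized T L S D θ) {X : ℕ → Vec d} {t : ℕ}
    (ht : t < T) (hx : X t ∈ D t) : gap D θ X t ≤ 2 := by
  have h1 := abs_le.1 (h.abs_reward_le t ht _ hx)
  have h2 := abs_le.1 (h.abs_optimalReward_le ht hx)
  unfold gap
  linarith [h1.1, h2.2]

end Gap

/-- The rounds of block `i`. -/
def blockRounds (d T i : ℕ) : Finset ℕ :=
  Finset.Ico (i * blockLength d T) (min ((i + 1) * blockLength d T) T)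

theorem div_mul_eq_of_mem_blockRounds {d T i t : ℕ} (ht : t ∈ blockRounds d T i) :
    t / blockLength d T = i := by
  unfold blockRounds at ht
  rw [Finset.mem_Ico] at ht
  exact Nat.div_eq_of_lt_le ht.1 (lt_of_lt_of_le ht.2 (min_le_left _ _))

theorem lt_of_mem_blockRounds {d T i t : ℕ} (ht : t ∈ blockRounds d T i) : t < T :=
  lt_of_lt_of_le (Finset.mem_Ico.1 ht).2 (min_le_right _ _)

theorem card_blockRounds_le (d T i : ℕ) : (blockRounds d T i).card ≤ blockLength d T := by
  rw [blockRounds, Nat.card_Ico]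
  have := min_le_left ((i + 1) * blockLength d T) T
  rw [add_mul, one_mul] at this
  rw [add_mul, one_mul]
  omega

/-- The noise part of the regression of round `t` is too large for the noise radius. -/
def NoiseExceeds {d : ℕ} (T : ℕ) (R : ℝ≥0) (L lam : ℝ) (w : ℕ) (X : ℕ → Vec d) (η : ℕ → ℝ)
    (t : ℕ) : Prop :=
  noiseRadius d T R L lam w <
    invNorm lam X (windowRounds d T w t) (noiseSum X η (windowRounds d T w t))

open Classical in
/-- The regret of SW-UCB with window length `w` in a block. -/
theorem exists_block_gap_le (R : ℝ≥0) {L S lam : ℝ} (hlam : 0 < lam) (hL : 0 < L) (hS : 0 < S) :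
    ∃ K : ℝ, 0 < K ∧ ∀ (d T w i : ℕ) (D : ℕ → Set (Vec d)) (θ X : ℕ → Vec d) (η : ℕ → ℝ),
      1 ≤ d → 2 ≤ T → 1 ≤ w → w ≤ blockLength d T → blockLength d T ≤ T →
      IsNormalized T L S D θ → (∀ t < T, X t ∈ D t) →
      (∀ t ∈ blockRounds d T i, IsMaxOn (ucb d T R L S lam w X (reward θ X η) t) (D t) (X t)) →
      ∑ t ∈ blockRounds d T i, gap D θ X t ≤
        K * ((1 + Real.log T) ^ 2 * radiusScale d R * √d * blockLength d T / √w +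
          w * √w / radiusScale d R *
            driftOn θ (Finset.Ico (i * blockLength d T)
              (min ((i + 1) * blockLength d T) T - 1))) +
        2 * ∑ t ∈ blockRounds d T i, if NoiseExceeds T R L lam w X η t then 1 else 0 := by
  obtain ⟨K, hK, hround⟩ := exists_round_gap_le R (S := S) hlam hL
  obtain ⟨C, hC, hrad⟩ := exists_radius_le R L S hlam hS
  set κ := 1 + Real.log (1 + L ^ 2 / lam) / Real.log 2 with hκ
  have hL0 : 0 ≤ L ^ 2 / lam := by positivity
  have hκ1 : 1 ≤ κ := by
    have : 0 ≤ Real.log (1 + L ^ 2 / lam) := Real.log_nonneg (by linarith)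
    have hl2 : 0 < Real.log 2 := Real.log_pos (by norm_num)
    rw [hκ]
    have : 0 ≤ Real.log (1 + L ^ 2 / lam) / Real.log 2 := by positivity
    linarith
  refine ⟨2 * C * √(2 * ((1 + L ^ 2 / lam) * κ)) + K, by positivity, ?_⟩
  intro d T w i D θ X η hd hT hw hwH hHT hD hXD hmax
  set H := blockLength d T with hH
  set A := i * H with hA
  set E := min ((i + 1) * H) T with hE
  set g := radiusScale d R with hg
  set β := radius d T R L S lam w with hβ
  have hg1 : 1 ≤ g := one_le_radiusScale hd R
  have hwT : w ≤ T := hwH.trans hHT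
  have hT' : (2 : ℝ) ≤ T := by exact_mod_cast hT
  have hlT : 0 ≤ Real.log T := Real.log_nonneg (by linarith)
  have hw0 : (0 : ℝ) < w := by exact_mod_cast hw
  have hXL : ∀ t < T, ‖X t‖ ≤ L := fun t ht => hD.norm_action_le t ht _ (hXD t ht)
  have hwin : ∀ t ∈ blockRounds d T i, windowRounds d T w t = Finset.Ico (max A (t - w)) t := by
    intro t ht
    rw [windowRounds, div_mul_eq_of_mem_blockRounds ht]
  have hper : ∀ t ∈ blockRounds d T i, gap D θ X t ≤
      2 * β * invNorm lam X (Finset.Ico (max A (t - w)) t) (X t).ofLp +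
        K * (√w / g) * driftOn θ (Finset.Ico (max A (t - w)) t) +
        2 * (if NoiseExceeds T R L lam w X η t then 1 else 0) := by
    intro t ht
    have htT := lt_of_mem_blockRounds ht
    have hB := driftOn_nonneg θ (Finset.Ico (max A (t - w)) t)
    have hn := invNorm_nonneg lam X (Finset.Ico (max A (t - w)) t) (X t).ofLp
    have hβ0 : 0 ≤ β := by rw [hβ]; unfold radius; positivity
    have h0 : 0 ≤ 2 * β * invNorm lam X (Finset.Ico (max A (t - w)) t) (X t).ofLp +
        K * (√w / g) * driftOn θ (Finset.Ico (max A (t - w)) t) := by positivity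
    -- A round with excessive noise is charged the trivial gap 2.
    split_ifs with hf
    · have := hD.gap_le_two htT (hXD t htT)
      linarith
    · rw [NoiseExceeds, hwin t ht, not_lt] at hf
      rw [mul_zero, add_zero]
      unfold gap
      rw [sub_le_iff_le_add]
      refine optimalReward_le_of_forall (hXD t htT) fun y hy => ?_
      rw [← sub_le_iff_le_add]
      have hy1 := abs_le.1 (hD.abs_reward_le t htT y hy)
      have hX1 := abs_le.1 (hD.abs_reward_le t htT _ (hXD t htT))
      have hm := hmax t ht hy
      simp only [ucb, estimate, gram, hwin t ht, Set.mem_ofPred_eq] at hm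
      refine (hround d T w θ X η (max A (t - w)) t y hd hT hwT (by omega)
        (fun s hs => hXL s ((Finset.mem_Ico.1 hs).2.trans htT)) (hXL t htT)
        (hD.norm_action_le t htT y hy) (hD.norm_param_le t htT) (by linarith [hy1.2, hX1.1])
        hf hm).trans (le_of_eq ?_)
      rw [← hβ, ← hg]
      ring
  refine (Finset.sum_le_sum hper).trans ?_
  rw [Finset.sum_add_distrib, Finset.sum_add_distrib, ← Finset.mul_sum, ← Finset.mul_sum,
    ← Finset.mul_sum]
  refine add_le_add ?_ le_rfl
  have hsum1 : ∑ t ∈ blockRounds d T i, invNorm lam X (Finset.Ico (max A (t - w)) t) (X t).ofLp ≤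
      √(2 * ((1 + L ^ 2 / lam) * κ)) * ((1 + Real.log T) * √d * H / √w) := by
    rcases le_or_gt A E with hAE | hAE
    · have hn : E = A + (E - A) := by omega
      have hnH : E - A ≤ H := by
        have := min_le_left ((i + 1) * H) T
        rw [← hE, add_mul, one_mul] at this
        omega
      have := sum_invNorm_le hlam X (L := L) (A := A) hw hwH hnH fun s hs => hXL s (by
        rw [← hn, Finset.mem_Ico] at hs
        exact lt_of_lt_of_le hs.2 (min_le_right _ _))
      rw [← hn] at this
      refine this.trans ?_
      have hlw := log_window_le (L := L) hlam hT hwT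
      rw [← hκ] at hlw
      have h1 : √(2 * ((1 + L ^ 2 / lam) * (d * Real.log (1 + w * L ^ 2 / lam))) / w) ≤
          √(2 * ((1 + L ^ 2 / lam) * κ)) * ((1 + Real.log T) * √d / √w) := by
        refine Real.sqrt_le_iff.2 ⟨by positivity, ?_⟩
        rw [mul_pow, div_pow, mul_pow, Real.sq_sqrt (by positivity), Real.sq_sqrt (by positivity),
          Real.sq_sqrt (by positivity)]
        have h2 : Real.log (1 + w * L ^ 2 / lam) ≤ κ * (1 + Real.log T) ^ 2 := by
          refine hlw.trans ?_
          gcongr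
          nlinarith
        calc _ ≤ 2 * ((1 + L ^ 2 / lam) * (d * (κ * (1 + Real.log T) ^ 2))) / w := by gcongr
          _ = _ := by ring
      calc _ ≤ (H : ℝ) * (√(2 * ((1 + L ^ 2 / lam) * κ)) * ((1 + Real.log T) * √d / √w)) := by
            gcongr
        _ = _ := by ring
    · have : blockRounds d T i = ∅ := by
        rw [blockRounds]
        exact Finset.Ico_eq_empty_of_le hAE.le
      rw [this, Finset.sum_empty]
      positivity
  have hsum2 := sum_driftOn_le θ (A := A) (E := E) w
  have hβ0 : 0 ≤ β := by rw [hβ]; unfold radius; positivity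
  have hβC := hrad d T w hd hT hwT
  rw [← hβ, ← hg] at hβC
  have hB := driftOn_nonneg θ (Finset.Ico A (E - 1))
  set B := driftOn θ (Finset.Ico A (E - 1)) with hBdef
  set u := (1 + Real.log T) * √d * H / √w with hu
  have hu0 : 0 ≤ u := by positivity
  set v := √(2 * ((1 + L ^ 2 / lam) * κ)) with hv
  have hv0 : 0 ≤ v := Real.sqrt_nonneg _
  have e1 : (1 + Real.log T) ^ 2 * g * √d * H / √w = g * (1 + Real.log T) * u := by
    rw [hu]; ring
  have e2 : w * √w / g * B = √w / g * (w * B) := by ring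
  rw [e1, e2]
  have p1 : 2 * β * ∑ t ∈ blockRounds d T i,
      invNorm lam X (Finset.Ico (max A (t - w)) t) (X t).ofLp ≤
      2 * (C * g * (1 + Real.log T)) * (v * u) := by
    refine mul_le_mul (by linarith) hsum1 (Finset.sum_nonneg fun t _ => invNorm_nonneg _ _ _ _)
      (by positivity)
  have p2 : K * (√w / g) * ∑ t ∈ blockRounds d T i, driftOn θ (Finset.Ico (max A (t - w)) t) ≤
      K * (√w / g) * (w * B) := mul_le_mul_of_nonneg_left hsum2 (by positivity)
  have q1 : 0 ≤ g * (1 + Real.log T) * u := by positivity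
  have q2 : 0 ≤ √w / g * (w * B) := by positivity
  have q3 : 0 ≤ K * (g * (1 + Real.log T) * u) := by positivity
  have q4 : 0 ≤ 2 * C * v * (√w / g * (w * B)) := by positivity
  nlinarith

/-! ### Self-normalized concentration -/

/-! ### One step of the method of mixtures -/

section Mixture

open scoped ENNReal

/-- The increment of the self-normalized exponential supermartingale. -/
def mixtureIncrement (r a m x : ℝ) : ℝ :=
  (√(1 + a))⁻¹ * Real.exp ((a * x ^ 2 + 2 * m * x - m ^ 2) / (2 * r * (1 + a)))

theorem mixtureIncrement_nonneg (r a m x : ℝ) : 0 ≤ mixtureIncrement r a m x := by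
  unfold mixtureIncrement; positivity

theorem measurable_mixtureIncrement (r : ℝ) :
    Measurable fun p : (ℝ × ℝ) × ℝ => mixtureIncrement r p.1.1 p.1.2 p.2 := by
  unfold mixtureIncrement; fun_prop

/-- Completing the square in `g`: the left side is an unnormalized Gaussian density, and its mass is
the increment. -/
theorem exp_mul_gaussianPDFReal_eq {r a : ℝ} (hr : 0 < r) (ha : 0 < a) (m x g : ℝ) :
    Real.exp (g * x - g ^ 2 * r / 2) * gaussianPDFReal (m / r) (Real.toNNReal (a / r)) g =
      mixtureIncrement r a m x *
        gaussianPDFReal ((a * x + m) / (r * (1 + a))) (Real.toNNReal (a / (r * (1 + a)))) g := by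
  unfold gaussianPDFReal mixtureIncrement
  rw [Real.coe_toNNReal _ (by positivity), Real.coe_toNNReal _ (by positivity)]
  have e1 : (√(2 * Real.pi * (a / r)))⁻¹ =
      (√(1 + a))⁻¹ * (√(2 * Real.pi * (a / (r * (1 + a)))))⁻¹ := by
    rw [← mul_inv, ← Real.sqrt_mul (by positivity)]
    congr 2
    field_simp
  rw [e1, mul_left_comm, ← Real.exp_add, mul_mul_mul_comm, ← Real.exp_add]
  congr 2
  field_simp
  ring

/-- For each `g`, sub-Gaussianity bounds the mean of `exp (g x - g² R² / 2)` by 1; averaging over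
`g` with law `N(m / R², a / R²)` and exchanging the integrals gives the increment. This Gaussian is
the current mixing law in the direction of the new action, so one-dimensional integrals suffice. For
`a = 0` it degenerates, and `ham` makes the increment equal to 1. -/
theorem lintegral_mixtureIncrement_le {R : ℝ≥0} (hR : R ≠ 0) {ν : Measure ℝ}
    [IsProbabilityMeasure ν] (hν : HasSubgaussianMGF id (R ^ 2) ν) {a m : ℝ} (ha : 0 ≤ a)
    (ham : a = 0 → m = 0) :
    ∫⁻ x, ENNReal.ofReal (mixtureIncrement ((R : ℝ) ^ 2) a m x) ∂ν ≤ 1 := by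
  rcases ha.eq_or_lt with rfl | ha
  · simp [mixtureIncrement, ham rfl]
  have hr : (0 : ℝ) < (R : ℝ) ^ 2 := by
    have : (0 : ℝ) < R := by exact_mod_cast pos_iff_ne_zero.2 hR
    positivity
  set r := (R : ℝ) ^ 2 with hrdef
  set v := Real.toNNReal (a / r) with hv
  have hv0 : v ≠ 0 := by
    rw [hv]; exact (Real.toNNReal_pos.2 (by positivity)).ne'
  have hv1 : Real.toNNReal (a / (r * (1 + a))) ≠ 0 := (Real.toNNReal_pos.2 (by positivity)).ne'
  have h1 : ∀ x, ENNReal.ofReal (mixtureIncrement r a m x) =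
      ∫⁻ g, ENNReal.ofReal (Real.exp (g * x - g ^ 2 * r / 2)) * gaussianPDF (m / r) v g := by
    intro x
    have : ∀ g, ENNReal.ofReal (Real.exp (g * x - g ^ 2 * r / 2)) * gaussianPDF (m / r) v g =
        ENNReal.ofReal (mixtureIncrement r a m x) *
          gaussianPDF ((a * x + m) / (r * (1 + a))) (Real.toNNReal (a / (r * (1 + a)))) g := by
      intro g
      rw [gaussianPDF, gaussianPDF, ← ENNReal.ofReal_mul (Real.exp_pos _).le,
        exp_mul_gaussianPDFReal_eq hr ha, ENNReal.ofReal_mul (mixtureIncrement_nonneg _ _ _ _)]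
    simp_rw [this]
    rw [lintegral_const_mul _ (measurable_gaussianPDF _ _), lintegral_gaussianPDF_eq_one _ hv1,
      mul_one]
  simp_rw [h1]
  rw [lintegral_lintegral_swap (by
    refine Measurable.aemeasurable ?_
    have h2 : Measurable fun p : ℝ × ℝ =>
        ENNReal.ofReal (Real.exp (p.2 * p.1 - p.2 ^ 2 * r / 2)) := by fun_prop
    exact h2.mul ((measurable_gaussianPDF _ _).comp measurable_snd))]
  rw [← lintegral_gaussianPDF_eq_one (m / r) hv0]
  refine lintegral_mono fun g => ?_
  rw [lintegral_mul_const _ (by fun_prop)]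
  refine mul_le_of_le_one_left zero_le ?_
  have h3 := hν.mgf_le g
  have h4 := hν.integrable_exp_mul g
  rw [mgf] at h3
  simp only [id, NNReal.coe_pow] at h3 h4
  have h5 : ∀ x, Real.exp (g * x - g ^ 2 * r / 2) =
      Real.exp (g * x) * Real.exp (-(g ^ 2 * r / 2)) := fun x => by
    rw [← Real.exp_add]; ring_nf
  rw [← ofReal_integral_eq_lintegral_ofReal]
  · rw [ENNReal.ofReal_le_one]
    simp_rw [h5]
    rw [integral_mul_const, Real.exp_neg, ← div_eq_mul_inv, div_le_one (Real.exp_pos _)]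
    refine h3.trans (le_of_eq ?_)
    rw [hrdef]; ring_nf
  · simp_rw [h5]
    exact h4.mul_const _
  · exact Filter.Eventually.of_forall fun x => (Real.exp_pos _).le

/-- Integrating out an independent variable. -/
theorem lintegral_comp_indep {Ω E : Type*} {m0 mΩ : MeasurableSpace Ω} [MeasurableSpace E]
    {P : Measure Ω} [IsProbabilityMeasure P] (hm : m0 ≤ mΩ)
    {Y : Ω → E} {η : Ω → ℝ} (hY : Measurable[m0] Y) (hη : Measurable η)
    (hind : Indep (MeasurableSpace.comap η inferInstance) m0 P) {F : E × ℝ → ℝ≥0∞}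
    (hF : Measurable F) :
    ∫⁻ ω, F (Y ω, η ω) ∂P = ∫⁻ ω, ∫⁻ x, F (Y ω, x) ∂(P.map η) ∂P := by
  have hY' : Measurable Y := hY.mono hm le_rfl
  have hI : IndepFun Y η P :=
    (indep_of_indep_of_le_right hind (measurable_iff_comap_le.1 hY)).symm
  have h1 := (indepFun_iff_map_prod_eq_prod_map_map hY'.aemeasurable hη.aemeasurable).1 hI
  have h2 : ∫⁻ ω, F (Y ω, η ω) ∂P = ∫⁻ z, F z ∂(P.map fun ω => (Y ω, η ω)) := by
    rw [lintegral_map hF (hY'.prodMk hη)]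
  have : IsProbabilityMeasure (P.map η) := Measure.isProbabilityMeasure_map hη.aemeasurable
  rw [h2, h1, lintegral_prod _ hF.aemeasurable, lintegral_map hF.lintegral_prod_right' hY']

end Mixture

/-! ### Measurability of random quadratic forms -/

section Measurability

variable {Ω : Type*} {m : MeasurableSpace Ω} {d : ℕ}

theorem measurable_det {V : Ω → Matrix (Fin d) (Fin d) ℝ}
    (hV : ∀ i j, Measurable fun ω => V ω i j) : Measurable fun ω => (V ω).det := by
  simp only [Matrix.det_apply]
  refine Finset.measurable_sum _ fun σ _ => Measurable.const_smul ?_ _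
  exact Finset.measurable_prod _ fun i _ => hV _ _

/-- By Cramer's rule the entries of the inverse are quotients of determinants, also at singular
matrices under the convention that the inverse of 0 is 0. -/
theorem measurable_inv_apply {V : Ω → Matrix (Fin d) (Fin d) ℝ}
    (hV : ∀ i j, Measurable fun ω => V ω i j) (i j : Fin d) :
    Measurable fun ω => (V ω)⁻¹ i j := by
  simp only [Matrix.inv_def, Ring.inverse_eq_inv', Matrix.smul_apply, smul_eq_mul,
    Matrix.adjugate_apply]
  refine (measurable_det hV).inv.mul (measurable_det fun k l => ?_)
  by_cases h : k = j
  · subst h; simp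
  · simpa [Matrix.updateRow_ne h] using hV k l

theorem measurable_inv_quad {V : Ω → Matrix (Fin d) (Fin d) ℝ}
    (hV : ∀ i j, Measurable fun ω => V ω i j) {u v : Ω → Fin d → ℝ}
    (hu : ∀ i, Measurable fun ω => u ω i) (hv : ∀ i, Measurable fun ω => v ω i) :
    Measurable fun ω => u ω ⬝ᵥ ((V ω)⁻¹ *ᵥ v ω) := by
  simp only [dotProduct, Matrix.mulVec]
  refine Finset.measurable_sum _ fun i _ => (hu i).mul ?_
  exact Finset.measurable_sum _ fun j _ => (measurable_inv_apply hV i j).mul (hv j)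

theorem measurable_vec_apply {x : Ω → Vec d} (hx : Measurable x) (i : Fin d) :
    Measurable fun ω => (x ω).ofLp i := by
  have : Continuous fun y : Vec d => y.ofLp i := by fun_prop
  exact this.measurable.comp hx

theorem measurable_actionGram_apply {X : ℕ → Ω → Vec d} {I : Finset ℕ} (lam : ℝ)
    (hX : ∀ s ∈ I, Measurable (X s)) (i j : Fin d) :
    Measurable fun ω => actionGram lam (fun s => X s ω) I i j := by
  simp only [actionGram, ridge, Matrix.add_apply, Matrix.sum_apply, Matrix.vecMulVec_apply]
  refine measurable_const.add (Finset.measurable_sum _ fun s hs => ?_)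
  exact (measurable_vec_apply (hX s hs) i).mul (measurable_vec_apply (hX s hs) j)

theorem measurable_noiseSum_apply {X : ℕ → Ω → Vec d} {η : ℕ → Ω → ℝ} {I : Finset ℕ}
    (hX : ∀ s ∈ I, Measurable (X s)) (hη : ∀ s ∈ I, Measurable (η s)) (i : Fin d) :
    Measurable fun ω => noiseSum (fun s => X s ω) (fun s => η s ω) I i := by
  simp only [noiseSum, Finset.sum_apply, Pi.smul_apply, smul_eq_mul]
  exact Finset.measurable_sum _ fun s hs => (hη s hs).mul (measurable_vec_apply (hX s hs) i)

end Measurability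

/-! ### The self-normalized supermartingale -/

section SelfNormalized

variable {d : ℕ}

/-- The squared self-normalized noise. -/
def noiseQuad (lam : ℝ) (X : ℕ → Vec d) (η : ℕ → ℝ) (I : Finset ℕ) : ℝ :=
  noiseSum X η I ⬝ᵥ ((actionGram lam X I)⁻¹ *ᵥ noiseSum X η I)

/-- The self-normalized exponential supermartingale started at `a`. -/
def noiseMixture (lam r : ℝ) (X : ℕ → Vec d) (η : ℕ → ℝ) (a t : ℕ) : ℝ :=
  (√((actionGram lam X (Finset.Ico a t)).det / lam ^ d))⁻¹ *
    Real.exp (noiseQuad lam X η (Finset.Ico a t) / (2 * r))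

theorem noiseMixture_nonneg (lam r : ℝ) (X : ℕ → Vec d) (η : ℕ → ℝ) (a t : ℕ) :
    0 ≤ noiseMixture lam r X η a t := by
  unfold noiseMixture; positivity

theorem noiseMixture_self {lam : ℝ} (hlam : 0 < lam) (r : ℝ) (X : ℕ → Vec d) (η : ℕ → ℝ)
    (a : ℕ) : noiseMixture lam r X η a a = 1 := by
  simp [noiseMixture, noiseQuad, noiseSum, det_ridge_empty, hlam.ne']

/-- The rank one update of the inverse form, expanded at the updated noise vector. The increment is
exactly the exponent in `mixtureIncrement`. -/
theorem noiseQuad_succ {lam : ℝ} (hlam : 0 < lam) (X : ℕ → Vec d) (η : ℕ → ℝ) {a t : ℕ}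
    (hat : a ≤ t) :
    noiseQuad lam X η (Finset.Ico a (t + 1)) = noiseQuad lam X η (Finset.Ico a t) +
      ((X t).ofLp ⬝ᵥ ((actionGram lam X (Finset.Ico a t))⁻¹ *ᵥ (X t).ofLp) * η t ^ 2 +
        2 * ((X t).ofLp ⬝ᵥ ((actionGram lam X (Finset.Ico a t))⁻¹ *ᵥ
          noiseSum X η (Finset.Ico a t))) * η t -
        ((X t).ofLp ⬝ᵥ ((actionGram lam X (Finset.Ico a t))⁻¹ *ᵥ
          noiseSum X η (Finset.Ico a t))) ^ 2) /
      (1 + (X t).ofLp ⬝ᵥ ((actionGram lam X (Finset.Ico a t))⁻¹ *ᵥ (X t).ofLp)) := by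
  have hV : (actionGram lam X (Finset.Ico a t)).PosDef := ridge_posDef hlam _ _
  have hW : (actionGram lam X (Finset.Ico a (t + 1))).PosDef := ridge_posDef hlam _ _
  have hs : noiseSum X η (Finset.Ico a (t + 1)) =
      noiseSum X η (Finset.Ico a t) + η t • (X t).ofLp := by
    rw [noiseSum, Finset.sum_Ico_succ_top hat, noiseSum]
  have hr := ridge_Ico_succ lam (fun s => (X s).ofLp) hat
  unfold noiseQuad
  rw [actionGram] at hW
  rw [hr] at hW
  rw [actionGram, hr, PosDef.inv_quad_add_vecMulVec hV _ _ hW, hs]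
  have hq : 0 ≤ (X t).ofLp ⬝ᵥ ((actionGram lam X (Finset.Ico a t))⁻¹ *ᵥ (X t).ofLp) :=
    ridge_inv_quad_nonneg hlam _ _ _
  have hsym := PosDef.mulVec_symm hV.inv (noiseSum X η (Finset.Ico a t)) (X t).ofLp
  simp only [Matrix.mulVec_add, Matrix.mulVec_smul, dotProduct_add, add_dotProduct,
    dotProduct_smul, smul_dotProduct, smul_eq_mul]
  rw [hsym]
  change 0 ≤ (X t).ofLp ⬝ᵥ ((ridge lam (fun s => (X s).ofLp) (Finset.Ico a t))⁻¹ *ᵥ (X t).ofLp)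
    at hq
  field_simp
  ring

/-- The determinant contributes the factor `(√(1 + a))⁻¹` and the quadratic form the exponential, so
the process is a product of one-step increments. -/
theorem noiseMixture_succ {lam r : ℝ} (hlam : 0 < lam) (X : ℕ → Vec d) (η : ℕ → ℝ)
    {a t : ℕ} (hat : a ≤ t) :
    noiseMixture lam r X η a (t + 1) = noiseMixture lam r X η a t *
      mixtureIncrement r
        ((X t).ofLp ⬝ᵥ ((actionGram lam X (Finset.Ico a t))⁻¹ *ᵥ (X t).ofLp))
        ((X t).ofLp ⬝ᵥ ((actionGram lam X (Finset.Ico a t))⁻¹ *ᵥ noiseSum X η (Finset.Ico a t)))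
        (η t) := by
  have hq : 0 ≤ (X t).ofLp ⬝ᵥ ((actionGram lam X (Finset.Ico a t))⁻¹ *ᵥ (X t).ofLp) :=
    ridge_inv_quad_nonneg hlam _ _ _
  have hdet : 0 < (actionGram lam X (Finset.Ico a t)).det := (ridge_posDef hlam _ _).det_pos
  unfold noiseMixture mixtureIncrement
  rw [noiseQuad_succ hlam X η hat]
  have h1 := det_ridge_Ico_succ hlam (fun s => (X s).ofLp) hat
  rw [actionGram, h1, mul_div_right_comm, Real.sqrt_mul (by positivity), mul_inv,
    mul_mul_mul_comm, ← Real.exp_add]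
  congr 2
  rw [add_div, div_div]
  congr 2
  ring

end SelfNormalized

/-! ### Confidence of the noise radius along a run -/

section Run

open scoped ENNReal

variable {d T : ℕ} {R : ℝ≥0} {L S lam : ℝ} {D : ℕ → Set (Vec d)} {θ : ℕ → Vec d}
  {ν : Measure ℝ} {Ω : Type*} {mΩ : MeasurableSpace Ω} {P : Measure Ω} {𝓕 : Filtration ℕ mΩ}
  {arm : ℕ → Ω → Arm d T} {X : ℕ → Ω → Vec d} {η : ℕ → Ω → ℝ}

theorem IsRun.measurable_action_of_le (h : IsRun d T R L S lam D θ ν P 𝓕 arm X η) {t k : ℕ}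
    (ht : t < T) (hk : 2 * t + 1 ≤ k) : Measurable[𝓕 k] (X t) :=
  (h.measurable_action t ht).mono (𝓕.mono hk) le_rfl

theorem IsRun.measurable_noise_of_le (h : IsRun d T R L S lam D θ ν P 𝓕 arm X η) {t k : ℕ}
    (ht : t < T) (hk : 2 * t + 2 ≤ k) : Measurable[𝓕 k] (η t) :=
  (h.measurable_noise t ht).mono (𝓕.mono hk) le_rfl

theorem IsRun.measurable_action' (h : IsRun d T R L S lam D θ ν P 𝓕 arm X η) {t : ℕ}
    (ht : t < T) : Measurable (X t) := (h.measurable_action t ht).mono (𝓕.le _) le_rfl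

theorem IsRun.measurable_noise' (h : IsRun d T R L S lam D θ ν P 𝓕 arm X η) {t : ℕ}
    (ht : t < T) : Measurable (η t) := (h.measurable_noise t ht).mono (𝓕.le _) le_rfl

theorem IsRun.measurable_noiseMixture (h : IsRun d T R L S lam D θ ν P 𝓕 arm X η) {a t : ℕ}
    (r : ℝ) (ht : t ≤ T) :
    Measurable[𝓕 (2 * t)] fun ω =>
      noiseMixture lam r (fun s => X s ω) (fun s => η s ω) a t := by
  have hX : ∀ s ∈ Finset.Ico a t, Measurable[𝓕 (2 * t)] (X s) := fun s hs => by
    have := Finset.mem_Ico.1 hs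
    exact h.measurable_action_of_le (by omega) (by omega)
  have hη : ∀ s ∈ Finset.Ico a t, Measurable[𝓕 (2 * t)] (η s) := fun s hs => by
    have := Finset.mem_Ico.1 hs
    exact h.measurable_noise_of_le (by omega) (by omega)
  unfold noiseMixture noiseQuad
  have h1 := @measurable_det Ω (𝓕 (2 * t)) d _
    (@measurable_actionGram_apply Ω (𝓕 (2 * t)) d X (Finset.Ico a t) lam hX)
  have h2 := @measurable_inv_quad Ω (𝓕 (2 * t)) d _
    (@measurable_actionGram_apply Ω (𝓕 (2 * t)) d X (Finset.Ico a t) lam hX) _ _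
    (@measurable_noiseSum_apply Ω (𝓕 (2 * t)) d X η (Finset.Ico a t) hX hη)
    (@measurable_noiseSum_apply Ω (𝓕 (2 * t)) d X η (Finset.Ico a t) hX hη)
  exact ((h1.div_const _).sqrt.inv).mul (h2.div_const _).exp

/-- The supermartingale property, by integrating out the newest noise, which is independent of
everything else in the integrand. The weight `Z`, known when the window opens, replaces conditional
expectations; importance weights will be inserted for it. -/
theorem IsRun.lintegral_noiseMixture_le [IsProbabilityMeasure P] [IsProbabilityMeasure ν]
    (h : IsRun d T R L S lam D θ ν P 𝓕 arm X η) (hν : HasSubgaussianMGF id (R ^ 2) ν)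
    (hR : R ≠ 0) (hlam : 0 < lam) {a t : ℕ} (hat : a ≤ t) (ht : t ≤ T) {Z : Ω → ℝ≥0∞}
    (hZ : Measurable[𝓕 (2 * a + 1)] Z) :
    ∫⁻ ω, Z ω * ENNReal.ofReal
        (noiseMixture lam ((R : ℝ) ^ 2) (fun s => X s ω) (fun s => η s ω) a t) ∂P ≤
      ∫⁻ ω, Z ω ∂P := by
  induction t, hat using Nat.le_induction with
  | base => simp [noiseMixture_self hlam]
  | succ t hat ih =>
    refine le_trans ?_ (ih (by omega))
    have htT : t < T := by omega
    set q : Ω → ℝ := fun ω => (X t ω).ofLp ⬝ᵥ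
      ((actionGram lam (fun s => X s ω) (Finset.Ico a t))⁻¹ *ᵥ (X t ω).ofLp) with hq
    set m : Ω → ℝ := fun ω => (X t ω).ofLp ⬝ᵥ
      ((actionGram lam (fun s => X s ω) (Finset.Ico a t))⁻¹ *ᵥ
        noiseSum (fun s => X s ω) (fun s => η s ω) (Finset.Ico a t)) with hm
    have hX : ∀ s ∈ Finset.Ico a t, Measurable[𝓕 (2 * t + 1)] (X s) := fun s hs => by
      have := Finset.mem_Ico.1 hs
      exact h.measurable_action_of_le (by omega) (by omega)
    have hη : ∀ s ∈ Finset.Ico a t, Measurable[𝓕 (2 * t + 1)] (η s) := fun s hs => by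
      have := Finset.mem_Ico.1 hs
      exact h.measurable_noise_of_le (by omega) (by omega)
    have hXt := @measurable_vec_apply Ω (𝓕 (2 * t + 1)) d _ (h.measurable_action t htT)
    have hq_meas : Measurable[𝓕 (2 * t + 1)] q :=
      @measurable_inv_quad Ω (𝓕 (2 * t + 1)) d _
        (@measurable_actionGram_apply Ω (𝓕 (2 * t + 1)) d X (Finset.Ico a t) lam hX) _ _ hXt hXt
    have hm_meas : Measurable[𝓕 (2 * t + 1)] m :=
      @measurable_inv_quad Ω (𝓕 (2 * t + 1)) d _
        (@measurable_actionGram_apply Ω (𝓕 (2 * t + 1)) d X (Finset.Ico a t) lam hX) _ _ hXt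
        (@measurable_noiseSum_apply Ω (𝓕 (2 * t + 1)) d X η (Finset.Ico a t) hX hη)
    set A : Ω → ℝ≥0∞ := fun ω => Z ω * ENNReal.ofReal
      (noiseMixture lam ((R : ℝ) ^ 2) (fun s => X s ω) (fun s => η s ω) a t) with hA
    have hA_meas : Measurable[𝓕 (2 * t + 1)] A :=
      (hZ.mono (𝓕.mono (by omega)) le_rfl).mul (ENNReal.measurable_ofReal.comp
        ((h.measurable_noiseMixture _ htT.le).mono (𝓕.mono (by omega)) le_rfl))
    have hF : Measurable fun p : (ℝ≥0∞ × (ℝ × ℝ)) × ℝ => p.1.1 * ENNReal.ofReal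
        (mixtureIncrement ((R : ℝ) ^ 2) p.1.2.1 p.1.2.2 p.2) := by
      refine measurable_fst.fst.mul (ENNReal.measurable_ofReal.comp ?_)
      exact (measurable_mixtureIncrement ((R : ℝ) ^ 2)).comp
        (measurable_fst.snd.prodMk measurable_snd)
    have hY : Measurable[𝓕 (2 * t + 1)] fun ω => (A ω, (q ω, m ω)) :=
      hA_meas.prodMk (hq_meas.prodMk hm_meas)
    have h1 := lintegral_comp_indep (P := P) (𝓕.le (2 * t + 1)) hY (h.measurable_noise' htT)
      (h.indep_noise t htT) hF
    rw [h.law_noise t htT] at h1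
    have h2 : ∫⁻ ω, Z ω * ENNReal.ofReal
        (noiseMixture lam ((R : ℝ) ^ 2) (fun s => X s ω) (fun s => η s ω) a (t + 1)) ∂P =
        ∫⁻ ω, A ω * ENNReal.ofReal (mixtureIncrement ((R : ℝ) ^ 2) (q ω) (m ω) (η t ω)) ∂P := by
      refine lintegral_congr fun ω => ?_
      rw [noiseMixture_succ hlam _ _ hat, ENNReal.ofReal_mul (noiseMixture_nonneg _ _ _ _ _ _),
        ← mul_assoc]
    rw [h2, h1]
    refine lintegral_mono fun ω => ?_
    have hq0 : 0 ≤ q ω := ridge_inv_quad_nonneg hlam _ _ _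
    -- The degenerate case of the one-step bound: by Cauchy–Schwarz, an action of inverse-Gram norm
    -- zero does not see the noise vector.
    have hqm : q ω = 0 → m ω = 0 := by
      intro h0
      have h3 := PosDef.sq_quad_le (ridge_posDef hlam (fun s => (X s ω).ofLp)
        (Finset.Ico a t)).inv (X t ω).ofLp
        (noiseSum (fun s => X s ω) (fun s => η s ω) (Finset.Ico a t))
      change m ω ^ 2 ≤ q ω * _ at h3
      rw [h0, zero_mul] at h3
      exact pow_eq_zero_iff (two_ne_zero) |>.1 (le_antisymm h3 (sq_nonneg _))
    change ∫⁻ x, A ω * ENNReal.ofReal (mixtureIncrement ((R : ℝ) ^ 2) (q ω) (m ω) x) ∂ν ≤ A ω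
    rw [lintegral_const_mul _ (by unfold mixtureIncrement; fun_prop)]
    exact mul_le_of_le_one_right zero_le (lintegral_mixtureIncrement_le hR hν hq0 hqm)

/-- The log-determinant is at most `d log (1 + w L² / lam)`, which is the first part of the squared
noise radius over `R²`. The other part, `log T / 2`, is halved in the exponent and leaves `T^(1/4)`.
-/
theorem le_noiseMixture_of_noiseExceeds {X : ℕ → Vec d} {η : ℕ → ℝ} {a t w : ℕ} (hlam : 0 < lam)
    (hR : R ≠ 0) (hT : 1 ≤ T) (hw : t ≤ a + w) (hX : ∀ s ∈ Finset.Ico a t, ‖X s‖ ≤ L)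
    (hwin : windowRounds d T w t = Finset.Ico a t) (h : NoiseExceeds T R L lam w X η t) :
    (T : ℝ) ^ (1 / 4 : ℝ) ≤ noiseMixture lam ((R : ℝ) ^ 2) X η a t := by
  have hR' : (0 : ℝ) < R := by exact_mod_cast pos_iff_ne_zero.2 hR
  have hT' : (1 : ℝ) ≤ T := by exact_mod_cast hT
  rw [NoiseExceeds, hwin, noiseRadius, invNorm] at h
  have hlog0 : 0 ≤ Real.log (1 + w * L ^ 2 / lam) := Real.log_nonneg (by
    have : 0 ≤ w * L ^ 2 / lam := by positivity
    linarith)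
  have hlT : 0 ≤ Real.log T := Real.log_nonneg hT'
  set u := (d : ℝ) * Real.log (1 + w * L ^ 2 / lam) with hu
  have hu0 : 0 ≤ u := by positivity
  have hdet : 0 < (actionGram lam X (Finset.Ico a t)).det := (ridge_posDef hlam _ _).det_pos
  have h1 : (R : ℝ) ^ 2 * (u + Real.log T / 2) < noiseQuad lam X η (Finset.Ico a t) := by
    have h2 := (Real.lt_sqrt (by positivity)).1 h
    rw [mul_pow, Real.sq_sqrt (by positivity)] at h2
    exact h2
  have h3 : Real.log ((actionGram lam X (Finset.Ico a t)).det / lam ^ d) ≤ u := by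
    refine log_det_ridge_le hlam _ _ (fun s hs => ?_) (by simp; omega)
    rw [dotProduct_self_eq]
    have := hX s hs
    gcongr
  set q := (actionGram lam X (Finset.Ico a t)).det / lam ^ d with hq
  have hq0 : 0 < q := by positivity
  have h4 : (√q)⁻¹ = Real.exp (-(Real.log q / 2)) := by
    rw [Real.exp_neg, ← Real.log_sqrt hq0.le, Real.exp_log (Real.sqrt_pos.2 hq0)]
  rw [noiseMixture, ← hq, h4, ← Real.exp_add, Real.rpow_def_of_pos (by linarith)]
  refine Real.exp_le_exp.2 ?_
  have h5 : (u + Real.log T / 2) / 2 ≤ noiseQuad lam X η (Finset.Ico a t) / (2 * (R : ℝ) ^ 2) := by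
    rw [div_le_div_iff₀ (by norm_num) (by positivity)]
    linarith
  linarith

theorem IsRun.measurableSet_noiseExceeds (h : IsRun d T R L S lam D θ ν P 𝓕 arm X η) (w : ℕ)
    {t : ℕ} (ht : t ≤ T) :
    MeasurableSet {ω | NoiseExceeds T R L lam w (fun s => X s ω) (fun s => η s ω) t} := by
  have hX : ∀ s ∈ windowRounds d T w t, Measurable (X s) := fun s hs => by
    have := Finset.mem_Ico.1 hs
    exact h.measurable_action' (by omega)
  have hη : ∀ s ∈ windowRounds d T w t, Measurable (η s) := fun s hs => by
    have := Finset.mem_Ico.1 hs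
    exact h.measurable_noise' (by omega)
  exact measurableSet_lt measurable_const (measurable_inv_quad
    (measurable_actionGram_apply lam hX) (measurable_noiseSum_apply hX hη)
    (measurable_noiseSum_apply hX hη)).sqrt

theorem IsRun.ae_noise_eq_zero (h : IsRun d T R L S lam D θ ν P 𝓕 arm X η)
    (hν : HasSubgaussianMGF id (R ^ 2) ν) (hR : R = 0) {t : ℕ} (ht : t < T) :
    η t =ᵐ[P] 0 := by
  subst hR
  have h1 : HasSubgaussianMGF id 0 ν := by simpa using hν
  have h2 := h1.ae_eq_zero_of_hasSubgaussianMGF_zero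
  rw [← h.law_noise t ht] at h2
  exact ae_of_ae_map (h.measurable_noise' ht).aemeasurable h2

open Classical in
/-- Conditionally on the arm of a block, the noise radius is exceeded with probability at most
`T^(-1/4)`. -/
theorem IsRun.lintegral_noiseExceeds_le [IsProbabilityMeasure P] [IsProbabilityMeasure ν]
    (h : IsRun d T R L S lam D θ ν P 𝓕 arm X η) (hν : HasSubgaussianMGF id (R ^ 2) ν)
    (hlam : 0 < lam) (hD : IsNormalized T L S D θ) {i t : ℕ} (w : ℕ)
    (ht : t ∈ blockRounds d T i) {Z : Ω → ℝ≥0∞}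
    (hZ : Measurable[𝓕 (2 * (i * blockLength d T) + 1)] Z) :
    ∫⁻ ω, Z ω * (if NoiseExceeds T R L lam w (fun s => X s ω) (fun s => η s ω) t then 1 else 0)
        ∂P ≤ ENNReal.ofReal ((T : ℝ) ^ (-(1 / 4) : ℝ)) * ∫⁻ ω, Z ω ∂P := by
  have htT := lt_of_mem_blockRounds ht
  have hT' : (0 : ℝ) < T := by exact_mod_cast (by omega : 0 < T)
  have hwin : windowRounds d T w t =
      Finset.Ico (max (i * blockLength d T) (t - w)) t := by
    rw [windowRounds, div_mul_eq_of_mem_blockRounds ht]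
  rcases eq_or_ne R 0 with hR | hR
  -- For `R = 0` the noise vanishes almost surely and the noise radius is not negative, so the
  -- strict inequality fails.
  · have hall : ∀ᵐ ω ∂P, ∀ s ∈ windowRounds d T w t, η s ω = 0 := by
      rw [Finset.eventually_all]
      intro s hs
      have := Finset.mem_Ico.1 hs
      exact h.ae_noise_eq_zero hν hR (by omega)
    have : ∫⁻ ω, Z ω * (if NoiseExceeds T R L lam w (fun s => X s ω) (fun s => η s ω) t
        then 1 else 0) ∂P = 0 := by
      refine (lintegral_congr_ae ?_).trans lintegral_zero
      filter_upwards [hall] with ω hω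
      have h0 : noiseSum (fun s => X s ω) (fun s => η s ω) (windowRounds d T w t) = 0 :=
        Finset.sum_eq_zero fun s hs => by simp only [hω s hs, zero_smul]
      rw [if_neg, mul_zero]
      rw [NoiseExceeds, h0, not_lt]
      simp [invNorm, noiseRadius, hR]
    rw [this]
    exact zero_le
  · set a := max (i * blockLength d T) (t - w) with ha
    have hmem := Finset.mem_Ico.1 ht
    have hat : a ≤ t := by omega
    -- The window never reaches back before its block, so what is known once the arm is drawn is
    -- known when the window opens. This is where the restart is used.
    have hZa : Measurable[𝓕 (2 * a + 1)] Z := hZ.mono (𝓕.mono (by omega)) le_rfl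
    have h1 := h.lintegral_noiseMixture_le hν hR hlam hat htT.le hZa
    -- Markov's inequality, in its pointwise form so that the weight `Z` can be kept.
    have h2 : ∀ ω, Z ω * (if NoiseExceeds T R L lam w (fun s => X s ω) (fun s => η s ω) t
        then 1 else 0) ≤ ENNReal.ofReal ((T : ℝ) ^ (-(1 / 4) : ℝ)) * (Z ω * ENNReal.ofReal
        (noiseMixture lam ((R : ℝ) ^ 2) (fun s => X s ω) (fun s => η s ω) a t)) := by
      intro ω
      split_ifs with hf
      · have h3 := le_noiseMixture_of_noiseExceeds (T := T) hlam hR (by omega)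
          (show t ≤ a + w by omega) (fun s hs => hD.norm_action_le s
            ((Finset.mem_Ico.1 hs).2.trans htT) _ (h.action_mem s
            ((Finset.mem_Ico.1 hs).2.trans htT) ω)) hwin hf
        rw [mul_left_comm]
        refine mul_le_mul_right ?_ (Z ω)
        rw [← ENNReal.ofReal_mul (by positivity), ← ENNReal.ofReal_one]
        refine ENNReal.ofReal_le_ofReal ?_
        calc (1 : ℝ) = (T : ℝ) ^ (-(1 / 4) : ℝ) * (T : ℝ) ^ (1 / 4 : ℝ) := by
              rw [← Real.rpow_add hT']; norm_num
          _ ≤ _ := by gcongr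
      · rw [mul_zero]; exact zero_le
    refine (lintegral_mono h2).trans ?_
    rw [lintegral_const_mul']
    · exact mul_le_mul_right h1 _
    · exact ENNReal.ofReal_ne_top

end Run

/-! ### EXP3 along a path -/

section EXP3

variable {d T : ℕ} {R : ℝ≥0}

theorem sum_arm_const (c : ℝ) : ∑ _j : Arm d T, c = ((gridSize d T : ℝ) + 1) * c := by
  simp

theorem exp3Weight_pos (a : ℕ → Arm d T) (Y : ℕ → ℝ) (i : ℕ) (j : Arm d T) :
    0 < exp3Weight d T R a Y i j := by
  induction i with
  | zero => simp [exp3Weight]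
  | succ i ih =>
    simp only [exp3Weight]
    split_ifs
    · exact mul_pos ih (Real.exp_pos _)
    · exact ih

theorem exploration_le_one : exploration d T ≤ 1 := min_le_left _ _

theorem exploration_nonneg : 0 ≤ exploration d T := le_min zero_le_one (Real.sqrt_nonneg _)

/-- The exploration floor. It bounds the importance weights and keeps the exponents in the weight
update at most 1. -/
theorem le_exp3Prob (s : Arm d T → ℝ) (hs : ∀ j, 0 < s j) (j : Arm d T) :
    exploration d T / ((gridSize d T : ℝ) + 1) ≤ exp3Prob d T s j := by
  have h1 : 0 ≤ 1 - exploration d T := sub_nonneg.2 exploration_le_one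
  have h2 : 0 ≤ s j / ∑ u, s u :=
    div_nonneg (hs j).le (Finset.sum_nonneg fun u _ => (hs u).le)
  unfold exp3Prob
  have := mul_nonneg h1 h2
  linarith

/-- Dropping the exploration part compares the share of an arm in the total weight with its
probability; this is the source of `1 / (1 - γ)` in the growth of the total. -/
theorem mul_weight_le_exp3Prob (s : Arm d T → ℝ) (hs : ∀ j, 0 < s j) (j : Arm d T) :
    (1 - exploration d T) * s j ≤ exp3Prob d T s j * ∑ u, s u := by
  have hW : 0 < ∑ u, s u := Finset.sum_pos (fun u _ => hs u) Finset.univ_nonempty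
  have h1 : 0 ≤ exploration d T / ((gridSize d T : ℝ) + 1) :=
    div_nonneg exploration_nonneg (by positivity)
  rw [exp3Prob, add_mul, mul_assoc, div_mul_cancel₀ _ hW.ne']
  have := mul_nonneg h1 hW.le
  linarith

/-- The importance weight of arm `j` in block `i`. -/
def importanceWeight (d T : ℕ) (R : ℝ≥0) (a : ℕ → Arm d T) (Y : ℕ → ℝ) (i : ℕ) (j : Arm d T) :
    ℝ :=
  if a i = j then (exp3Prob d T (exp3Weight d T R a Y i) j)⁻¹ else 0

theorem importanceWeight_nonneg (a : ℕ → Arm d T) (Y : ℕ → ℝ) (i : ℕ) (j : Arm d T) :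
    0 ≤ importanceWeight d T R a Y i j := by
  unfold importanceWeight
  split_ifs
  · refine inv_nonneg.2 (le_trans ?_ (le_exp3Prob _ (fun j => exp3Weight_pos a Y i j) j))
    exact div_nonneg exploration_nonneg (by positivity)
  · exact le_rfl

theorem importanceWeight_le (hγ : 0 < exploration d T) (a : ℕ → Arm d T) (Y : ℕ → ℝ) (i : ℕ)
    (j : Arm d T) :
    importanceWeight d T R a Y i j ≤ ((gridSize d T : ℝ) + 1) / exploration d T := by
  unfold importanceWeight
  split_ifs
  · rw [← inv_div]
    exact inv_anti₀ (by positivity) (le_exp3Prob _ (fun j => exp3Weight_pos a Y i j) j)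
  · positivity

theorem exp3Weight_succ (a : ℕ → Arm d T) (Y : ℕ → ℝ) (i : ℕ) (j : Arm d T) :
    exp3Weight d T R a Y (i + 1) j = exp3Weight d T R a Y i j *
      Real.exp (exploration d T / ((gridSize d T : ℝ) + 1) *
        (importanceWeight d T R a Y i j * scaledBlockReward d T R Y i)) := by
  simp only [exp3Weight, importanceWeight]
  by_cases h : j = a i
  · rw [if_pos h, if_pos h.symm]
    congr 2
    rw [← div_div]; ring
  · rw [if_neg h, if_neg (Ne.symm h)]
    simp

theorem exp3Weight_eq (a : ℕ → Arm d T) (Y : ℕ → ℝ) (n : ℕ) (j : Arm d T) :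
    exp3Weight d T R a Y n j = Real.exp (exploration d T / ((gridSize d T : ℝ) + 1) *
      ∑ i ∈ Finset.range n,
        importanceWeight d T R a Y i j * scaledBlockReward d T R Y i) := by
  induction n with
  | zero => simp [exp3Weight]
  | succ n ih =>
    rw [exp3Weight_succ, ih, ← Real.exp_add, Finset.sum_range_succ, mul_add]

/-- Only the drawn arm changes, by a factor `exp y` with `0 ≤ y ≤ 1`, so `exp y ≤ 1 + y + y²`
applies. The share of that arm is at most `p / (1 - γ)`, which cancels the `1 / p` in `y`; the
quadratic term keeps one `1 / p`, the sum of the importance weights. -/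
theorem sum_exp3Weight_succ_le (hγ : 0 < exploration d T) (hγ1 : exploration d T < 1)
    (a : ℕ → Arm d T) (Y : ℕ → ℝ) (i : ℕ) (h0 : 0 ≤ scaledBlockReward d T R Y i)
    (h1 : scaledBlockReward d T R Y i ≤ 1) :
    ∑ j, exp3Weight d T R a Y (i + 1) j ≤ (∑ j, exp3Weight d T R a Y i j) *
      Real.exp (exploration d T / ((gridSize d T : ℝ) + 1) / (1 - exploration d T) *
        (scaledBlockReward d T R Y i + exploration d T / ((gridSize d T : ℝ) + 1) *
          ∑ j, importanceWeight d T R a Y i j)) := by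
  set K := (gridSize d T : ℝ) + 1 with hK
  have hK0 : 0 < K := by positivity
  set γ := exploration d T with hγdef
  set q := scaledBlockReward d T R Y i with hq
  set s := exp3Weight d T R a Y i with hs
  have hspos : ∀ j, 0 < s j := fun j => exp3Weight_pos a Y i j
  set W := ∑ j, s j with hW
  have hW0 : 0 < W := Finset.sum_pos (fun u _ => hspos u) Finset.univ_nonempty
  set p := exp3Prob d T s (a i) with hp
  have hpγ : γ / K ≤ p := le_exp3Prob s hspos (a i)
  have hp0 : 0 < p := lt_of_lt_of_le (by positivity) hpγ
  have hsum : ∑ j, importanceWeight d T R a Y i j = p⁻¹ := by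
    simp only [importanceWeight, Finset.sum_ite_eq, Finset.mem_univ, if_true]
    rw [← hs, ← hp]
  set y := γ / K * (p⁻¹ * q) with hy
  have hy0 : 0 ≤ y := by positivity
  have hy1 : y ≤ 1 := by
    have h2 : γ / K * p⁻¹ ≤ 1 := by rw [← div_eq_mul_inv, div_le_one hp0]; exact hpγ
    calc y = γ / K * p⁻¹ * q := by rw [hy]; ring
      _ ≤ 1 * 1 := mul_le_mul h2 h1 h0 zero_le_one
      _ = 1 := one_mul 1
  have hexp : Real.exp y ≤ 1 + y + y ^ 2 := by
    have := Real.abs_exp_sub_one_sub_id_le (show |y| ≤ 1 by rwa [abs_of_nonneg hy0])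
    linarith [(abs_le.1 this).2]
  have hnext : ∑ j, exp3Weight d T R a Y (i + 1) j = W + s (a i) * (Real.exp y - 1) := by
    have : ∀ j, exp3Weight d T R a Y (i + 1) j =
        s j + if a i = j then s (a i) * (Real.exp y - 1) else 0 := by
      intro j
      rw [exp3Weight_succ]
      by_cases hj : a i = j
      · subst hj
        rw [if_pos rfl, hy, hp, hs, hq, importanceWeight, if_pos rfl]; ring
      · rw [if_neg hj, importanceWeight, if_neg hj]; simp [hs]
    simp only [this, Finset.sum_add_distrib, Finset.sum_ite_eq, Finset.mem_univ, if_true]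
    rw [hW]
  have hsa : (1 - γ) * s (a i) ≤ p * W := mul_weight_le_exp3Prob s hspos (a i)
  have hγ' : 0 < 1 - γ := by linarith
  have hsa' : s (a i) ≤ W * (p / (1 - γ)) := by
    rw [mul_div_assoc', le_div_iff₀ hγ']; linarith
  have hpy : p * (y + y ^ 2) ≤ γ / K * (q + γ / K * p⁻¹) := by
    have e : p * (y + y ^ 2) = γ / K * (q + γ / K * (p⁻¹ * q ^ 2)) := by
      rw [hy]; field_simp
    rw [e]
    have : q ^ 2 ≤ 1 := by nlinarith
    have h3 : p⁻¹ * q ^ 2 ≤ p⁻¹ := mul_le_of_le_one_right (by positivity) this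
    gcongr
  rw [hnext, hsum]
  calc W + s (a i) * (Real.exp y - 1) ≤ W + W * (p / (1 - γ)) * (y + y ^ 2) := by
        have : 0 ≤ Real.exp y - 1 := by linarith [Real.add_one_le_exp y]
        have h4 : s (a i) * (Real.exp y - 1) ≤ W * (p / (1 - γ)) * (y + y ^ 2) :=
          mul_le_mul hsa' (by linarith) this (by positivity)
        linarith
    _ = W * (1 + p * (y + y ^ 2) / (1 - γ)) := by ring
    _ ≤ W * (1 + γ / K * (q + γ / K * p⁻¹) / (1 - γ)) := by gcongr
    _ ≤ W * Real.exp (γ / K / (1 - γ) * (q + γ / K * p⁻¹)) := by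
        refine mul_le_mul_of_nonneg_left ?_ hW0.le
        refine le_trans (le_of_eq ?_) (Real.add_one_le_exp _)
        ring

theorem sum_exp3Weight_le (hγ : 0 < exploration d T) (hγ1 : exploration d T < 1)
    (a : ℕ → Arm d T) (Y : ℕ → ℝ) (n : ℕ) (h0 : ∀ i < n, 0 ≤ scaledBlockReward d T R Y i)
    (h1 : ∀ i < n, scaledBlockReward d T R Y i ≤ 1) :
    ∑ j, exp3Weight d T R a Y n j ≤ ((gridSize d T : ℝ) + 1) *
      Real.exp (exploration d T / ((gridSize d T : ℝ) + 1) / (1 - exploration d T) *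
        ∑ i ∈ Finset.range n, (scaledBlockReward d T R Y i +
          exploration d T / ((gridSize d T : ℝ) + 1) *
          ∑ j, importanceWeight d T R a Y i j)) := by
  induction n with
  | zero => simp [exp3Weight]
  | succ n ih =>
    refine (sum_exp3Weight_succ_le hγ hγ1 a Y n (h0 n (by omega)) (h1 n (by omega))).trans ?_
    refine le_of_le_of_eq (mul_le_mul_of_nonneg_right (ih (fun i hi => h0 i (by omega))
      fun i hi => h1 i (by omega)) (Real.exp_pos _).le) ?_
    rw [Finset.sum_range_succ, mul_assoc, ← Real.exp_add, ← mul_add]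

/-- The regret inequality of EXP3 on a path where all rescaled rewards lie in `[0, 1]`. -/
theorem exp3_path_le (hγ : 0 < exploration d T) (hγ1 : exploration d T < 1)
    (a : ℕ → Arm d T) (Y : ℕ → ℝ) (n : ℕ) (h0 : ∀ i < n, 0 ≤ scaledBlockReward d T R Y i)
    (h1 : ∀ i < n, scaledBlockReward d T R Y i ≤ 1) (j : Arm d T) :
    (1 - exploration d T) * ∑ i ∈ Finset.range n,
        importanceWeight d T R a Y i j * scaledBlockReward d T R Y i ≤
      ∑ i ∈ Finset.range n, scaledBlockReward d T R Y i +
        exploration d T / ((gridSize d T : ℝ) + 1) *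
          ∑ i ∈ Finset.range n, ∑ u, importanceWeight d T R a Y i u +
        ((gridSize d T : ℝ) + 1) * Real.log ((gridSize d T : ℝ) + 1) / exploration d T := by
  have h2 := sum_exp3Weight_le hγ hγ1 a Y n h0 h1
  have h3 : exp3Weight d T R a Y n j ≤ ∑ u, exp3Weight d T R a Y n u :=
    Finset.single_le_sum (fun u _ => (exp3Weight_pos a Y n u).le) (Finset.mem_univ j)
  rw [exp3Weight_eq] at h3
  replace h3 := h3.trans h2
  rw [Finset.sum_add_distrib, ← Finset.mul_sum] at h3
  set K := (gridSize d T : ℝ) + 1 with hK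
  have hK0 : 0 < K := by positivity
  have hK1 : 1 ≤ K := by rw [hK]; linarith [(Nat.cast_nonneg (gridSize d T) : (0 : ℝ) ≤ _)]
  set γ := exploration d T
  set G := ∑ i ∈ Finset.range n, importanceWeight d T R a Y i j * scaledBlockReward d T R Y i
  set Q := ∑ i ∈ Finset.range n, scaledBlockReward d T R Y i +
    γ / K * ∑ i ∈ Finset.range n, ∑ u, importanceWeight d T R a Y i u with hQ
  rw [← Real.exp_log hK0, ← Real.exp_add, Real.exp_log hK0, Real.exp_le_exp] at h3
  have hγ' : 0 < 1 - γ := by linarith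
  have h4 : (1 - γ) * G ≤ Q + (1 - γ) * (K * Real.log K / γ) := by
    have h5 := mul_le_mul_of_nonneg_left h3 (show 0 ≤ (1 - γ) * (K / γ) by positivity)
    calc (1 - γ) * G = (1 - γ) * (K / γ) * (γ / K * G) := by field_simp
      _ ≤ _ := h5
      _ = _ := by field_simp; ring
  have h6 : (1 - γ) * (K * Real.log K / γ) ≤ K * Real.log K / γ :=
    mul_le_of_le_one_left (div_nonneg (mul_nonneg hK0.le (Real.log_nonneg hK1)) hγ.le)
      (by linarith)
  linarith

end EXP3

/-! ### Sub-Gaussian variables -/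

section SubGaussian

variable {Ω : Type*} {mΩ : MeasurableSpace Ω} {P : Measure Ω}

/-- The bound `1 + u μ ≤ E exp (u X) ≤ exp (c u² / 2)` is linear in `u` on the left and quadratic on
the right near 0, which forces `μ = 0`. -/
theorem integral_eq_zero_of_hasSubgaussianMGF [IsProbabilityMeasure P] {X : Ω → ℝ} {c : ℝ≥0}
    (h : HasSubgaussianMGF X c P) : ∫ ω, X ω ∂P = 0 := by
  have key : ∀ u : ℝ, 1 + u * ∫ ω, X ω ∂P ≤ Real.exp (c * u ^ 2 / 2) := by
    intro u
    refine le_trans ?_ (h.mgf_le u)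
    rw [mgf]
    have h1 : 1 + u * ∫ ω, X ω ∂P = ∫ ω, (1 + u * X ω) ∂P := by
      rw [integral_add (integrable_const _) (h.integrable.const_mul _), integral_const_mul]
      simp
    rw [h1]
    refine integral_mono ((integrable_const _).add (h.integrable.const_mul _))
      (h.integrable_exp_mul u) fun ω => ?_
    change 1 + u * X ω ≤ Real.exp (u * X ω)
    linarith [Real.add_one_le_exp (u * X ω)]
  set μ := ∫ ω, X ω ∂P with hμ
  by_contra hne
  have hμ2 : 0 < μ ^ 2 := by positivity
  have hc : (0 : ℝ) ≤ c := c.2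
  -- The test point is `u = δ μ`. This `δ` makes `c δ < 1` and the exponent at most `1 / 2`, so the
  -- quadratic term loses against `δ μ²`.
  set δ := 1 / (1 + c * (1 + μ ^ 2)) with hδ
  have hden : 0 < 1 + (c : ℝ) * (1 + μ ^ 2) := by positivity
  have hδ0 : 0 < δ := by positivity
  have hδ1 : δ * (1 + c * (1 + μ ^ 2)) = 1 := by rw [hδ]; field_simp
  have hδle : δ ≤ 1 := by
    nlinarith [mul_nonneg hδ0.le (mul_nonneg hc (by positivity : 0 ≤ 1 + μ ^ 2))]
  have hcδ : c * δ * (1 + μ ^ 2) ≤ 1 := by nlinarith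
  have h1 := key (δ * μ)
  set y := (c : ℝ) * (δ * μ) ^ 2 / 2 with hy
  have hy0 : 0 ≤ y := by positivity
  have hcm : c * δ * μ ^ 2 ≤ 1 := by
    have : 0 ≤ c * δ := by positivity
    nlinarith
  have hcd : c * δ < 1 := by
    have : 0 ≤ c * δ * μ ^ 2 := by positivity
    nlinarith
  have hy1 : y ≤ 1 / 2 := by
    have : y = c * δ * μ ^ 2 * δ / 2 := by rw [hy]; ring
    rw [this]
    have : c * δ * μ ^ 2 * δ ≤ 1 * 1 := mul_le_mul hcm hδle hδ0.le zero_le_one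
    linarith
  have h2 := Real.abs_exp_sub_one_sub_id_le (show |y| ≤ 1 by rw [abs_of_nonneg hy0]; linarith)
  have h3 : Real.exp y ≤ 1 + y + y ^ 2 := by linarith [(abs_le.1 h2).2]
  have h4 : δ * μ * μ ≤ 2 * y := by nlinarith
  have h5 : 2 * y = c * δ * (δ * μ ^ 2) := by rw [hy]; ring
  have h6 : 0 < δ * μ ^ 2 := by positivity
  nlinarith

/-- From `y² ≤ 2 (exp y + exp (-y))` at `y = X / √c`, where both exponential moments are at most
`exp (1 / 2) ≤ 2`; this gives the constant 8. -/
theorem integral_sq_le_of_hasSubgaussianMGF [IsProbabilityMeasure P] {X : Ω → ℝ} {c : ℝ≥0}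
    (h : HasSubgaussianMGF X c P) : ∫ ω, X ω ^ 2 ∂P ≤ 8 * c := by
  rcases eq_or_ne c 0 with rfl | hc
  · have h1 := h.ae_eq_zero_of_hasSubgaussianMGF_zero
    have : ∫ ω, X ω ^ 2 ∂P = ∫ _, (0 : ℝ) ∂P := by
      refine integral_congr_ae ?_
      filter_upwards [h1] with ω hω
      rw [hω]; simp
    rw [this]; simp
  have hc0 : (0 : ℝ) < c := by exact_mod_cast pos_iff_ne_zero.2 hc
  set u := 1 / √(c : ℝ) with hu
  have hu2 : u ^ 2 = 1 / c := by rw [hu, div_pow, Real.sq_sqrt hc0.le, one_pow]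
  have hpt : ∀ y : ℝ, y ^ 2 ≤ 2 * (Real.exp y + Real.exp (-y)) := by
    intro y
    rcases le_total 0 y with hy | hy
    · have := Real.quadratic_le_exp_of_nonneg hy
      nlinarith [Real.exp_pos (-y)]
    · have := Real.quadratic_le_exp_of_nonneg (neg_nonneg.2 hy)
      nlinarith [Real.exp_pos y]
  have hpt' : ∀ ω, X ω ^ 2 ≤ 2 * c * (Real.exp (u * X ω) + Real.exp (-u * X ω)) := by
    intro ω
    have h1 := hpt (u * X ω)
    rw [mul_pow, hu2, one_div, ← neg_mul] at h1
    have h2 := mul_le_mul_of_nonneg_left h1 hc0.le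
    rw [mul_inv_cancel_left₀ hc0.ne'] at h2
    linarith
  have hi := (h.integrable_exp_mul u).add (h.integrable_exp_mul (-u))
  have hsq : Integrable (fun ω => X ω ^ 2) P := by
    have := h.memLp 2
    exact_mod_cast this.integrable_sq
  refine (integral_mono hsq (hi.const_mul (2 * c)) hpt').trans ?_
  rw [integral_const_mul]
  simp only [Pi.add_apply]
  rw [integral_add (h.integrable_exp_mul u) (h.integrable_exp_mul (-u))]
  have h1 := h.mgf_le u
  have h2 := h.mgf_le (-u)
  rw [mgf] at h1 h2
  rw [neg_sq] at h2
  have h3 : Real.exp (c * u ^ 2 / 2) ≤ 2 := by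
    rw [hu2]
    have : (c : ℝ) * (1 / c) / 2 = 1 / 2 := by field_simp
    rw [this]
    have h4 := Real.abs_exp_sub_one_sub_id_le (show |(1 / 2 : ℝ)| ≤ 1 by norm_num)
    linarith [(abs_le.1 h4).2]
  nlinarith

end SubGaussian

/-! ### EXP3 along a run -/

section Run

variable {d T : ℕ} {R : ℝ≥0} {L S lam : ℝ} {D : ℕ → Set (Vec d)} {θ : ℕ → Vec d}
  {ν : Measure ℝ} {Ω : Type*} {mΩ : MeasurableSpace Ω} {P : Measure Ω} {𝓕 : Filtration ℕ mΩ}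
  {arm : ℕ → Ω → Arm d T} {X : ℕ → Ω → Vec d} {η : ℕ → Ω → ℝ}

/-- The rewards of a run. -/
abbrev runReward (θ : ℕ → Vec d) (X : ℕ → Ω → Vec d) (η : ℕ → Ω → ℝ) (ω : Ω) : ℕ → ℝ :=
  reward θ (fun s => X s ω) (fun s => η s ω)

/-- The importance weights of a run. -/
abbrev runWeight (R : ℝ≥0) (θ : ℕ → Vec d) (arm : ℕ → Ω → Arm d T) (X : ℕ → Ω → Vec d)
    (η : ℕ → Ω → ℝ) (i : ℕ) (j : Arm d T) (ω : Ω) : ℝ :=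
  importanceWeight d T R (fun k => arm k ω) (runReward θ X η ω) i j

theorem measurable_inner_param {m : MeasurableSpace Ω} {x : Ω → Vec d} (hx : Measurable x)
    (v : Vec d) : Measurable fun ω => (inner ℝ (x ω) v : ℝ) := by
  have : Continuous fun y : Vec d => (inner ℝ y v : ℝ) := by fun_prop
  exact this.measurable.comp hx

theorem IsRun.measurable_scaledBlockReward (h : IsRun d T R L S lam D θ ν P 𝓕 arm X η) (i : ℕ) :
    Measurable[𝓕 (2 * ((i + 1) * blockLength d T))] fun ω =>
      scaledBlockReward d T R (runReward θ X η ω) i := by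
  unfold scaledBlockReward blockReward
  refine measurable_const.add (Measurable.div_const ?_ _)
  refine Finset.measurable_sum _ fun t ht => ?_
  have ht' : t ∈ blockRounds d T i := ht
  have htT := lt_of_mem_blockRounds ht'
  have hle := lt_of_lt_of_le (Finset.mem_Ico.1 ht).2 (min_le_left _ _)
  refine Measurable.add ?_ (h.measurable_noise_of_le htT (by omega))
  exact @measurable_inner_param d Ω (𝓕 (2 * ((i + 1) * blockLength d T))) _
    (h.measurable_action_of_le htT (by omega)) (θ t)

theorem measurable_exp3Prob {m : MeasurableSpace Ω} {s : Ω → Arm d T → ℝ}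
    (hs : ∀ j, Measurable fun ω => s ω j) (j : Arm d T) :
    Measurable fun ω => exp3Prob d T (s ω) j := by
  unfold exp3Prob
  exact (((hs j).div (Finset.measurable_sum _ fun u _ => hs u)).const_mul _).add_const _

theorem measurable_importanceWeight {m : MeasurableSpace Ω} {i : ℕ}
    (hw : ∀ j, Measurable fun ω => exp3Weight d T R (fun k => arm k ω) (runReward θ X η ω) i j)
    (ha : Measurable (arm i)) (j : Arm d T) :
    Measurable (runWeight R θ arm X η i j) := by
  unfold runWeight importanceWeight
  refine Measurable.ite (ha (measurableSet_singleton j)) ?_ measurable_const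
  exact (measurable_exp3Prob hw j).inv

theorem IsRun.measurable_exp3Weight (h : IsRun d T R L S lam D θ ν P 𝓕 arm X η)
    (hH : 1 ≤ blockLength d T) {i : ℕ} (hi : i ≤ numBlocks d T) (j : Arm d T) :
    Measurable[𝓕 (2 * (i * blockLength d T))] fun ω =>
      exp3Weight d T R (fun k => arm k ω) (runReward θ X η ω) i j := by
  induction i generalizing j with
  | zero => exact measurable_const
  | succ i ih =>
    have hle : 2 * (i * blockLength d T) + 1 ≤ 2 * ((i + 1) * blockLength d T) := by
      rw [add_mul, one_mul]; omega
    simp only [exp3Weight_succ]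
    have hw : ∀ j, Measurable[𝓕 (2 * ((i + 1) * blockLength d T))] fun ω =>
        exp3Weight d T R (fun k => arm k ω) (runReward θ X η ω) i j := fun j =>
      (ih (by omega) j).mono (𝓕.mono (by omega)) le_rfl
    have ha : Measurable[𝓕 (2 * ((i + 1) * blockLength d T))] (arm i) :=
      (h.measurable_arm i (by omega)).mono (𝓕.mono hle) le_rfl
    refine (hw j).mul (Measurable.exp ?_)
    exact ((@measurable_importanceWeight d T R θ Ω arm X η _ i hw ha j).mul
      (h.measurable_scaledBlockReward i)).const_mul _

theorem IsRun.measurable_runWeight (h : IsRun d T R L S lam D θ ν P 𝓕 arm X η)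
    (hH : 1 ≤ blockLength d T) {i : ℕ} (hi : i < numBlocks d T) (j : Arm d T) :
    Measurable[𝓕 (2 * (i * blockLength d T) + 1)] (runWeight R θ arm X η i j) :=
  @measurable_importanceWeight d T R θ Ω arm X η _ i
    (fun j => (h.measurable_exp3Weight hH hi.le j).mono (𝓕.mono (by omega)) le_rfl)
    (h.measurable_arm i hi) j

theorem IsRun.integrable_runWeight [IsProbabilityMeasure P]
    (h : IsRun d T R L S lam D θ ν P 𝓕 arm X η) (hγ : 0 < exploration d T)
    (hH : 1 ≤ blockLength d T) {i : ℕ} (hi : i < numBlocks d T) (j : Arm d T) :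
    Integrable (runWeight R θ arm X η i j) P := by
  refine Integrable.of_bound (((h.measurable_runWeight hH hi j).mono (𝓕.le _)
    le_rfl).aestronglyMeasurable) (((gridSize d T : ℝ) + 1) / exploration d T) ?_
  refine Filter.Eventually.of_forall fun ω => ?_
  rw [Real.norm_of_nonneg (importanceWeight_nonneg _ _ _ _)]
  exact importanceWeight_le hγ _ _ _ _

/-- Importance weights have mean one. -/
theorem IsRun.integral_runWeight [IsProbabilityMeasure P]
    (h : IsRun d T R L S lam D θ ν P 𝓕 arm X η) (hγ : 0 < exploration d T)
    (hH : 1 ≤ blockLength d T) {i : ℕ} (hi : i < numBlocks d T) (j : Arm d T) :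
    ∫ ω, runWeight R θ arm X η i j ω ∂P = 1 := by
  set f : Ω → ℝ := (arm i ⁻¹' {j}).indicator fun _ => (1 : ℝ) with hf
  set p : Ω → ℝ := fun ω => exp3Prob d T
    (exp3Weight d T R (fun k => arm k ω) (runReward θ X η ω) i) j with hp
  have hp_meas : Measurable[𝓕 (2 * (i * blockLength d T))] p := @measurable_exp3Prob d T Ω _ _
    (fun u => h.measurable_exp3Weight hH hi.le u) j
  have hp0 : ∀ ω, 0 < p ω := fun ω => lt_of_lt_of_le (by positivity)
    (le_exp3Prob _ (fun u => exp3Weight_pos _ _ _ u) j)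
  have heq : runWeight R θ arm X η i j = f * p⁻¹ := by
    ext ω
    rw [Pi.mul_apply, Pi.inv_apply]
    by_cases hj : arm i ω = j
    · rw [hf, Set.indicator_of_mem (show ω ∈ arm i ⁻¹' {j} from hj), one_mul]
      exact if_pos hj
    · rw [hf, Set.indicator_of_notMem (show ω ∉ arm i ⁻¹' {j} from hj), zero_mul]
      exact if_neg hj
  have hint := h.integrable_runWeight hγ hH hi j
  have harm : Measurable (arm i) := (h.measurable_arm i hi).mono (𝓕.le _) le_rfl
  have hfint : Integrable f P :=
    (integrable_const (1 : ℝ)).indicator (harm (measurableSet_singleton j))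
  rw [heq] at hint ⊢
  -- The probability is determined by the past, so it can be pulled out, and it cancels against the
  -- conditional law of the arm.
  have hcond := condExp_mul_of_stronglyMeasurable_right (μ := P)
    (hp_meas.inv).stronglyMeasurable hint hfint
  have hlaw : P[f | 𝓕 (2 * (i * blockLength d T))] =ᵐ[P] p := h.law_arm i hi j
  rw [← integral_condExp (𝓕.le (2 * (i * blockLength d T)))]
  have h1 : ∫ ω, (P[f * p⁻¹ | 𝓕 (2 * (i * blockLength d T))]) ω ∂P = ∫ _, (1 : ℝ) ∂P := by
    refine integral_congr_ae ?_
    filter_upwards [hcond, hlaw] with ω h2 h3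
    rw [h2, Pi.mul_apply, h3, Pi.inv_apply, mul_inv_cancel₀ (hp0 ω).ne']
  rw [h1]; simp

end Run

/-! ### Block noise -/

/-- The total noise of block `i`. -/
def blockNoise (d T : ℕ) (η : ℕ → ℝ) (i : ℕ) : ℝ := ∑ t ∈ blockRounds d T i, η t

/-- The level that the block noise exceeds with small probability. -/
def blockNoiseLevel (d T : ℕ) (R : ℝ≥0) : ℝ :=
  2 * (R : ℝ) * √((blockLength d T : ℝ) * Real.log ((T : ℝ) / √(blockLength d T : ℝ)))

/-- The scale by which block rewards are divided. -/
def rewardScale (d T : ℕ) (R : ℝ≥0) : ℝ :=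
  2 * (blockLength d T : ℝ) + 4 * (R : ℝ) * √((blockLength d T : ℝ) *
    Real.log ((T : ℝ) / √(blockLength d T : ℝ)))

theorem blockNoiseLevel_nonneg (d T : ℕ) (R : ℝ≥0) : 0 ≤ blockNoiseLevel d T R := by
  unfold blockNoiseLevel; positivity

theorem rewardScale_eq (d T : ℕ) (R : ℝ≥0) :
    rewardScale d T R = 2 * (blockLength d T : ℝ) + 2 * blockNoiseLevel d T R := by
  unfold rewardScale blockNoiseLevel; ring

section Run

variable {d T : ℕ} {R : ℝ≥0} {L S lam : ℝ} {D : ℕ → Set (Vec d)} {θ : ℕ → Vec d}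
  {ν : Measure ℝ} {Ω : Type*} {mΩ : MeasurableSpace Ω} {P : Measure Ω} {𝓕 : Filtration ℕ mΩ}
  {arm : ℕ → Ω → Arm d T} {X : ℕ → Ω → Vec d} {η : ℕ → Ω → ℝ}

theorem IsRun.hasSubgaussianMGF_noise (h : IsRun d T R L S lam D θ ν P 𝓕 arm X η)
    (hν : HasSubgaussianMGF id (R ^ 2) ν) {t : ℕ} (ht : t < T) :
    HasSubgaussianMGF (η t) (R ^ 2) P := by
  rw [← HasSubgaussianMGF.id_map_iff (h.measurable_noise' ht).aemeasurable, h.law_noise t ht]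
  exact hν

theorem IsRun.indepFun_noise (h : IsRun d T R L S lam D θ ν P 𝓕 arm X η) {t : ℕ} (ht : t < T)
    {Z : Ω → ℝ} (hZ : Measurable[𝓕 (2 * t + 1)] Z) : IndepFun Z (η t) P :=
  (indep_of_indep_of_le_right (h.indep_noise t ht) (measurable_iff_comap_le.1 hZ)).symm

theorem IsRun.hasSubgaussianMGF_sum_noise [IsProbabilityMeasure P]
    (h : IsRun d T R L S lam D θ ν P 𝓕 arm X η) (hν : HasSubgaussianMGF id (R ^ 2) ν) {a b : ℕ}
    (hab : a ≤ b) (hb : b ≤ T) :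
    HasSubgaussianMGF (fun ω => ∑ t ∈ Finset.Ico a b, η t ω) ((b - a : ℕ) * R ^ 2) P := by
  induction b, hab using Nat.le_induction with
  | base => simp
  | succ b hab ih =>
    have h1 := ih (by omega)
    have h2 := h.hasSubgaussianMGF_noise hν (show b < T by omega)
    have hm : Measurable[𝓕 (2 * b + 1)] fun ω => ∑ t ∈ Finset.Ico a b, η t ω :=
      Finset.measurable_sum _ fun t ht => by
        have := Finset.mem_Ico.1 ht
        exact h.measurable_noise_of_le (by omega) (by omega)
    have h3 := h1.add_of_indepFun h2 (h.indepFun_noise (show b < T by omega) hm)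
    have hc : ((b + 1 - a : ℕ) : ℝ≥0) * R ^ 2 = (b - a : ℕ) * R ^ 2 + R ^ 2 := by
      rw [show b + 1 - a = (b - a) + 1 by omega]; push_cast; ring
    rw [hc]
    simp only [Finset.sum_Ico_succ_top hab]
    exact h3

/-- The variance proxy is left existential because the last block may be shorter than the others. -/
theorem IsRun.exists_hasSubgaussianMGF_blockNoise [IsProbabilityMeasure P]
    (h : IsRun d T R L S lam D θ ν P 𝓕 arm X η) (hν : HasSubgaussianMGF id (R ^ 2) ν) (i : ℕ) :
    ∃ c : ℝ≥0, (c : ℝ) ≤ blockLength d T * (R : ℝ) ^ 2 ∧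
      HasSubgaussianMGF (fun ω => blockNoise d T (fun s => η s ω) i) c P := by
  refine ⟨((blockRounds d T i).card : ℝ≥0) * R ^ 2, ?_, ?_⟩
  · push_cast
    have : ((blockRounds d T i).card : ℝ) ≤ blockLength d T := by
      exact_mod_cast card_blockRounds_le d T i
    gcongr
  · rcases le_or_gt (i * blockLength d T) (min ((i + 1) * blockLength d T) T) with hle | hlt
    · have := h.hasSubgaussianMGF_sum_noise hν hle (min_le_right _ _)
      rw [blockRounds, Nat.card_Ico]
      exact this
    · have he : blockRounds d T i = ∅ := Finset.Ico_eq_empty_of_le hlt.le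
      simp [blockNoise, he]

theorem IsRun.integral_sq_blockNoise_le [IsProbabilityMeasure P]
    (h : IsRun d T R L S lam D θ ν P 𝓕 arm X η) (hν : HasSubgaussianMGF id (R ^ 2) ν) (i : ℕ) :
    ∫ ω, blockNoise d T (fun s => η s ω) i ^ 2 ∂P ≤ 8 * (blockLength d T * (R : ℝ) ^ 2) := by
  obtain ⟨c, hc, hs⟩ := h.exists_hasSubgaussianMGF_blockNoise hν i
  have := integral_sq_le_of_hasSubgaussianMGF hs
  linarith

/-- The level is such that the Chernoff exponent is at least `2 log (T / √H)`; each tail is then at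
most `H / T²`. -/
theorem IsRun.measureReal_blockNoise_gt_le [IsProbabilityMeasure P]
    (h : IsRun d T R L S lam D θ ν P 𝓕 arm X η) (hν : HasSubgaussianMGF id (R ^ 2) ν)
    (hH : 1 ≤ blockLength d T) (hHT : blockLength d T ≤ T) (i : ℕ) :
    P.real {ω | blockNoiseLevel d T R < |blockNoise d T (fun s => η s ω) i|} ≤
      2 * (blockLength d T / (T : ℝ) ^ 2) := by
  obtain ⟨c, hc, hs⟩ := h.exists_hasSubgaussianMGF_blockNoise hν i
  have hε := blockNoiseLevel_nonneg d T R
  set ε := blockNoiseLevel d T R with hεdef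
  have hH' : (1 : ℝ) ≤ blockLength d T := by exact_mod_cast hH
  have hHT' : (blockLength d T : ℝ) ≤ T := by exact_mod_cast hHT
  have hT0 : (0 : ℝ) < T := by linarith
  rcases eq_or_ne c 0 with rfl | hc0
  · have h0 := hs.ae_eq_zero_of_hasSubgaussianMGF_zero
    have : P {ω | ε < |blockNoise d T (fun s => η s ω) i|} = 0 := by
      refine measure_mono_null (t := {ω | ¬ blockNoise d T (fun s => η s ω) i = 0}) ?_ h0
      intro ω hω h1
      change ε < |blockNoise d T (fun s => η s ω) i| at hω
      rw [h1, abs_zero] at hω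
      exact absurd hω (not_lt.2 hε)
    rw [measureReal_def, this, ENNReal.toReal_zero]
    positivity
  · have hc0' : (0 : ℝ) < c := by exact_mod_cast pos_iff_ne_zero.2 hc0
    have hsub : {ω | ε < |blockNoise d T (fun s => η s ω) i|} ⊆
        {ω | ε ≤ blockNoise d T (fun s => η s ω) i} ∪
          {ω | ε ≤ (-fun ω => blockNoise d T (fun s => η s ω) i) ω} := by
      intro ω hω
      rcases lt_abs.1 (show ε < |blockNoise d T (fun s => η s ω) i| from hω) with h1 | h1
      · exact Or.inl h1.le
      · exact Or.inr h1.le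
    refine (measureReal_mono hsub).trans ((measureReal_union_le _ _).trans ?_)
    have h1 := hs.measure_ge_le hε
    have h2 := hs.neg.measure_ge_le hε
    set ℓ := Real.log ((T : ℝ) / √(blockLength d T : ℝ)) with hℓ
    have hsq : √(blockLength d T : ℝ) ≤ T := by
      refine Real.sqrt_le_iff.2 ⟨hT0.le, ?_⟩
      nlinarith
    have hsq0 : 0 < √(blockLength d T : ℝ) := Real.sqrt_pos.2 (by linarith)
    have hℓ0 : 0 ≤ ℓ := Real.log_nonneg (by rwa [le_div_iff₀ hsq0, one_mul])
    have hε2 : ε ^ 2 = 4 * (R : ℝ) ^ 2 * (blockLength d T * ℓ) := by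
      rw [hεdef, blockNoiseLevel, mul_pow, Real.sq_sqrt (by positivity)]; ring
    have h3 : Real.exp (-ε ^ 2 / (2 * c)) ≤ blockLength d T / (T : ℝ) ^ 2 := by
      have h4 : -ε ^ 2 / (2 * c) ≤ -(2 * ℓ) := by
        rw [div_le_iff₀ (by positivity), hε2]
        have := mul_le_mul_of_nonneg_left hc hℓ0
        nlinarith
      refine (Real.exp_le_exp.2 h4).trans (le_of_eq ?_)
      rw [Real.exp_neg, mul_comm, Real.exp_mul, hℓ, Real.exp_log (by positivity),
        Real.rpow_two, div_pow, Real.sq_sqrt (by linarith), inv_div]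
    linarith

/-- The event that the noise of some block is large. -/
def largeNoise (d T : ℕ) (R : ℝ≥0) (η : ℕ → Ω → ℝ) : Set Ω :=
  ⋃ i ∈ Finset.range (numBlocks d T),
    {ω | blockNoiseLevel d T R < |blockNoise d T (fun s => η s ω) i|}

theorem IsRun.measurable_blockNoise (h : IsRun d T R L S lam D θ ν P 𝓕 arm X η) (i : ℕ) :
    Measurable fun ω => blockNoise d T (fun s => η s ω) i :=
  Finset.measurable_sum _ fun _ ht => h.measurable_noise' (lt_of_mem_blockRounds ht)

theorem IsRun.measurableSet_largeNoise (h : IsRun d T R L S lam D θ ν P 𝓕 arm X η) :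
    MeasurableSet (largeNoise d T R η) :=
  Finset.measurableSet_biUnion _ fun i _ =>
    measurableSet_lt measurable_const (h.measurable_blockNoise i).abs

theorem IsRun.measureReal_largeNoise_le [IsProbabilityMeasure P]
    (h : IsRun d T R L S lam D θ ν P 𝓕 arm X η) (hν : HasSubgaussianMGF id (R ^ 2) ν)
    (hH : 1 ≤ blockLength d T) (hHT : blockLength d T ≤ T) :
    P.real (largeNoise d T R η) ≤
      numBlocks d T * (2 * (blockLength d T / (T : ℝ) ^ 2)) := by
  refine (measureReal_biUnion_finset_le _ _).trans ?_
  refine (Finset.sum_le_sum fun i _ => h.measureReal_blockNoise_gt_le hν hH hHT i).trans ?_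
  simp

/-- The noise of a block has mean zero given its arm. -/
theorem IsRun.integral_mul_blockNoise [IsProbabilityMeasure P]
    (h : IsRun d T R L S lam D θ ν P 𝓕 arm X η) (hν : HasSubgaussianMGF id (R ^ 2) ν) {i : ℕ}
    {Z : Ω → ℝ} (hZ : Measurable[𝓕 (2 * (i * blockLength d T) + 1)] Z) {c : ℝ}
    (hc : ∀ ω, |Z ω| ≤ c) :
    Integrable (fun ω => Z ω * blockNoise d T (fun s => η s ω) i) P ∧
      ∫ ω, Z ω * blockNoise d T (fun s => η s ω) i ∂P = 0 := by
  have hZ' : Measurable Z := hZ.mono (𝓕.le _) le_rfl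
  have hint : ∀ t ∈ blockRounds d T i, Integrable (fun ω => Z ω * η t ω) P := fun t ht =>
    ((h.hasSubgaussianMGF_noise hν (lt_of_mem_blockRounds ht)).integrable).bdd_mul
      hZ'.aestronglyMeasurable (Filter.Eventually.of_forall fun ω => by
        rw [Real.norm_eq_abs]; exact hc ω)
  simp only [blockNoise, Finset.mul_sum]
  refine ⟨integrable_finsetSum _ hint, ?_⟩
  rw [integral_finsetSum _ hint]
  refine Finset.sum_eq_zero fun t ht => ?_
  have htT := lt_of_mem_blockRounds ht
  have hle := (Finset.mem_Ico.1 ht).1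
  have hind := h.indepFun_noise htT (hZ.mono (𝓕.mono (by omega)) le_rfl)
  rw [hind.integral_fun_mul_eq_mul_integral hZ'.aestronglyMeasurable
    (h.measurable_noise' htT).aestronglyMeasurable,
    integral_eq_zero_of_hasSubgaussianMGF (h.hasSubgaussianMGF_noise hν htT), mul_zero]

end Run

/-! ### Comparison of the algorithm with a fixed window length -/

section Path

variable {d T : ℕ} {R : ℝ≥0} {L S : ℝ} {D : ℕ → Set (Vec d)} {θ : ℕ → Vec d}

/-- The regret of block `i`. -/
def blockGap (T : ℕ) (D : ℕ → Set (Vec d)) (θ X : ℕ → Vec d) (i : ℕ) : ℝ :=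
  ∑ t ∈ blockRounds d T i, gap D θ X t

/-- The rescaled block reward of an omniscient learner, in the original units. -/
def blockOptimum (T : ℕ) (R : ℝ≥0) (D : ℕ → Set (Vec d)) (θ : ℕ → Vec d) (i : ℕ) : ℝ :=
  rewardScale d T R / 2 + ∑ t ∈ blockRounds d T i, optimalReward D θ t

theorem abs_sum_blockRounds_le {f : ℕ → ℝ} {c : ℝ} (hc : 0 ≤ c) (i : ℕ)
    (hf : ∀ t < T, |f t| ≤ c) : |∑ t ∈ blockRounds d T i, f t| ≤ c * blockLength d T := by
  refine (Finset.abs_sum_le_sum_abs _ _).trans ?_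
  refine (Finset.sum_le_sum fun t ht => hf t (lt_of_mem_blockRounds ht)).trans ?_
  rw [Finset.sum_const, nsmul_eq_mul, mul_comm]
  have : ((blockRounds d T i).card : ℝ) ≤ blockLength d T := by
    exact_mod_cast card_blockRounds_le d T i
  gcongr

theorem two_mul_blockLength_le_rewardScale (d T : ℕ) (R : ℝ≥0) :
    2 * (blockLength d T : ℝ) ≤ rewardScale d T R := by
  rw [rewardScale_eq]; linarith [blockNoiseLevel_nonneg d T R]

theorem rewardScale_pos (R : ℝ≥0) (hH : 1 ≤ blockLength d T) : 0 < rewardScale d T R := by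
  have := two_mul_blockLength_le_rewardScale d T R
  have h1 : (1 : ℝ) ≤ blockLength d T := by exact_mod_cast hH
  linarith

/-- Translates EXP3 rewards into regret. The optimum is deterministic and common to all arms, so it
drops out against importance weights of mean one. -/
theorem scaledBlockReward_mul (hH : 1 ≤ blockLength d T) (X : ℕ → Vec d) (η : ℕ → ℝ) (i : ℕ) :
    rewardScale d T R * scaledBlockReward d T R (reward θ X η) i =
      blockOptimum T R D θ i - blockGap T D θ X i + blockNoise d T η i := by
  have h0 := (rewardScale_pos R hH).ne'
  have h1 : blockReward d T (reward θ X η) i = ∑ t ∈ blockRounds d T i, optimalReward D θ t -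
      blockGap T D θ X i + blockNoise d T η i := by
    unfold blockReward blockGap blockNoise
    rw [← Finset.sum_sub_distrib, ← Finset.sum_add_distrib]
    refine Finset.sum_congr rfl fun t _ => ?_
    unfold reward gap; ring
  unfold scaledBlockReward blockOptimum
  rw [h1, ← rewardScale]
  field_simp
  ring

theorem IsNormalized.blockOptimum_mem (h : IsNormalized T L S D θ) {X : ℕ → Vec d}
    (hX : ∀ t < T, X t ∈ D t) (i : ℕ) :
    0 ≤ blockOptimum T R D θ i ∧ blockOptimum T R D θ i ≤ rewardScale d T R := by
  have h1 := abs_le.1 (abs_sum_blockRounds_le (d := d) zero_le_one i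
    fun t ht => h.abs_optimalReward_le ht (hX t ht))
  have h2 := two_mul_blockLength_le_rewardScale d T R
  unfold blockOptimum
  constructor <;> linarith [h1.1, h1.2]

theorem IsNormalized.blockGap_nonneg (h : IsNormalized T L S D θ) {X : ℕ → Vec d}
    (hX : ∀ t < T, X t ∈ D t) (i : ℕ) : 0 ≤ blockGap T D θ X i :=
  Finset.sum_nonneg fun t ht =>
    h.gap_nonneg (lt_of_mem_blockRounds ht) (hX t (lt_of_mem_blockRounds ht))

theorem IsNormalized.blockGap_le (h : IsNormalized T L S D θ) {X : ℕ → Vec d}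
    (hX : ∀ t < T, X t ∈ D t) (i : ℕ) : blockGap T D θ X i ≤ 2 * blockLength d T := by
  refine (le_abs_self _).trans (abs_sum_blockRounds_le zero_le_two i fun t ht => ?_)
  rw [abs_of_nonneg (h.gap_nonneg ht (hX t ht))]
  exact h.gap_le_two ht (hX t ht)

/-- Mean rewards of a block sum to at most `H` in absolute value, and `rewardScale` is twice `H`
plus the noise level. -/
theorem scaledBlockReward_mem (h : IsNormalized T L S D θ) {X : ℕ → Vec d}
    (hX : ∀ t < T, X t ∈ D t) (hH : 1 ≤ blockLength d T) (η : ℕ → ℝ) (i : ℕ)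
    (hη : |blockNoise d T η i| ≤ blockNoiseLevel d T R) :
    0 ≤ scaledBlockReward d T R (reward θ X η) i ∧
      scaledBlockReward d T R (reward θ X η) i ≤ 1 := by
  have h0 := rewardScale_pos (d := d) (T := T) R hH
  have h1 : |∑ t ∈ blockRounds d T i, (inner ℝ (X t) (θ t) : ℝ)| ≤ 1 * blockLength d T :=
    abs_sum_blockRounds_le zero_le_one i fun t ht => h.abs_reward_le t ht _ (hX t ht)
  have h2 : blockReward d T (reward θ X η) i =
      ∑ t ∈ blockRounds d T i, (inner ℝ (X t) (θ t) : ℝ) + blockNoise d T η i := by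
    unfold blockReward blockNoise
    rw [← Finset.sum_add_distrib]
    rfl
  have h3 : |blockReward d T (reward θ X η) i / rewardScale d T R| ≤ 1 / 2 := by
    rw [abs_div, abs_of_pos h0, div_le_iff₀ h0, h2, rewardScale_eq]
    refine (abs_add_le _ _).trans ?_
    linarith
  have h4 := abs_le.1 h3
  unfold scaledBlockReward
  rw [← rewardScale]
  constructor <;> linarith [h4.1, h4.2]

open Classical in
/-- The regret inequality of EXP3 on every path, with a penalty when the noise is large. -/
theorem sum_blockGap_le (h : IsNormalized T L S D θ) {X : ℕ → Vec d} (hX : ∀ t < T, X t ∈ D t)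
    (hH : 1 ≤ blockLength d T) (hγ : 0 < exploration d T) (hγ1 : exploration d T < 1)
    (a : ℕ → Arm d T) (η : ℕ → ℝ) (n : ℕ) (j : Arm d T) :
    ∑ i ∈ Finset.range n, blockGap T D θ X i ≤
      ∑ i ∈ Finset.range n,
        importanceWeight d T R a (reward θ X η) i j * blockGap T D θ X i +
      ∑ i ∈ Finset.range n, (1 - importanceWeight d T R a (reward θ X η) i j) *
        (blockOptimum T R D θ i + blockNoise d T η i) +
      rewardScale d T R * (exploration d T *
          ∑ i ∈ Finset.range n, importanceWeight d T R a (reward θ X η) i j +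
        exploration d T / ((gridSize d T : ℝ) + 1) *
          ∑ i ∈ Finset.range n, ∑ u, importanceWeight d T R a (reward θ X η) i u +
        ((gridSize d T : ℝ) + 1) * Real.log ((gridSize d T : ℝ) + 1) / exploration d T) +
      3 * rewardScale d T R * n * (((gridSize d T : ℝ) + 1) / exploration d T) *
        (if ∀ i < n, |blockNoise d T η i| ≤ blockNoiseLevel d T R then 0 else 1) +
      ((gridSize d T : ℝ) + 1) / exploration d T / blockLength d T *
        ∑ i ∈ Finset.range n, blockNoise d T η i ^ 2 := by
  set Z := importanceWeight d T R a (reward θ X η) with hZ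
  set K := (gridSize d T : ℝ) + 1 with hK
  have hK1 : 1 ≤ K := by rw [hK]; linarith [(Nat.cast_nonneg (gridSize d T) : (0 : ℝ) ≤ _)]
  set γ := exploration d T with hγdef
  set M := rewardScale d T R with hM
  have hM0 : 0 < M := rewardScale_pos R hH
  have hH' : (1 : ℝ) ≤ blockLength d T := by exact_mod_cast hH
  have hMH : 2 * (blockLength d T : ℝ) ≤ M := two_mul_blockLength_le_rewardScale d T R
  have hKγ : 1 ≤ K / γ := by rw [le_div_iff₀ hγ]; linarith
  have hZ0 : ∀ i u, 0 ≤ Z i u := fun i u => importanceWeight_nonneg _ _ _ _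
  have hZK : ∀ i u, Z i u ≤ K / γ := fun i u => importanceWeight_le hγ _ _ _ _
  have hlog : 0 ≤ K * Real.log K / γ :=
    div_nonneg (mul_nonneg (by linarith) (Real.log_nonneg hK1)) hγ.le
  have hsumZ : 0 ≤ ∑ i ∈ Finset.range n, Z i j := Finset.sum_nonneg fun i _ => hZ0 i j
  have hsumZ2 : 0 ≤ ∑ i ∈ Finset.range n, ∑ u, Z i u :=
    Finset.sum_nonneg fun i _ => Finset.sum_nonneg fun u _ => hZ0 i u
  have hN2 : 0 ≤ K / γ / blockLength d T * ∑ i ∈ Finset.range n, blockNoise d T η i ^ 2 :=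
    mul_nonneg (by positivity) (Finset.sum_nonneg fun i _ => sq_nonneg _)
  split_ifs with hG
  -- Moderate noise: the EXP3 inequality applies, its factor `1 - γ` costs at most `γ ∑ Z` since the
  -- rewards are at most 1, and multiplication by `M` returns to regret.
  · have hq : ∀ i < n, 0 ≤ scaledBlockReward d T R (reward θ X η) i ∧
        scaledBlockReward d T R (reward θ X η) i ≤ 1 := fun i hi =>
      scaledBlockReward_mem h hX hH η i (hG i hi)
    have hpath := exp3_path_le hγ hγ1 a (reward θ X η) n (fun i hi => (hq i hi).1)
      (fun i hi => (hq i hi).2) j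
    rw [← hZ, ← hK, ← hγdef] at hpath
    set q := scaledBlockReward d T R (reward θ X η) with hqdef
    have h1 : ∑ i ∈ Finset.range n, Z i j * q i ≤ ∑ i ∈ Finset.range n, Z i j :=
      Finset.sum_le_sum fun i hi =>
        mul_le_of_le_one_right (hZ0 i j) (hq i (Finset.mem_range.1 hi)).2
    have h2 : ∑ i ∈ Finset.range n, Z i j * q i - ∑ i ∈ Finset.range n, q i ≤
        γ * ∑ i ∈ Finset.range n, Z i j + γ / K * ∑ i ∈ Finset.range n, ∑ u, Z i u +
          K * Real.log K / γ := by nlinarith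
    have h3 := mul_le_mul_of_nonneg_left h2 hM0.le
    have h4 : M * (∑ i ∈ Finset.range n, Z i j * q i - ∑ i ∈ Finset.range n, q i) =
        ∑ i ∈ Finset.range n, blockGap T D θ X i -
          ∑ i ∈ Finset.range n, Z i j * blockGap T D θ X i -
          ∑ i ∈ Finset.range n, (1 - Z i j) *
            (blockOptimum T R D θ i + blockNoise d T η i) := by
      rw [← Finset.sum_sub_distrib, Finset.mul_sum, ← Finset.sum_sub_distrib,
        ← Finset.sum_sub_distrib]
      refine Finset.sum_congr rfl fun i _ => ?_
      have h5 := scaledBlockReward_mul (R := R) (D := D) (θ := θ) hH X η i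
      rw [← hM, ← hqdef] at h5
      have : M * (Z i j * q i - q i) = (Z i j - 1) * (M * q i) := by ring
      rw [this, h5]; ring
    rw [h4] at h3
    linarith
  -- Large noise: EXP3 gives nothing. The penalty `3 M n K / γ` covers the regret itself (one part)
  -- and the possibly negative term `(1 - Z)(optimum + noise)` (two parts, with the squared noise).
  · have h1 : ∑ i ∈ Finset.range n, blockGap T D θ X i ≤ n * M := by
      refine (Finset.sum_le_sum fun i _ => (h.blockGap_le hX i).trans hMH).trans ?_
      simp
    have h2 : 0 ≤ ∑ i ∈ Finset.range n, Z i j * blockGap T D θ X i :=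
      Finset.sum_nonneg fun i _ => mul_nonneg (hZ0 i j) (h.blockGap_nonneg hX i)
    have h3 : -(2 * M * n * (K / γ) + K / γ / blockLength d T *
        ∑ i ∈ Finset.range n, blockNoise d T η i ^ 2) ≤ ∑ i ∈ Finset.range n, (1 - Z i j) *
            (blockOptimum T R D θ i + blockNoise d T η i) := by
      have h4 : ∀ i ∈ Finset.range n, -(2 * M * (K / γ) + K / γ / blockLength d T *
          blockNoise d T η i ^ 2) ≤
          (1 - Z i j) * (blockOptimum T R D θ i + blockNoise d T η i) := by
        intro i _
        have hO := h.blockOptimum_mem (R := R) hX i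
        rw [← hM] at hO
        set N := blockNoise d T η i
        have h5 : |1 - Z i j| ≤ K / γ := abs_le.2 ⟨by linarith [hZK i j], by linarith [hZ0 i j]⟩
        -- An unbounded `|N|` is traded for its square, whose mean is of order `R² H`.
        have h6 : |N| ≤ blockLength d T + N ^ 2 / blockLength d T := by
          have h7 : |N| * blockLength d T ≤ blockLength d T ^ 2 + |N| ^ 2 := by
            nlinarith [sq_nonneg (|N| - blockLength d T), abs_nonneg N]
          rw [sq_abs] at h7
          have hne : (blockLength d T : ℝ) ≠ 0 := by positivity
          have : (blockLength d T : ℝ) + N ^ 2 / blockLength d T =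
              (blockLength d T ^ 2 + N ^ 2) / blockLength d T := by field_simp
          rw [this, le_div_iff₀ (by positivity)]
          exact h7
        have h8 : |blockOptimum T R D θ i + N| ≤ 2 * M + N ^ 2 / blockLength d T := by
          refine (abs_add_le _ _).trans ?_
          rw [abs_of_nonneg hO.1]
          linarith [hO.2]
        have h9 : |(1 - Z i j) * (blockOptimum T R D θ i + N)| ≤
            K / γ * (2 * M + N ^ 2 / blockLength d T) := by
          rw [abs_mul]
          exact mul_le_mul h5 h8 (abs_nonneg _) (by positivity)
        have h10 := (abs_le.1 h9).1
        have e : K / γ * (2 * M + N ^ 2 / blockLength d T) =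
            2 * M * (K / γ) + K / γ / blockLength d T * N ^ 2 := by ring
        rw [e] at h10
        exact h10
      refine le_trans (le_of_eq ?_) (Finset.sum_le_sum h4)
      rw [Finset.sum_neg_distrib, Finset.sum_add_distrib, Finset.sum_const,
        Finset.card_range, nsmul_eq_mul, ← Finset.mul_sum]
      ring
    have h5 : (n : ℝ) * M ≤ M * n * (K / γ) := by
      have : 0 ≤ M * n := by positivity
      nlinarith
    have h6 : 0 ≤ M * (γ * ∑ i ∈ Finset.range n, Z i j +
        γ / K * ∑ i ∈ Finset.range n, ∑ u, Z i u + K * Real.log K / γ) := by positivity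
    linarith

end Path

/-! ### EXP3 regret in expectation -/

section Run

variable {d T : ℕ} {R : ℝ≥0} {L S lam : ℝ} {D : ℕ → Set (Vec d)} {θ : ℕ → Vec d}
  {ν : Measure ℝ} {Ω : Type*} {mΩ : MeasurableSpace Ω} {P : Measure Ω} {𝓕 : Filtration ℕ mΩ}
  {arm : ℕ → Ω → Arm d T} {X : ℕ → Ω → Vec d} {η : ℕ → Ω → ℝ}

theorem IsRun.measurable_blockGap (h : IsRun d T R L S lam D θ ν P 𝓕 arm X η) (i : ℕ) :
    Measurable fun ω => blockGap T D θ (fun s => X s ω) i :=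
  Finset.measurable_sum _ fun t ht => measurable_const.sub
    (measurable_inner_param (h.measurable_action' (lt_of_mem_blockRounds ht)) (θ t))

theorem IsRun.abs_blockGap_le (h : IsRun d T R L S lam D θ ν P 𝓕 arm X η)
    (hD : IsNormalized T L S D θ) (i : ℕ) (ω : Ω) :
    |blockGap T D θ (fun s => X s ω) i| ≤ 2 * blockLength d T := by
  rw [abs_of_nonneg (hD.blockGap_nonneg (fun t ht => h.action_mem t ht ω) i)]
  exact hD.blockGap_le (fun t ht => h.action_mem t ht ω) i

theorem IsRun.integrable_blockGap [IsProbabilityMeasure P]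
    (h : IsRun d T R L S lam D θ ν P 𝓕 arm X η) (hD : IsNormalized T L S D θ) (i : ℕ) :
    Integrable (fun ω => blockGap T D θ (fun s => X s ω) i) P :=
  Integrable.of_bound (h.measurable_blockGap i).aestronglyMeasurable (2 * blockLength d T)
    (Filter.Eventually.of_forall fun ω => h.abs_blockGap_le hD i ω)

theorem IsRun.integrable_runWeight_mul_blockGap [IsProbabilityMeasure P]
    (h : IsRun d T R L S lam D θ ν P 𝓕 arm X η) (hD : IsNormalized T L S D θ)
    (hγ : 0 < exploration d T) (hH : 1 ≤ blockLength d T) {i : ℕ} (hi : i < numBlocks d T)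
    (j : Arm d T) :
    Integrable (fun ω => runWeight R θ arm X η i j ω * blockGap T D θ (fun s => X s ω) i) P :=
  (h.integrable_runWeight hγ hH hi j).mul_bdd (c := 2 * blockLength d T)
    (h.measurable_blockGap i).aestronglyMeasurable
    (Filter.Eventually.of_forall fun ω => h.abs_blockGap_le hD i ω)

/-- The regret of the algorithm exceeds that of a fixed window length by the regret of EXP3. -/
theorem IsRun.sum_integral_blockGap_le [IsProbabilityMeasure P]
    (h : IsRun d T R L S lam D θ ν P 𝓕 arm X η) (hν : HasSubgaussianMGF id (R ^ 2) ν)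
    (hD : IsNormalized T L S D θ) (hγ : 0 < exploration d T) (hγ1 : exploration d T < 1)
    (hH : 1 ≤ blockLength d T) (hHT : blockLength d T ≤ T) (j : Arm d T) :
    ∑ i ∈ Finset.range (numBlocks d T), ∫ ω, blockGap T D θ (fun s => X s ω) i ∂P ≤
      ∑ i ∈ Finset.range (numBlocks d T),
        ∫ ω, runWeight R θ arm X η i j ω * blockGap T D θ (fun s => X s ω) i ∂P +
      rewardScale d T R * (2 * exploration d T * numBlocks d T +
        ((gridSize d T : ℝ) + 1) * Real.log ((gridSize d T : ℝ) + 1) / exploration d T) +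
      3 * rewardScale d T R * numBlocks d T * (((gridSize d T : ℝ) + 1) / exploration d T) *
        (numBlocks d T * (2 * (blockLength d T / (T : ℝ) ^ 2))) +
      ((gridSize d T : ℝ) + 1) / exploration d T * (numBlocks d T * (8 * (R : ℝ) ^ 2)) := by
  classical
  set n := numBlocks d T with hn
  set K := (gridSize d T : ℝ) + 1 with hK
  have hK0 : 0 < K := by positivity
  set γ := exploration d T with hγdef
  set M := rewardScale d T R with hM
  have hM0 : 0 < M := rewardScale_pos R hH
  have hH' : (0 : ℝ) < blockLength d T := by exact_mod_cast hH
  set Z := runWeight R θ arm X η with hZ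
  set G := fun i ω => blockGap T D θ (fun s => X s ω) i with hG
  set N := fun i ω => blockNoise d T (fun s => η s ω) i with hN
  set O := blockOptimum T R D θ with hO
  have hZ1 : ∀ i ∈ Finset.range n, ∀ u, ∫ ω, Z i u ω ∂P = 1 := fun i hi u =>
    h.integral_runWeight hγ hH (Finset.mem_range.1 hi) u
  have iZ : ∀ i ∈ Finset.range n, ∀ u, Integrable (Z i u) P := fun i hi u =>
    h.integrable_runWeight hγ hH (Finset.mem_range.1 hi) u
  have iG : ∀ i, Integrable (G i) P := fun i => h.integrable_blockGap hD i
  have iZG : ∀ i ∈ Finset.range n, Integrable (fun ω => Z i j ω * G i ω) P := fun i hi =>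
    h.integrable_runWeight_mul_blockGap hD hγ hH (Finset.mem_range.1 hi) j
  have iN : ∀ i, Integrable (N i) P ∧ ∫ ω, N i ω ∂P = 0 ∧
      Integrable (fun ω => N i ω ^ 2) P := by
    intro i
    obtain ⟨c, _, hc⟩ := h.exists_hasSubgaussianMGF_blockNoise hν i
    have h2 := hc.memLp 2
    exact ⟨hc.integrable, integral_eq_zero_of_hasSubgaussianMGF hc,
      by exact_mod_cast h2.integrable_sq⟩
  have iZN : ∀ i ∈ Finset.range n, Integrable (fun ω => Z i j ω * N i ω) P ∧
      ∫ ω, Z i j ω * N i ω ∂P = 0 := fun i hi =>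
    h.integral_mul_blockNoise hν (h.measurable_runWeight hH (Finset.mem_range.1 hi) j)
      (c := K / γ) fun ω => by
        rw [abs_of_nonneg (importanceWeight_nonneg _ _ _ _)]
        exact importanceWeight_le hγ _ _ _ _
  -- Mean zero on the whole space: `Z` has mean one, the optimum is deterministic, and the block
  -- noise is centred even when weighted by `Z`. Restricting to moderate noise would destroy this.
  have iC : ∀ i ∈ Finset.range n, Integrable (fun ω => (1 - Z i j ω) * (O i + N i ω)) P ∧
      ∫ ω, (1 - Z i j ω) * (O i + N i ω) ∂P = 0 := by
    intro i hi
    have e : (fun ω => (1 - Z i j ω) * (O i + N i ω)) =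
        fun ω => (O i - Z i j ω * O i) + (N i ω - Z i j ω * N i ω) := by
      ext ω; ring
    have j1 : Integrable (fun ω => O i - Z i j ω * O i) P :=
      (integrable_const _).sub ((iZ i hi j).mul_const _)
    have j2 : Integrable (fun ω => N i ω - Z i j ω * N i ω) P := (iN i).1.sub (iZN i hi).1
    rw [e]
    refine ⟨j1.add j2, ?_⟩
    rw [integral_add j1 j2, integral_sub (integrable_const _) ((iZ i hi j).mul_const _),
      integral_sub (iN i).1 (iZN i hi).1, integral_mul_const, hZ1 i hi j, (iN i).2.1,
      (iZN i hi).2]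
    simp
  set bad : Ω → ℝ := (largeNoise d T R η).indicator fun _ => (1 : ℝ) with hbad
  have ibad : Integrable bad P := (integrable_const (1 : ℝ)).indicator h.measurableSet_largeNoise
  have hbad1 : ∫ ω, bad ω ∂P ≤ n * (2 * (blockLength d T / (T : ℝ) ^ 2)) := by
    rw [hbad, integral_indicator_const _ h.measurableSet_largeNoise, smul_eq_mul, mul_one]
    exact h.measureReal_largeNoise_le hν hH hHT
  have hpt : ∀ ω, ∑ i ∈ Finset.range n, G i ω ≤
      ∑ i ∈ Finset.range n, Z i j ω * G i ω +
      ∑ i ∈ Finset.range n, (1 - Z i j ω) * (O i + N i ω) +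
      M * (γ * ∑ i ∈ Finset.range n, Z i j ω + γ / K * ∑ i ∈ Finset.range n, ∑ u, Z i u ω +
        K * Real.log K / γ) +
      3 * M * n * (K / γ) * bad ω +
      K / γ / blockLength d T * ∑ i ∈ Finset.range n, N i ω ^ 2 := by
    intro ω
    refine (sum_blockGap_le (R := R) hD (fun t ht => h.action_mem t ht ω) hH hγ hγ1
      (fun k => arm k ω) (fun s => η s ω) n j).trans (le_of_eq ?_)
    congr 2
    congr 1
    by_cases hω : ∀ i < n, |blockNoise d T (fun s => η s ω) i| ≤ blockNoiseLevel d T R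
    · rw [if_pos hω, hbad, Set.indicator_of_notMem]
      simp only [largeNoise, Set.mem_iUnion, not_exists]
      intro i hi
      exact not_lt.2 (hω i (Finset.mem_range.1 hi))
    · rw [if_neg hω, hbad, Set.indicator_of_mem]
      push Not at hω
      obtain ⟨i, hi, hlt⟩ := hω
      exact Set.mem_biUnion (Finset.mem_coe.2 (Finset.mem_range.2 hi)) hlt
  have j1 : Integrable (fun ω => ∑ i ∈ Finset.range n, Z i j ω * G i ω) P :=
    integrable_finsetSum _ iZG
  have j2 : Integrable (fun ω => ∑ i ∈ Finset.range n, (1 - Z i j ω) * (O i + N i ω)) P :=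
    integrable_finsetSum _ fun i hi => (iC i hi).1
  have j3 : Integrable (fun ω => ∑ i ∈ Finset.range n, Z i j ω) P :=
    integrable_finsetSum _ fun i hi => iZ i hi j
  have j4 : Integrable (fun ω => ∑ i ∈ Finset.range n, ∑ u, Z i u ω) P :=
    integrable_finsetSum _ fun i hi => integrable_finsetSum _ fun u _ => iZ i hi u
  have j5 : Integrable (fun ω => ∑ i ∈ Finset.range n, N i ω ^ 2) P :=
    integrable_finsetSum _ fun i _ => (iN i).2.2
  have j6 : Integrable (fun ω => M * (γ * ∑ i ∈ Finset.range n, Z i j ω +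
      γ / K * ∑ i ∈ Finset.range n, ∑ u, Z i u ω + K * Real.log K / γ)) P :=
    (((j3.const_mul _).add (j4.const_mul _)).add (integrable_const _)).const_mul _
  have j7 : Integrable (fun ω => γ * ∑ i ∈ Finset.range n, Z i j ω +
      γ / K * ∑ i ∈ Finset.range n, ∑ u, Z i u ω) P := (j3.const_mul _).add (j4.const_mul _)
  have hint := integral_mono (integrable_finsetSum _ fun i _ => iG i)
    ((((j1.add j2).add j6).add (ibad.const_mul (3 * M * n * (K / γ)))).add
      (j5.const_mul (K / γ / blockLength d T))) hpt
  have e3 : ∫ ω, ∑ i ∈ Finset.range n, Z i j ω ∂P = n := by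
    rw [integral_finsetSum _ fun i hi => iZ i hi j, Finset.sum_congr rfl fun i hi => hZ1 i hi j]
    simp
  have e4 : ∫ ω, ∑ i ∈ Finset.range n, ∑ u, Z i u ω ∂P = n * K := by
    rw [integral_finsetSum _ fun i hi => integrable_finsetSum _ fun u _ => iZ i hi u]
    have : ∀ i ∈ Finset.range n, ∫ ω, ∑ u, Z i u ω ∂P = K := by
      intro i hi
      rw [integral_finsetSum _ fun u _ => iZ i hi u, Finset.sum_congr rfl fun u _ => hZ1 i hi u,
        sum_arm_const, mul_one]
    rw [Finset.sum_congr rfl this]; simp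
  have e5 : ∫ ω, ∑ i ∈ Finset.range n, N i ω ^ 2 ∂P ≤
      n * (8 * (blockLength d T * (R : ℝ) ^ 2)) := by
    rw [integral_finsetSum _ fun i _ => (iN i).2.2]
    refine (Finset.sum_le_sum fun i _ => h.integral_sq_blockNoise_le hν i).trans ?_
    simp
  have e6 : ∫ ω, M * (γ * ∑ i ∈ Finset.range n, Z i j ω +
      γ / K * ∑ i ∈ Finset.range n, ∑ u, Z i u ω + K * Real.log K / γ) ∂P =
      M * (2 * γ * n + K * Real.log K / γ) := by
    rw [integral_const_mul, integral_add j7 (integrable_const _),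
      integral_add (j3.const_mul _) (j4.const_mul _), integral_const_mul, integral_const_mul, e3, e4,
      integral_const]
    simp only [probReal_univ, one_smul]
    field_simp
    ring
  have e2 : ∫ ω, ∑ i ∈ Finset.range n, (1 - Z i j ω) * (O i + N i ω) ∂P = 0 := by
    rw [integral_finsetSum _ fun i hi => (iC i hi).1]
    exact Finset.sum_eq_zero fun i hi => (iC i hi).2
  rw [integral_add' (((j1.add j2).add j6).add (ibad.const_mul (3 * M * n * (K / γ))))
      (j5.const_mul (K / γ / blockLength d T)),
    integral_add' ((j1.add j2).add j6) (ibad.const_mul (3 * M * n * (K / γ))),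
    integral_add' (j1.add j2) j6, integral_add' j1 j2, e2, e6, integral_const_mul,
    integral_const_mul, integral_finsetSum _ iZG, integral_finsetSum _ fun i _ => iG i,
    add_zero] at hint
  refine hint.trans (add_le_add (add_le_add le_rfl ?_) ?_)
  · exact mul_le_mul_of_nonneg_left hbad1 (by positivity)
  · refine (mul_le_mul_of_nonneg_left e5 (by positivity)).trans (le_of_eq ?_)
    field_simp

end Run

/-! ### Summation over blocks -/

theorem sum_blockRounds_eq {d T : ℕ} (f : ℕ → ℝ) (n : ℕ) :
    ∑ i ∈ Finset.range n, ∑ t ∈ blockRounds d T i, f t =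
      ∑ t ∈ Finset.range (min (n * blockLength d T) T), f t := by
  induction n with
  | zero => simp
  | succ n ih =>
    rw [Finset.sum_range_succ, ih, blockRounds]
    have hle : n * blockLength d T ≤ (n + 1) * blockLength d T :=
      Nat.mul_le_mul_right _ (Nat.le_succ n)
    rcases le_or_gt (n * blockLength d T) T with h | h
    · rw [min_eq_left h, Finset.range_eq_Ico,
        Finset.sum_Ico_consecutive _ (Nat.zero_le _) (le_min hle h), Finset.range_eq_Ico]
    · rw [min_eq_right h.le, min_eq_right (h.le.trans hle), Finset.Ico_eq_empty_of_le h.le]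
      simp

/-- The drift ranges of the blocks are disjoint, so the variation budget is spent once, not once per
block. -/
theorem sum_driftOn_blocks_le {d T : ℕ} (θ : ℕ → Vec d) (n : ℕ) :
    ∑ i ∈ Finset.range n, driftOn θ (Finset.Ico (i * blockLength d T)
        (min ((i + 1) * blockLength d T) T - 1)) ≤
      driftOn θ (Finset.range (min (n * blockLength d T) T - 1)) := by
  induction n with
  | zero => simp [driftOn]
  | succ n ih =>
    rw [Finset.sum_range_succ]
    refine (add_le_add_left ih _).trans ?_
    have hle : n * blockLength d T ≤ (n + 1) * blockLength d T :=
      Nat.mul_le_mul_right _ (Nat.le_succ n)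
    unfold driftOn
    rw [← Finset.sum_union]
    · refine Finset.sum_le_sum_of_subset_of_nonneg (fun p hp => ?_) fun _ _ _ => norm_nonneg _
      simp only [Finset.mem_union, Finset.mem_range, Finset.mem_Ico] at hp ⊢
      omega
    · rw [Finset.disjoint_left]
      intro p hp hq
      simp only [Finset.mem_range, Finset.mem_Ico] at hp hq
      omega

theorem one_le_windowLength {d T : ℕ} (hH : 1 ≤ blockLength d T) (j : Arm d T) :
    1 ≤ windowLength d T j := by
  unfold windowLength
  rw [Nat.one_le_floor_iff]
  exact Real.one_le_rpow (by exact_mod_cast hH) (by positivity)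

theorem windowLength_le {d T : ℕ} (hH : 1 ≤ blockLength d T) (j : Arm d T) :
    windowLength d T j ≤ blockLength d T := by
  unfold windowLength
  refine Nat.floor_le_of_le ?_
  have h1 : (1 : ℝ) ≤ blockLength d T := by exact_mod_cast hH
  refine (Real.rpow_le_rpow_of_exponent_le h1 ?_).trans (Real.rpow_one _).le
  refine div_le_one_of_le₀ ?_ (Nat.cast_nonneg _)
  exact_mod_cast Nat.lt_succ_iff.1 j.2

theorem le_numBlocks_mul {d T : ℕ} (hH : 1 ≤ blockLength d T) :
    T ≤ numBlocks d T * blockLength d T := by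
  have h1 : (0 : ℝ) < blockLength d T := by exact_mod_cast hH
  have h2 := Nat.le_ceil ((T : ℝ) / blockLength d T)
  rw [div_le_iff₀ h1] at h2
  exact_mod_cast h2

/-! ### Expected regret against a fixed window -/

section Run

variable {d T : ℕ} {R : ℝ≥0} {L S lam : ℝ} {D : ℕ → Set (Vec d)} {θ : ℕ → Vec d}
  {ν : Measure ℝ} {Ω : Type*} {mΩ : MeasurableSpace Ω} {P : Measure Ω} {𝓕 : Filtration ℕ mΩ}
  {arm : ℕ → Ω → Arm d T} {X : ℕ → Ω → Vec d} {η : ℕ → Ω → ℝ}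

theorem IsRun.expectedRegret_eq [IsProbabilityMeasure P]
    (h : IsRun d T R L S lam D θ ν P 𝓕 arm X η) (hD : IsNormalized T L S D θ)
    (hH : 1 ≤ blockLength d T) :
    expectedRegret P T D θ X = ∑ i ∈ Finset.range (numBlocks d T),
      ∫ ω, blockGap T D θ (fun s => X s ω) i ∂P := by
  rw [← integral_finsetSum _ fun i _ => h.integrable_blockGap hD i]
  unfold expectedRegret
  refine integral_congr_ae (Filter.Eventually.of_forall fun ω => ?_)
  have := sum_blockRounds_eq (d := d) (T := T) (gap D θ fun s => X s ω) (numBlocks d T)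
  rw [min_eq_right (le_numBlocks_mul hH)] at this
  exact this.symm

theorem IsRun.expectedRegret_le_two_mul [IsProbabilityMeasure P]
    (h : IsRun d T R L S lam D θ ν P 𝓕 arm X η) (hD : IsNormalized T L S D θ) :
    expectedRegret P T D θ X ≤ 2 * T := by
  unfold expectedRegret
  have hb : ∀ ω, ∑ t ∈ Finset.range T, (optimalReward D θ t - inner ℝ (X t ω) (θ t)) ≤ 2 * T := by
    intro ω
    refine (Finset.sum_le_card_nsmul _ _ 2 fun t ht => ?_).trans (by simp [mul_comm])
    exact hD.gap_le_two (X := fun s => X s ω) (Finset.mem_range.1 ht)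
      (h.action_mem t (Finset.mem_range.1 ht) ω)
  have h0 : ∀ ω, 0 ≤ ∑ t ∈ Finset.range T, (optimalReward D θ t - inner ℝ (X t ω) (θ t)) :=
    fun ω => Finset.sum_nonneg fun t ht => hD.gap_nonneg (X := fun s => X s ω)
      (Finset.mem_range.1 ht) (h.action_mem t (Finset.mem_range.1 ht) ω)
  refine (integral_mono_of_nonneg (Filter.Eventually.of_forall h0) (integrable_const (2 * (T : ℝ)))
    (Filter.Eventually.of_forall hb)).trans (by simp)

open Classical in
-- The weighted concentration bound with `Z` the importance weight: its mean is one, so reweighting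
-- costs nothing in the failure probability.
theorem IsRun.integral_runWeight_mul_noiseExceeds_le [IsProbabilityMeasure P]
    [IsProbabilityMeasure ν]
    (h : IsRun d T R L S lam D θ ν P 𝓕 arm X η) (hν : HasSubgaussianMGF id (R ^ 2) ν)
    (hlam : 0 < lam) (hD : IsNormalized T L S D θ) (hγ : 0 < exploration d T)
    (hH : 1 ≤ blockLength d T) {i t : ℕ} (hi : i < numBlocks d T) (w : ℕ)
    (ht : t ∈ blockRounds d T i) (j : Arm d T) :
    Integrable (fun ω => runWeight R θ arm X η i j ω *
        (if NoiseExceeds T R L lam w (fun s => X s ω) (fun s => η s ω) t then 1 else 0)) P ∧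
      ∫ ω, runWeight R θ arm X η i j ω *
        (if NoiseExceeds T R L lam w (fun s => X s ω) (fun s => η s ω) t then 1 else 0) ∂P ≤
      (T : ℝ) ^ (-(1 / 4) : ℝ) := by
  set Z := runWeight R θ arm X η i j with hZdef
  have hZ0 : ∀ ω, 0 ≤ Z ω := fun ω => importanceWeight_nonneg _ _ _ _
  have hZm := h.measurable_runWeight hH hi j
  have hZi := h.integrable_runWeight hγ hH hi j
  have hmeas : Measurable fun ω =>
      (if NoiseExceeds T R L lam w (fun s => X s ω) (fun s => η s ω) t then (1 : ℝ) else 0) :=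
    Measurable.ite (h.measurableSet_noiseExceeds w (lt_of_mem_blockRounds ht).le)
      measurable_const measurable_const
  have hint : Integrable (fun ω => Z ω *
      (if NoiseExceeds T R L lam w (fun s => X s ω) (fun s => η s ω) t then (1 : ℝ) else 0)) P :=
    hZi.mul_bdd (c := 1) hmeas.aestronglyMeasurable (Filter.Eventually.of_forall fun ω => by
      split_ifs <;> simp)
  refine ⟨hint, ?_⟩
  have hl := h.lintegral_noiseExceeds_le hν hlam hD w ht
    (Z := fun ω => ENNReal.ofReal (Z ω)) (ENNReal.measurable_ofReal.comp hZm)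
  rw [← ofReal_integral_eq_lintegral_ofReal hZi (Filter.Eventually.of_forall hZ0),
    h.integral_runWeight hγ hH hi j, ENNReal.ofReal_one, mul_one] at hl
  have he : ∫⁻ ω, ENNReal.ofReal (Z ω) *
      (if NoiseExceeds T R L lam w (fun s => X s ω) (fun s => η s ω) t then 1 else 0) ∂P =
      ∫⁻ ω, ENNReal.ofReal (Z ω *
      (if NoiseExceeds T R L lam w (fun s => X s ω) (fun s => η s ω) t then 1 else 0)) ∂P := by
    refine lintegral_congr fun ω => ?_
    split_ifs <;> simp
  rw [he, ← ofReal_integral_eq_lintegral_ofReal hint (Filter.Eventually.of_forall fun ω => by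
    have := hZ0 ω
    dsimp only
    split_ifs <;> simp [this])] at hl
  exact (ENNReal.ofReal_le_ofReal_iff (by positivity)).1 hl

/-- The regret of the algorithm against a fixed window length. -/
theorem exists_expectedRegret_le (R : ℝ≥0) {L S lam : ℝ} (hlam : 0 < lam) (hL : 0 < L)
    (hS : 0 < S) :
    ∃ C : ℝ, 0 < C ∧ ∀ (d T : ℕ) (D : ℕ → Set (Vec d)) (θ : ℕ → Vec d) (B : ℝ) (ν : Measure ℝ)
      [IsProbabilityMeasure ν] {Ω : Type*} {mΩ : MeasurableSpace Ω} (P : Measure Ω)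
      [IsProbabilityMeasure P] (𝓕 : Filtration ℕ mΩ) (arm : ℕ → Ω → Arm d T)
      (X : ℕ → Ω → Vec d) (η : ℕ → Ω → ℝ) (j : Arm d T),
      IsRun d T R L S lam D θ ν P 𝓕 arm X η → HasSubgaussianMGF id (R ^ 2) ν →
      IsNormalized T L S D θ → θ ∈ variationClass d T B → 1 ≤ d → 2 ≤ T →
      1 ≤ blockLength d T → blockLength d T ≤ T → 0 < exploration d T → exploration d T < 1 →
      expectedRegret P T D θ X ≤
        C * (numBlocks d T * ((1 + Real.log T) ^ 2 * radiusScale d R * √d * blockLength d T /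
            √(windowLength d T j)) +
          windowLength d T j * √(windowLength d T j) / radiusScale d R * B) +
        2 * (numBlocks d T * blockLength d T) * (T : ℝ) ^ (-(1 / 4) : ℝ) +
        (rewardScale d T R * (2 * exploration d T * numBlocks d T +
          ((gridSize d T : ℝ) + 1) * Real.log ((gridSize d T : ℝ) + 1) / exploration d T) +
        3 * rewardScale d T R * numBlocks d T * (((gridSize d T : ℝ) + 1) / exploration d T) *
          (numBlocks d T * (2 * (blockLength d T / (T : ℝ) ^ 2))) +
        ((gridSize d T : ℝ) + 1) / exploration d T * (numBlocks d T * (8 * (R : ℝ) ^ 2))) := by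
  classical
  obtain ⟨C, hC, hblock⟩ := exists_block_gap_le R hlam hL hS
  refine ⟨C, hC, ?_⟩
  intro d T D θ B ν _ Ω mΩ P _ 𝓕 arm X η j h hν hD hθ hd hT hH hHT hγ hγ1
  rw [h.expectedRegret_eq hD hH]
  have hexp := h.sum_integral_blockGap_le hν hD hγ hγ1 hH hHT j
  refine hexp.trans ?_
  rw [add_assoc, add_assoc, ← add_assoc (rewardScale d T R * _)]
  refine add_le_add ?_ le_rfl
  set w := windowLength d T j with hw
  set H := blockLength d T with hHdef
  set n := numBlocks d T with hn
  set Z := runWeight R θ arm X η with hZ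
  set A := (1 + Real.log T) ^ 2 * radiusScale d R * √d * H / √w with hA
  set F := fun t ω =>
    (if NoiseExceeds T R L lam w (fun s => X s ω) (fun s => η s ω) t then (1 : ℝ) else 0) with hF
  have hper : ∀ i ∈ Finset.range n,
      ∫ ω, Z i j ω * blockGap T D θ (fun s => X s ω) i ∂P ≤
        C * (A + w * √w / radiusScale d R * driftOn θ (Finset.Ico (i * H)
          (min ((i + 1) * H) T - 1))) + 2 * (H * (T : ℝ) ^ (-(1 / 4) : ℝ)) := by
    intro i hi
    have hi' := Finset.mem_range.1 hi
    set b := C * (A + w * √w / radiusScale d R * driftOn θ (Finset.Ico (i * H)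
          (min ((i + 1) * H) T - 1))) with hb
    have hfail : ∀ t ∈ blockRounds d T i, Integrable (fun ω => Z i j ω * F t ω) P ∧
        ∫ ω, Z i j ω * F t ω ∂P ≤ (T : ℝ) ^ (-(1 / 4) : ℝ) := fun t ht =>
      h.integral_runWeight_mul_noiseExceeds_le hν hlam hD hγ hH hi' w ht j
    have hpt : ∀ ω, Z i j ω * blockGap T D θ (fun s => X s ω) i ≤
        Z i j ω * b + 2 * ∑ t ∈ blockRounds d T i, Z i j ω * F t ω := by
      intro ω
      -- On paths where `j` was not drawn the weight vanishes, so the SW-UCB bound is needed only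
      -- where the block really used this window.
      by_cases harm : arm i ω = j
      · have hg := hblock d T w i D θ (fun s => X s ω) (fun s => η s ω) hd hT
          (one_le_windowLength hH j) (windowLength_le hH j) hHT hD
          (fun t ht => h.action_mem t ht ω) fun t ht => by
            have := h.action_isMaxOn t (lt_of_mem_blockRounds ht) ω
            rw [div_mul_eq_of_mem_blockRounds ht, harm] at this
            exact this
        have hZ0 : 0 ≤ Z i j ω := importanceWeight_nonneg _ _ _ _
        have := mul_le_mul_of_nonneg_left hg hZ0
        rw [← Finset.mul_sum]
        refine this.trans (le_of_eq ?_)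
        rw [hb, hA]
        ring
      · have hZ0 : Z i j ω = 0 := if_neg harm
        simp [hZ0]
    have iZ := h.integrable_runWeight hγ hH hi' j
    have j1 : Integrable (fun ω => Z i j ω * b) P := iZ.mul_const _
    have j2 : Integrable (fun ω => ∑ t ∈ blockRounds d T i, Z i j ω * F t ω) P :=
      integrable_finsetSum _ fun t ht => (hfail t ht).1
    have hint := integral_mono (h.integrable_runWeight_mul_blockGap hD hγ hH hi' j)
      (j1.add (j2.const_mul 2)) hpt
    rw [integral_add' j1 (j2.const_mul 2), integral_mul_const,
      h.integral_runWeight hγ hH hi' j, one_mul, integral_const_mul,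
      integral_finsetSum _ fun t ht => (hfail t ht).1] at hint
    refine hint.trans ?_
    have hs : ∑ t ∈ blockRounds d T i, ∫ ω, Z i j ω * F t ω ∂P ≤
        H * (T : ℝ) ^ (-(1 / 4) : ℝ) := by
      refine (Finset.sum_le_card_nsmul _ _ _ fun t ht => (hfail t ht).2).trans ?_
      rw [nsmul_eq_mul]
      have : ((blockRounds d T i).card : ℝ) ≤ H := by
        exact_mod_cast card_blockRounds_le d T i
      gcongr
    linarith
  refine (Finset.sum_le_sum hper).trans ?_
  rw [Finset.sum_add_distrib, ← Finset.mul_sum, Finset.sum_add_distrib, ← Finset.mul_sum,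
    Finset.sum_const, Finset.sum_const, Finset.card_range, nsmul_eq_mul, nsmul_eq_mul]
  have hdrift : ∑ i ∈ Finset.range n, driftOn θ (Finset.Ico (i * H)
      (min ((i + 1) * H) T - 1)) ≤ B := by
    refine (sum_driftOn_blocks_le θ n).trans ?_
    rw [min_eq_right (le_numBlocks_mul hH)]
    exact hθ
  have hg := one_le_radiusScale hd R
  have h1 : w * √w / radiusScale d R * ∑ i ∈ Finset.range n, driftOn θ (Finset.Ico (i * H)
      (min ((i + 1) * H) T - 1)) ≤ w * √w / radiusScale d R * B :=
    mul_le_mul_of_nonneg_left hdrift (by positivity)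
  have h2 := mul_le_mul_of_nonneg_left h1 hC.le
  rw [mul_add, mul_add]
  linarith

end Run

/-! ### The parameters of the algorithm -/

/-- The grid of window lengths contains every length up to a constant factor. -/
theorem exists_windowLength {d T : ℕ} (hH : 2 ≤ blockLength d T) {y : ℝ} (hy : 1 ≤ y)
    (hyH : y ≤ blockLength d T) :
    ∃ j : Arm d T, (windowLength d T j : ℝ) ≤ y ∧ y ≤ 6 * windowLength d T j := by
  have hH' : (2 : ℝ) ≤ blockLength d T := by exact_mod_cast hH
  have hlogH : 0 < Real.log (blockLength d T) := Real.log_pos (by linarith)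
  have hΔ0 : 0 < gridSize d T := Nat.ceil_pos.2 hlogH
  have hΔ0' : (0 : ℝ) < gridSize d T := by exact_mod_cast hΔ0
  have hΔ : Real.log (blockLength d T) ≤ gridSize d T := Nat.le_ceil _
  have hlogy : 0 ≤ Real.log y := Real.log_nonneg hy
  have hlogyH : Real.log y ≤ Real.log (blockLength d T) := Real.log_le_log (by linarith) hyH
  set H : ℝ := (blockLength d T : ℝ) with hHdef
  set Δ : ℝ := (gridSize d T : ℝ) with hΔdef
  -- The real exponent with `H^(q / Δ) = y`; the arm is its integer part.
  set q := Δ * (Real.log y / Real.log H) with hq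
  have hq0 : 0 ≤ q := by positivity
  have hqΔ : q ≤ Δ := by
    rw [hq]
    exact mul_le_of_le_one_right hΔ0'.le (div_le_one_of_le₀ hlogyH hlogH.le)
  have hj : ⌊q⌋₊ < gridSize d T + 1 := by
    rw [Nat.lt_succ_iff]
    exact Nat.floor_le_of_le hqΔ
  refine ⟨⟨⌊q⌋₊, hj⟩, ?_⟩
  set k : ℝ := (⌊q⌋₊ : ℝ) with hk
  have hkq : k ≤ q := Nat.floor_le hq0
  have hqk : q < k + 1 := Nat.lt_floor_add_one q
  have hw : windowLength d T ⟨⌊q⌋₊, hj⟩ = ⌊H ^ (k / Δ)⌋₊ := rfl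
  rw [hw]
  set z := H ^ (k / Δ) with hz
  have hz1 : 1 ≤ z := Real.one_le_rpow (by linarith) (by positivity)
  have hzexp : z = Real.exp (Real.log H * (k / Δ)) := Real.rpow_def_of_pos (by linarith) _
  have hyexp : y = Real.exp (Real.log H * (q / Δ)) := by
    have : Real.log H * (q / Δ) = Real.log y := by rw [hq]; field_simp
    rw [this, Real.exp_log (by linarith)]
  have hzy : z ≤ y := by
    rw [hzexp, hyexp]
    refine Real.exp_le_exp.2 ?_
    gcongr
  -- Neighbouring grid points have ratio `H^(1 / Δ) ≤ e < 3`, as `Δ ≥ log H`. The floor costs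
  -- another factor 2, which makes 6.
  have hyz : y ≤ 3 * z := by
    have h1 : y ≤ Real.exp 1 * z := by
      rw [hzexp, hyexp, ← Real.exp_add]
      refine Real.exp_le_exp.2 ?_
      have h2 : Real.log H * (q / Δ) ≤ Real.log H * ((k + 1) / Δ) := by gcongr
      have h3 : Real.log H / Δ ≤ 1 := div_le_one_of_le₀ hΔ hΔ0'.le
      have h4 : Real.log H * ((k + 1) / Δ) = Real.log H / Δ + Real.log H * (k / Δ) := by ring
      linarith
    have := Real.exp_one_lt_d9
    nlinarith
  have hf1 : (⌊z⌋₊ : ℝ) ≤ z := Nat.floor_le (by linarith)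
  have hf2 : z < ⌊z⌋₊ + 1 := Nat.lt_floor_add_one z
  have hf3 : (1 : ℝ) ≤ ⌊z⌋₊ := by exact_mod_cast (Nat.one_le_floor_iff z).2 hz1
  constructor <;> linarith

/-- The parameters of the algorithm in the case where the bound is not trivial; here `a^2` stands
for `d^(2/3)` and `τ` for `T^(1/4)`. -/
theorem parameter_bounds {d T : ℕ} {a τ : ℝ} (ha : 1 ≤ a) (hτT : τ ^ 4 = T) (hT : 4 ≤ T)
    (haτ : a ^ 2 ≤ τ) (hτ : 0 < τ) (hblock : blockLength d T = ⌊a ^ 2 * τ ^ 2⌋₊) :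
    2 ≤ blockLength d T ∧ blockLength d T ≤ T ∧ (blockLength d T : ℝ) ≤ a ^ 2 * τ ^ 2 ∧
      a ^ 2 * τ ^ 2 ≤ 2 * blockLength d T ∧
      (numBlocks d T : ℝ) * blockLength d T ≤ 2 * T ∧ (numBlocks d T : ℝ) ≤ 4 * τ ^ 2 ∧
      2 ≤ (gridSize d T : ℝ) + 1 ∧ (gridSize d T : ℝ) + 1 ≤ 2 * (1 + Real.log T) := by
  have hT' : (4 : ℝ) ≤ T := by exact_mod_cast hT
  have hτ2 : 2 ≤ τ ^ 2 := by
    by_contra hc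
    push Not at hc
    have : (τ ^ 2) ^ 2 < 2 ^ 2 := by gcongr
    nlinarith
  have ha2 : 1 ≤ a ^ 2 := one_le_pow₀ ha
  have hx2 : 2 ≤ a ^ 2 * τ ^ 2 := by nlinarith
  have h1 : 2 ≤ blockLength d T := by
    rw [hblock]; exact Nat.le_floor (by exact_mod_cast hx2)
  have h1' : (2 : ℝ) ≤ blockLength d T := by exact_mod_cast h1
  have h2 : (blockLength d T : ℝ) ≤ a ^ 2 * τ ^ 2 := by
    rw [hblock]; exact Nat.floor_le (by linarith)
  have h3 : a ^ 2 * τ ^ 2 < blockLength d T + 1 := by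
    rw [hblock]; exact Nat.lt_floor_add_one _
  have hτ1 : 1 ≤ τ := ha2.trans haτ
  have h4 : (blockLength d T : ℝ) ≤ T := by
    rw [← hτT]
    calc (blockLength d T : ℝ) ≤ a ^ 2 * τ ^ 2 := h2
      _ ≤ τ * τ ^ 2 := by gcongr
      _ = τ ^ 3 * 1 := by ring
      _ ≤ τ ^ 3 * τ := by gcongr
      _ = τ ^ 4 := by ring
  have h5 : (numBlocks d T : ℝ) * blockLength d T ≤ 2 * T := by
    have h6 : (numBlocks d T : ℝ) < T / blockLength d T + 1 := Nat.ceil_lt_add_one (by positivity)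
    have h7 : (T / blockLength d T + 1 : ℝ) * blockLength d T = T + blockLength d T := by
      field_simp
    nlinarith
  have h8 : (numBlocks d T : ℝ) ≤ 4 * τ ^ 2 := by
    have hn0 : (0 : ℝ) ≤ numBlocks d T := Nat.cast_nonneg _
    have h9 : τ ^ 2 ≤ 2 * blockLength d T := by nlinarith
    have h10 : (numBlocks d T : ℝ) * τ ^ 2 ≤ 4 * τ ^ 2 * τ ^ 2 := by
      calc (numBlocks d T : ℝ) * τ ^ 2 ≤ numBlocks d T * (2 * blockLength d T) := by gcongr
        _ ≤ 4 * T := by linarith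
        _ = 4 * τ ^ 2 * τ ^ 2 := by rw [← hτT]; ring
    exact le_of_mul_le_mul_right h10 (by positivity)
  have hlogH : 0 < Real.log (blockLength d T) := Real.log_pos (by linarith)
  have h11 : (1 : ℝ) ≤ gridSize d T := by exact_mod_cast Nat.ceil_pos.2 hlogH
  have h12 : (gridSize d T : ℝ) < Real.log (blockLength d T) + 1 := Nat.ceil_lt_add_one hlogH.le
  have h13 : Real.log (blockLength d T) ≤ Real.log T := Real.log_le_log (by linarith) h4
  refine ⟨h1, by exact_mod_cast h4, h2, by linarith, h5, h8, by linarith, by linarith⟩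

theorem one_half_le_log {x : ℝ} (hx : 2 ≤ x) : 1 / 2 ≤ Real.log x := by
  have h1 : Real.log 2 ≤ Real.log x := Real.log_le_log (by norm_num) hx
  have := Real.log_two_gt_d9
  linarith

/-- The exploration rate, when it is less than one. -/
theorem exploration_bounds {d T : ℕ} {Λ : ℝ} (hK2 : 2 ≤ (gridSize d T : ℝ) + 1)
    (hKΛ : (gridSize d T : ℝ) + 1 ≤ 2 * Λ) (hn : 1 ≤ numBlocks d T)
    (hγ1 : exploration d T < 1) :
    0 < exploration d T ∧ exploration d T * numBlocks d T ≤ 2 * Λ * √(numBlocks d T) ∧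
      ((gridSize d T : ℝ) + 1) * Real.log ((gridSize d T : ℝ) + 1) / exploration d T ≤
        4 * Λ * √(numBlocks d T) ∧
      ((gridSize d T : ℝ) + 1) / exploration d T ≤ 8 * Λ * √(numBlocks d T) := by
  have hlogK := one_half_le_log hK2
  have hn' : (1 : ℝ) ≤ numBlocks d T := by exact_mod_cast hn
  have he1 : 1 < Real.exp 1 - 1 := by have := Real.exp_one_gt_d9; linarith
  have he2 : Real.exp 1 - 1 < 2 := by have := Real.exp_one_lt_d9; linarith
  have hmin : exploration d T = √(((gridSize d T : ℝ) + 1) * Real.log ((gridSize d T : ℝ) + 1) /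
      ((Real.exp 1 - 1) * (numBlocks d T : ℝ))) := by
    unfold exploration at hγ1 ⊢
    exact min_eq_right ((min_lt_iff.1 hγ1).resolve_left (lt_irrefl _)).le
  set γ := exploration d T
  set K := (gridSize d T : ℝ) + 1
  set n : ℝ := (numBlocks d T : ℝ)
  set v := Real.exp 1 - 1
  have hγ0 : 0 < γ := by rw [hmin]; exact Real.sqrt_pos.2 (by positivity)
  have hγ2 : γ ^ 2 * (v * n) = K * Real.log K := by
    rw [hmin, Real.sq_sqrt (by positivity), div_mul_cancel₀ _ (by positivity)]
  have hlogK' : Real.log K ≤ 2 * Λ := (Real.log_le_self (by linarith)).trans hKΛ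
  have hΛ : 1 ≤ Λ := by linarith
  have hγn : γ * n ≤ 2 * Λ * √n := by
    have h1 : (γ * n) ^ 2 ≤ (2 * Λ * √n) ^ 2 := by
      rw [mul_pow, mul_pow _ (√n), Real.sq_sqrt (by linarith)]
      have h2 : γ ^ 2 * n ≤ (2 * Λ) ^ 2 := by
        calc γ ^ 2 * n ≤ γ ^ 2 * (v * n) := by
              refine mul_le_mul_of_nonneg_left ?_ (sq_nonneg _)
              nlinarith
          _ = K * Real.log K := hγ2
          _ ≤ (2 * Λ) * (2 * Λ) := by gcongr
          _ = _ := by ring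
      calc γ ^ 2 * n ^ 2 = γ ^ 2 * n * n := by ring
        _ ≤ (2 * Λ) ^ 2 * n := by gcongr
    exact (le_abs_self _).trans (abs_le_of_sq_le_sq h1 (by positivity))
  have hKl : K * Real.log K / γ ≤ 4 * Λ * √n := by
    have h1 : K * Real.log K / γ = v * (γ * n) := by
      rw [← hγ2]; field_simp
    rw [h1]
    nlinarith [mul_pos hγ0 (by linarith : 0 < n)]
  refine ⟨hγ0, hγn, hKl, ?_⟩
  have h1 : K / γ ≤ 2 * (K * Real.log K / γ) := by
    rw [mul_div_assoc', div_le_div_iff_of_pos_right hγ0]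
    nlinarith
  linarith

/-- Full exploration occurs only with logarithmically many blocks; then `T` is at most `H` up to
logarithms and the trivial regret bound suffices. -/
theorem numBlocks_le_of_exploration_eq_one {d T : ℕ} {Λ : ℝ}
    (hK2 : 2 ≤ (gridSize d T : ℝ) + 1)
    (hKΛ : (gridSize d T : ℝ) + 1 ≤ 2 * Λ) (hn : 1 ≤ numBlocks d T)
    (hγ1 : ¬ exploration d T < 1) : (numBlocks d T : ℝ) ≤ 4 * Λ ^ 2 := by
  have hlogK := one_half_le_log hK2
  have hn' : (1 : ℝ) ≤ numBlocks d T := by exact_mod_cast hn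
  have he1 : 1 < Real.exp 1 - 1 := by have := Real.exp_one_gt_d9; linarith
  rw [not_lt] at hγ1
  unfold exploration at hγ1
  have h1 := (le_min_iff.1 hγ1).2
  rw [Real.one_le_sqrt, one_le_div (by positivity)] at h1
  have hlogK' : Real.log ((gridSize d T : ℝ) + 1) ≤ 2 * Λ :=
    (Real.log_le_self (by linarith)).trans hKΛ
  calc (numBlocks d T : ℝ) ≤ (Real.exp 1 - 1) * numBlocks d T := by nlinarith
    _ ≤ _ := h1
    _ ≤ (2 * Λ) * (2 * Λ) := by gcongr; linarith
    _ = _ := by ring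

/-- A crude bound that replaces `√H` by `H`; nothing is lost, since the mean rewards already have
scale `H`. -/
theorem rewardScale_le {d T : ℕ} (R : ℝ≥0) (hH : 1 ≤ blockLength d T) (hT : 1 ≤ T) :
    rewardScale d T R ≤ (2 + 4 * R) * (blockLength d T * (1 + Real.log T)) := by
  have hH' : (1 : ℝ) ≤ blockLength d T := by exact_mod_cast hH
  have hT' : (1 : ℝ) ≤ T := by exact_mod_cast hT
  have hlT : 0 ≤ Real.log T := Real.log_nonneg hT'
  have hs : 1 ≤ √(blockLength d T : ℝ) := Real.one_le_sqrt.2 hH'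
  have h1 : Real.log ((T : ℝ) / √(blockLength d T : ℝ)) ≤ 1 + Real.log T := by
    rw [Real.log_div (by positivity) (by positivity)]
    linarith [Real.log_nonneg hs]
  have h2 : √((blockLength d T : ℝ) * Real.log ((T : ℝ) / √(blockLength d T : ℝ))) ≤
      blockLength d T * (1 + Real.log T) := by
    refine Real.sqrt_le_iff.2 ⟨by positivity, ?_⟩
    rw [mul_pow]
    refine mul_le_mul_of_nonneg (by nlinarith) (h1.trans (by nlinarith)) (by positivity)
      (by positivity)
  have h3 : (blockLength d T : ℝ) ≤ blockLength d T * (1 + Real.log T) := by nlinarith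
  unfold rewardScale
  have h4 := mul_le_mul_of_nonneg_left h2 (show (0 : ℝ) ≤ 4 * R by positivity)
  linarith

/-- The cost of EXP3. -/
theorem exp3_cost_le {d T : ℕ} (R : ℝ≥0) {a τ : ℝ} (ha : 1 ≤ a) (hτT : τ ^ 4 = T) (hT : 4 ≤ T)
    (haτ : a ^ 2 ≤ τ) (hτ : 0 < τ) (hblock : blockLength d T = ⌊a ^ 2 * τ ^ 2⌋₊)
    (hγ1 : exploration d T < 1) :
    rewardScale d T R * (2 * exploration d T * numBlocks d T +
          ((gridSize d T : ℝ) + 1) * Real.log ((gridSize d T : ℝ) + 1) / exploration d T) +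
        3 * rewardScale d T R * numBlocks d T * (((gridSize d T : ℝ) + 1) / exploration d T) *
          (numBlocks d T * (2 * (blockLength d T / (T : ℝ) ^ 2))) +
        ((gridSize d T : ℝ) + 1) / exploration d T * (numBlocks d T * (8 * (R : ℝ) ^ 2)) ≤
      (400 * (2 + 4 * R) + 512 * (R : ℝ) ^ 2) * (a ^ 2 * τ ^ 3 * (1 + Real.log T) ^ 2) := by
  obtain ⟨h1, h2, h3, h4, h5, h6, h7, h8⟩ := parameter_bounds ha hτT hT haτ hτ hblock
  have hH' : (2 : ℝ) ≤ blockLength d T := by exact_mod_cast h1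
  have hT' : (4 : ℝ) ≤ T := by exact_mod_cast hT
  have hlT : 0 ≤ Real.log T := Real.log_nonneg (by linarith)
  have hn : 1 ≤ numBlocks d T := Nat.ceil_pos.2 (by positivity)
  obtain ⟨g0, g1, g2, g3⟩ := exploration_bounds h7 h8 hn hγ1
  have hM := rewardScale_le (d := d) (T := T) R (by omega) (by omega)
  have hM0 := rewardScale_pos (d := d) (T := T) R (by omega)
  have hn' : (1 : ℝ) ≤ numBlocks d T := by exact_mod_cast hn
  set M := rewardScale d T R
  set γ := exploration d T
  set n : ℝ := (numBlocks d T : ℝ)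
  set K := (gridSize d T : ℝ) + 1
  set Λ := 1 + Real.log T
  set H : ℝ := (blockLength d T : ℝ)
  set ρ : ℝ := 2 + 4 * (R : ℝ)
  have hρ : 0 < ρ := by positivity
  have hΛ : 1 ≤ Λ := by simp only [Λ]; linarith
  set s := √n with hs
  have hs2 : s ^ 2 = n := Real.sq_sqrt (by linarith)
  have hs0 : 0 ≤ s := Real.sqrt_nonneg _
  have ha2 : 1 ≤ a ^ 2 := one_le_pow₀ ha
  have hτ1 : 1 ≤ τ := ha2.trans haτ
  have hsτ : s ≤ 2 * τ := by
    refine (le_abs_self _).trans (abs_le_of_sq_le_sq ?_ (by positivity))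
    rw [hs2]; linarith
  have hHs : H * s ≤ 2 * (a ^ 2 * τ ^ 3) := by
    calc H * s ≤ (a ^ 2 * τ ^ 2) * (2 * τ) := by gcongr
      _ = _ := by ring
  have e1 : M * (2 * γ * n + K * Real.log K / γ) ≤ 16 * ρ * (a ^ 2 * τ ^ 3 * Λ ^ 2) := by
    have : 2 * γ * n + K * Real.log K / γ ≤ 8 * Λ * s := by linarith
    calc M * (2 * γ * n + K * Real.log K / γ) ≤ M * (8 * Λ * s) := by gcongr
      _ ≤ ρ * (H * Λ) * (8 * Λ * s) := by gcongr
      _ = 8 * ρ * Λ ^ 2 * (H * s) := by ring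
      _ ≤ 8 * ρ * Λ ^ 2 * (2 * (a ^ 2 * τ ^ 3)) := by gcongr
      _ = _ := by ring
  have hτ3 : τ ≤ a ^ 2 * τ ^ 3 := by
    have : τ * 1 ≤ τ ^ 3 * a ^ 2 := by
      refine mul_le_mul ?_ ha2 zero_le_one (by positivity)
      exact le_self_pow₀ hτ1 (by norm_num)
    linarith
  -- The number of blocks enters twice, from the penalty and from the union bound; with `n H ≤ 2 T`,
  -- the quotient `(n H)² / T²` is at most 4.
  have e2 : 3 * M * n * (K / γ) * (n * (2 * (H / (T : ℝ) ^ 2))) ≤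
      384 * ρ * (a ^ 2 * τ ^ 3 * Λ ^ 2) := by
    have hKγ0 : 0 ≤ K / γ := by positivity
    calc 3 * M * n * (K / γ) * (n * (2 * (H / (T : ℝ) ^ 2)))
        ≤ 3 * (ρ * (H * Λ)) * n * (8 * Λ * s) * (n * (2 * (H / (T : ℝ) ^ 2))) := by gcongr
      _ = 48 * ρ * Λ ^ 2 * s * ((n * H) ^ 2 / (T : ℝ) ^ 2) := by ring
      _ ≤ 48 * ρ * Λ ^ 2 * (2 * τ) * ((2 * T) ^ 2 / (T : ℝ) ^ 2) := by gcongr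
      _ = 384 * ρ * Λ ^ 2 * τ := by field_simp; ring
      _ ≤ 384 * ρ * Λ ^ 2 * (a ^ 2 * τ ^ 3) := by gcongr
      _ = _ := by ring
  have e3 : K / γ * (n * (8 * (R : ℝ) ^ 2)) ≤ 512 * (R : ℝ) ^ 2 * (a ^ 2 * τ ^ 3 * Λ ^ 2) := by
    calc K / γ * (n * (8 * (R : ℝ) ^ 2)) ≤ 8 * Λ * s * (n * (8 * (R : ℝ) ^ 2)) := by gcongr
      _ ≤ 8 * Λ * (2 * τ) * (4 * τ ^ 2 * (8 * (R : ℝ) ^ 2)) := by gcongr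
      _ = 512 * (R : ℝ) ^ 2 * (1 * τ ^ 3 * Λ) := by ring
      _ ≤ 512 * (R : ℝ) ^ 2 * (a ^ 2 * τ ^ 3 * Λ ^ 2) := by
          have : Λ ≤ Λ ^ 2 := le_self_pow₀ hΛ (by norm_num)
          gcongr
  linarith

/-- The choice of the window length. -/
theorem exists_window_scale {d : ℕ} (hd : 1 ≤ d) (R : ℝ≥0) {a τ β : ℝ} (ha : 1 ≤ a)
    (had : a ^ 3 = d) (hβ : 1 ≤ β) (hβτ : β ≤ τ) :
    ∃ r : ℝ, 1 ≤ r ∧ r ≤ a * τ ∧ τ ^ 4 * (radiusScale d R * √d) / r ≤ a ^ 2 * τ ^ 3 * β ∧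
      r ^ 3 / radiusScale d R * β ^ 4 ≤ a ^ 2 * τ ^ 3 * β := by
  have hc2 : √(d : ℝ) ^ 2 = a ^ 3 := by rw [Real.sq_sqrt (Nat.cast_nonneg d), had]
  have hc1 : 1 ≤ √(d : ℝ) := Real.one_le_sqrt.2 (by exact_mod_cast hd)
  set c := √(d : ℝ)
  have hca : c ≤ a ^ 2 := by
    refine (le_abs_self _).trans (abs_le_of_sq_le_sq ?_ (by positivity))
    rw [hc2]
    calc a ^ 3 = a ^ 3 * 1 := by ring
      _ ≤ a ^ 3 * a := by gcongr
      _ = (a ^ 2) ^ 2 := by ring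
  have hτ0 : 0 < τ := by linarith
  rcases eq_or_ne R 0 with hR | hR
  · have hg : radiusScale d R = 1 := by simp [radiusScale, hR]
    rw [hg]
    -- Here `r` stands for `√w`. For `R = 0` the two costs are `√d T / r` and `r³ B`, and this
    -- choice bounds both.
    refine ⟨τ / β, by rwa [one_le_div (by linarith)], ?_, ?_, ?_⟩
    · rw [div_le_iff₀ (by linarith)]
      have : 1 ≤ a * β := by nlinarith
      nlinarith
    · have : τ ^ 4 * (1 * c) / (τ / β) = c * τ ^ 3 * β := by field_simp
      rw [this]
      gcongr
    · have : (τ / β) ^ 3 / 1 * β ^ 4 = 1 * τ ^ 3 * β := by field_simp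
      rw [this]
      have : 1 ≤ a ^ 2 := one_le_pow₀ ha
      gcongr
  · have hg : radiusScale d R = c := by simp [radiusScale, hR, c]
    rw [hg]
    have hr1 : 1 ≤ τ / β := by rwa [one_le_div (by linarith)]
    -- For `R ≠ 0` the costs are `d T / r` and `r³ B / √d`. The first becomes exactly `a² τ³ β`, the
    -- second `√d τ³ β`; the cap `r ≤ a τ` keeps the window within a block.
    refine ⟨a * (τ / β), by nlinarith, ?_, ?_, ?_⟩
    · have : τ / β ≤ τ := div_le_self hτ0.le hβ
      gcongr
    · have : τ ^ 4 * (c * c) / (a * (τ / β)) = c ^ 2 * τ ^ 3 * β / a := by field_simp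
      rw [this, hc2]
      refine le_of_eq ?_
      field_simp
    · have : (a * (τ / β)) ^ 3 / c * β ^ 4 = a ^ 3 / c * τ ^ 3 * β := by field_simp
      rw [this, ← hc2]
      have : c ^ 2 / c = c := by field_simp
      rw [this]
      gcongr

/-- The bound for a fixed window length, at the right window length. -/
theorem fixed_window_cost_le {d T : ℕ} {a τ β B r C : ℝ} (R : ℝ≥0) (ha : 1 ≤ a)
    (hd : 1 ≤ d) (hτT : τ ^ 4 = T) (hT : 4 ≤ T) (haτ : a ^ 2 ≤ τ) (hτ : 0 < τ)
    (hblock : blockLength d T = ⌊a ^ 2 * τ ^ 2⌋₊) (hC : 0 < C) (hB : 0 ≤ B) (hBβ : B ≤ β ^ 4)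
    (hβ : 1 ≤ β) (hr : 1 ≤ r) (hra : r ≤ a * τ)
    (hr1 : τ ^ 4 * (radiusScale d R * √d) / r ≤ a ^ 2 * τ ^ 3 * β)
    (hr2 : r ^ 3 / radiusScale d R * β ^ 4 ≤ a ^ 2 * τ ^ 3 * β) :
    ∃ j : Arm d T,
      C * (numBlocks d T * ((1 + Real.log T) ^ 2 * radiusScale d R * √d * blockLength d T /
            √(windowLength d T j)) +
          windowLength d T j * √(windowLength d T j) / radiusScale d R * B) +
        2 * (numBlocks d T * blockLength d T) * (T : ℝ) ^ (-(1 / 4) : ℝ) ≤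
      (9 * C + 4) * (a ^ 2 * τ ^ 3 * β * (1 + Real.log T) ^ 2) := by
  obtain ⟨h1, h2, h3, h4, h5, h6, h7, h8⟩ := parameter_bounds ha hτT hT haτ hτ hblock
  have hH' : (2 : ℝ) ≤ blockLength d T := by exact_mod_cast h1
  have hT' : (4 : ℝ) ≤ T := by exact_mod_cast hT
  have hlT : 0 ≤ Real.log T := Real.log_nonneg (by linarith)
  have hg := one_le_radiusScale hd R
  have hr2' : r ^ 2 ≤ 2 * blockLength d T := by
    calc r ^ 2 ≤ (a * τ) ^ 2 := by gcongr
      _ = a ^ 2 * τ ^ 2 := by ring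
      _ ≤ _ := h4
  -- The minimum is needed because `H` is rounded down and `r²` may exceed it slightly. As `r² ≤ 2
  -- H`, this turns the grid constant 6 into 12.
  obtain ⟨j, hj1, hj2⟩ := exists_windowLength (d := d) (T := T) h1
    (y := min (r ^ 2) (blockLength d T)) (le_min (one_le_pow₀ hr) (by linarith)) (min_le_right _ _)
  refine ⟨j, ?_⟩
  have hw1 : 1 ≤ windowLength d T j := one_le_windowLength (by omega) j
  have hw1' : (1 : ℝ) ≤ windowLength d T j := by exact_mod_cast hw1
  set w : ℝ := (windowLength d T j : ℝ)
  have hwr : w ≤ r ^ 2 := hj1.trans (min_le_left _ _)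
  have hrw : r ^ 2 ≤ 12 * w := by
    have : r ^ 2 / 2 ≤ min (r ^ 2) (blockLength d T) := le_min (by nlinarith) (by linarith)
    linarith
  have hsw : √w ≤ r := Real.sqrt_le_iff.2 ⟨by linarith, hwr⟩
  have hsw0 : 0 < √w := Real.sqrt_pos.2 (by linarith)
  have hrs : r ≤ 4 * √w := by
    refine (le_abs_self _).trans (abs_le_of_sq_le_sq ?_ (by positivity))
    rw [mul_pow, Real.sq_sqrt (by linarith)]
    linarith
  set g := radiusScale d R
  set Λ := 1 + Real.log T
  have hΛ : 1 ≤ Λ := by simp only [Λ]; linarith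
  set n : ℝ := (numBlocks d T : ℝ)
  set H : ℝ := (blockLength d T : ℝ)
  set U := a ^ 2 * τ ^ 3 * β
  have hΛ2 : 1 ≤ Λ ^ 2 := one_le_pow₀ hΛ
  have ha2 : 1 ≤ a ^ 2 := one_le_pow₀ ha
  have hU0 : 0 ≤ U := by positivity
  have e1 : n * (Λ ^ 2 * g * √d * H / √w) ≤ 8 * (U * Λ ^ 2) := by
    have h9 : 1 / √w ≤ 4 / r := by
      rw [div_le_div_iff₀ hsw0 (by linarith)]; linarith
    calc n * (Λ ^ 2 * g * √d * H / √w) = n * H * (Λ ^ 2 * (g * √d)) * (1 / √w) := by ring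
      _ ≤ 2 * T * (Λ ^ 2 * (g * √d)) * (4 / r) := by gcongr
      _ = 8 * Λ ^ 2 * (τ ^ 4 * (g * √d) / r) := by rw [← hτT]; ring
      _ ≤ 8 * Λ ^ 2 * U := by gcongr
      _ = _ := by ring
  have e2 : w * √w / g * B ≤ U * Λ ^ 2 := by
    calc w * √w / g * B ≤ r ^ 2 * r / g * β ^ 4 := by gcongr
      _ = r ^ 3 / g * β ^ 4 := by ring
      _ ≤ U := hr2
      _ ≤ U * Λ ^ 2 := le_mul_of_one_le_right hU0 hΛ2
  have e5 : 1 * τ ^ 3 * 1 ≤ U := by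
    simp only [U]
    gcongr
  have hτr : (T : ℝ) ^ (-(1 / 4) : ℝ) = 1 / τ := by
    rw [← hτT, ← Real.rpow_natCast, ← Real.rpow_mul hτ.le]
    norm_num
    rw [Real.rpow_neg_one]
  have e3 : 2 * (n * H) * (T : ℝ) ^ (-(1 / 4) : ℝ) ≤ 4 * (U * Λ ^ 2) := by
    rw [hτr]
    calc 2 * (n * H) * (1 / τ) ≤ 2 * (2 * T) * (1 / τ) := by gcongr
      _ = 4 * τ ^ 3 := by rw [← hτT]; field_simp; ring
      _ = 4 * (1 * τ ^ 3 * 1 * 1) := by ring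
      _ ≤ 4 * (U * Λ ^ 2) := by gcongr
  have e4 := mul_le_mul_of_nonneg_left (add_le_add e1 e2) hC.le
  linarith

end BOB

end

/-! ### The regret bound -/

theorem theorem4 :
    ∃ k : ℕ, ∀ (R : ℝ≥0) (L S lam : ℝ), 0 < L → 0 < S → 0 < lam →
      ∃ C : ℝ, ∀ (d T : ℕ), 1 ≤ d → 1 ≤ T → ∀ (B : ℝ), 0 ≤ B →
        ∀ (D : ℕ → Set (BOB.Vec d)) (θ : ℕ → BOB.Vec d),
          BOB.IsNormalized T L S D θ → θ ∈ BOB.variationClass d T B →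
        ∀ (ν : Measure ℝ) [IsProbabilityMeasure ν], HasSubgaussianMGF id (R ^ 2) ν →
        ∀ {Ω : Type*} {mΩ : MeasurableSpace Ω} (P : Measure Ω) [IsProbabilityMeasure P]
          (𝓕 : Filtration ℕ mΩ) (arm : ℕ → Ω → BOB.Arm d T) (X : ℕ → Ω → BOB.Vec d)
          (η : ℕ → Ω → ℝ),
          BOB.IsRun d T R L S lam D θ ν P 𝓕 arm X η →
          BOB.expectedRegret P T D θ X ≤
            C * (d : ℝ) ^ (2 / 3 : ℝ) * (B + 1) ^ (1 / 4 : ℝ) * (T : ℝ) ^ (3 / 4 : ℝ) *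
              (1 + Real.log T) ^ k := by
  -- Two logarithmic factors suffice: for SW-UCB, one from the radius and one from the elliptical
  -- potential; for EXP3, one from the reward scale and one from the number of arms.
  refine ⟨2, fun R L S lam hL hS hlam => ?_⟩
  obtain ⟨C, hC, hmain⟩ := BOB.exists_expectedRegret_le R hlam hL hS
  -- The summands pay for the fixed window, for EXP3 and, with the final 8, for the regimes where
  -- the trivial bound `2 T` is used.
  refine ⟨9 * C + 4 + (400 * (2 + 4 * R) + 512 * (R : ℝ) ^ 2) + 8, ?_⟩
  intro d T hd hT B hB D θ hD hθ ν _ hν Ω mΩ P _ 𝓕 arm X η h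
  have hd' : (1 : ℝ) ≤ d := by exact_mod_cast hd
  have hT' : (1 : ℝ) ≤ T := by exact_mod_cast hT
  have hlT : 0 ≤ Real.log T := Real.log_nonneg hT'
  set a : ℝ := (d : ℝ) ^ (1 / 3 : ℝ) with ha
  set τ : ℝ := (T : ℝ) ^ (1 / 4 : ℝ) with hτ
  set β : ℝ := (B + 1) ^ (1 / 4 : ℝ) with hβ
  have ha1 : 1 ≤ a := Real.one_le_rpow hd' (by norm_num)
  have hτ1 : 1 ≤ τ := Real.one_le_rpow hT' (by norm_num)
  have hβ1 : 1 ≤ β := Real.one_le_rpow (by linarith) (by norm_num)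
  have ha2 : (d : ℝ) ^ (2 / 3 : ℝ) = a ^ 2 := by
    rw [ha, ← Real.rpow_natCast, ← Real.rpow_mul (by linarith)]; norm_num
  have ha3 : a ^ 3 = d := by
    rw [ha, ← Real.rpow_natCast, ← Real.rpow_mul (by linarith)]; norm_num
  have hτ3 : (T : ℝ) ^ (3 / 4 : ℝ) = τ ^ 3 := by
    rw [hτ, ← Real.rpow_natCast, ← Real.rpow_mul (by linarith)]; norm_num
  have hτ2 : (T : ℝ) ^ (1 / 2 : ℝ) = τ ^ 2 := by
    rw [hτ, ← Real.rpow_natCast, ← Real.rpow_mul (by linarith)]; norm_num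
  have hτ4 : τ ^ 4 = T := by
    rw [hτ, ← Real.rpow_natCast, ← Real.rpow_mul (by linarith)]; norm_num
  have hβ4 : β ^ 4 = B + 1 := by
    rw [hβ, ← Real.rpow_natCast, ← Real.rpow_mul (by linarith)]; norm_num
  have hblock : BOB.blockLength d T = ⌊a ^ 2 * τ ^ 2⌋₊ := by
    rw [BOB.blockLength, ha2, hτ2]
  rw [ha2, hτ3]
  set Λ := 1 + Real.log T with hΛdef
  have hΛ1 : 1 ≤ Λ := by linarith
  have hΛ2 : 1 ≤ Λ ^ 2 := one_le_pow₀ hΛ1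
  have ha21 : 1 ≤ a ^ 2 := one_le_pow₀ ha1
  set c := 9 * C + 4 + (400 * (2 + 4 * (R : ℝ)) + 512 * (R : ℝ) ^ 2) with hc
  have hc0 : 0 ≤ c := by positivity
  set U := a ^ 2 * β * τ ^ 3 * Λ ^ 2 with hU
  have hU0 : 0 ≤ U := by positivity
  have hgoal : (c + 8) * a ^ 2 * β * τ ^ 3 * Λ ^ 2 = (c + 8) * U := by rw [hU]; ring
  rw [hgoal]
  have htriv := h.expectedRegret_le_two_mul hD
  have hsuff : 2 * (T : ℝ) ≤ 8 * U → BOB.expectedRegret P T D θ X ≤ (c + 8) * U := by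
    intro h1
    nlinarith [mul_nonneg hc0 hU0]
  have hT4 : (T : ℝ) = τ * τ ^ 3 := by rw [← hτ4]; ring
  -- In each of the next three cases `T ≤ 4 U`: either `T < 4`, or one of `d^(2/3)`, `(B + 1)^(1/4)`
  -- exceeds the missing factor `τ = T^(1/4)`.
  by_cases c1 : T < 4
  · refine hsuff ?_
    have h1 : (T : ℝ) ≤ 4 := by exact_mod_cast c1.le
    have h2 : 1 ≤ U := by
      have : 1 ≤ τ ^ 3 := one_le_pow₀ hτ1
      calc (1 : ℝ) = 1 * 1 * 1 * 1 := by norm_num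
        _ ≤ a ^ 2 * β * τ ^ 3 * Λ ^ 2 := by gcongr
    linarith
  push Not at c1
  by_cases c2 : τ < a ^ 2
  · refine hsuff ?_
    have h1 : (T : ℝ) ≤ U := by
      calc (T : ℝ) = τ * 1 * τ ^ 3 * 1 := by rw [hT4]; ring
        _ ≤ a ^ 2 * β * τ ^ 3 * Λ ^ 2 := by gcongr
    linarith
  push Not at c2
  by_cases c3 : τ < β
  · refine hsuff ?_
    have h1 : (T : ℝ) ≤ U := by
      calc (T : ℝ) = 1 * τ * τ ^ 3 * 1 := by rw [hT4]; ring
        _ ≤ a ^ 2 * β * τ ^ 3 * Λ ^ 2 := by gcongr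
    linarith
  push Not at c3
  have hτ0 : 0 < τ := by linarith
  obtain ⟨h1, h2, h3, h4, h5, h6, h7, h8⟩ := BOB.parameter_bounds ha1 hτ4 c1 c2 hτ0 hblock
  have hn : 1 ≤ BOB.numBlocks d T := by
    have := BOB.le_numBlocks_mul (d := d) (T := T) (by omega)
    by_contra hc
    have h0 : BOB.numBlocks d T = 0 := by omega
    rw [h0, zero_mul] at this
    omega
  by_cases c4 : BOB.exploration d T < 1
  · have hγ0 := (BOB.exploration_bounds h7 h8 hn c4).1
    obtain ⟨r, hr1, hr2, hr3, hr4⟩ := BOB.exists_window_scale hd R ha1 ha3 hβ1 c3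
    obtain ⟨j, hj⟩ := BOB.fixed_window_cost_le (B := B) R ha1 hd hτ4 c1 c2 hτ0 hblock hC hB
      (by linarith) hβ1 hr1 hr2 hr3 hr4
    have hreg := hmain d T D θ B ν P 𝓕 arm X η j h hν hD hθ hd (by omega) (by omega) h2 hγ0 c4
    have hexp := BOB.exp3_cost_le R ha1 hτ4 c1 c2 hτ0 hblock c4
    refine hreg.trans ((add_le_add hj hexp).trans ?_)
    have e1 : a ^ 2 * τ ^ 3 * β * (1 + Real.log T) ^ 2 = U := by rw [hU]; ring
    have e2 : a ^ 2 * τ ^ 3 * (1 + Real.log T) ^ 2 ≤ U := by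
      calc a ^ 2 * τ ^ 3 * (1 + Real.log T) ^ 2 = a ^ 2 * 1 * τ ^ 3 * Λ ^ 2 := by ring
        _ ≤ U := by rw [hU]; gcongr
    rw [e1]
    have e3 := mul_le_mul_of_nonneg_left e2
      (show 0 ≤ 400 * (2 + 4 * (R : ℝ)) + 512 * (R : ℝ) ^ 2 by positivity)
    rw [hc]
    linarith
  · refine hsuff ?_
    have h9 := BOB.numBlocks_le_of_exploration_eq_one h7 h8 hn c4
    have h10 : (T : ℝ) ≤ BOB.numBlocks d T * BOB.blockLength d T := by
      exact_mod_cast BOB.le_numBlocks_mul (d := d) (T := T) (by omega)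
    have h11 : (T : ℝ) ≤ 4 * U := by
      calc (T : ℝ) ≤ BOB.numBlocks d T * BOB.blockLength d T := h10
        _ ≤ 4 * Λ ^ 2 * (a ^ 2 * τ ^ 2) := by gcongr
        _ = 4 * (a ^ 2 * 1 * τ ^ 2 * Λ ^ 2) := by ring
        _ ≤ 4 * (a ^ 2 * β * τ ^ 3 * Λ ^ 2) := by
            gcongr
            norm_num
    linarith
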